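/- For $N\ge 1$ and even $k\ge 0$ let $M_k(N)$ be the space of modular forms of weight $k$ for $\Gamma_0(N)$ with trivial character, $S_k(N)\subset M_k(N)$ the cusp forms, $M(N)=\bigoplus_{k \text{ even}}M_k(N)$ the graded ring of modular forms, regarded as a ring of functions on the upper half plane, and $S(N)=\bigoplus_{k \text{ even}}S_k(N)$ its cuspidal ideal. For a character $\chi$ let $M_k(N,\chi)$ be the forms of weight $k$ and character $\chi$; $\chi_D$ denotes the quadratic character of discriminant $D$. For $p^e$ exactly dividing $N$ let $w_{p^e}$ be the Atkin–Lehner involution of $M(N)$; a superscript $\pm$ (for $N=6$ two signs, for $w_2$ and $w_3$ in this order) indicates its eigenvalue. With $q=e^{2\pi i z}$ put $$\Theta=\sum_{(x,y)\in\mathbb Z^2}q^{x^2+xy+y^2},\qquad \theta=\sum_{x\in\mathbb Z}q^{x^2},\qquad \eta=q^{1/24}\prod_{n\ge1}(1-q^n),$$ and write $f_t(z)=f(tz)$. Let $Q=E_4$, $R=E_6$ be the normalized Eisenstein series of level $1$. Then: **Level 1.** $M(1)\subset M(N)$ for $N=2,3,4,6,8$, and $$Q=\Theta_1(5\Theta_1^3+12\Theta_1^2\Theta_2-16\Theta_2^3)=\theta_1^8+56\theta_1^6\theta_2^2-40\theta_1^4\theta_2^4-32\theta_1^2\theta_2^6+16\theta_2^8,$$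 $$R=(\Theta_1^2+2\Theta_1\Theta_2-2\Theta_2^2)(-11\Theta_1^4-20\Theta_1^3\Theta_2+16\Theta_1\Theta_2^3+16\Theta_2^4)$$ $$\phantom{R}=(\theta_1^4+4\theta_1^2\theta_2^2-4\theta_2^4)(\theta_1^8-136\theta_1^6\theta_2^2+152\theta_1^4\theta_2^4-32\theta_1^2\theta_2^6+16\theta_2^8).$$ **Level 2.** Let $A=\theta_1^4+4\theta_1^2\theta_2^2-4\theta_2^4$ and $B=\theta_1^8-24\theta_1^6\theta_2^2+40\theta_1^4\theta_2^4-32\theta_1^2\theta_2^6+16\theta_2^8$. Then $A\in M_2(2)^-$, $B\in M_4(2)^-$, these are algebraically independent, and $M(2)=\mathbb C[A,B]$ as graded rings. The ideal $S(2)$ is generated by $\eta_1^8\eta_2^8=2^{-8}(A^4-B^2)\in S_8(2)^+$. **Level 3.** Let $\Phi=4\Theta_2^3-3\Theta_1^2\Theta_2$. Then $\Theta\in M_1(3,\chi_{-3})$ and $\Phi\in M_3(3,\chi_{-3})$ are algebraically independent, and $M(3)$ is the even weight part of $\widehat M(3)=\mathbb C[\Theta,\Phi]$ (weights $1$, $3$),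 weight by weight. The automorphism $\Theta\mapsto i\Theta$, $\Phi\mapsto i\Phi$ of $\widehat M(3)$ restricts to $w_3$ on $M(3)$. The ideal $S(3)$ is generated by $\eta_1^6\eta_3^6=2^{-2}3^{-3}(\Theta^6-\Phi^2)\in S_6(3)^-$. **Level 4.** Let $D=\theta_1^4-8\theta_1^2\theta_2^2+8\theta_2^4$ and $C=\theta^4$. Then $\theta$, $D$ are algebraically independent, and $M(4)$ is the even weight part of $\widehat M(4)=\mathbb C[\theta,D]$ (weights $1/2$, $2$), weight by weight; for odd $k\ge1$ the weight $k$ part of $\widehat M(4)$ is $M_k(4,\chi_{-4})$. For every primitive eighth root of unity $\rho$ the automorphism $\theta\mapsto\rho\theta$, $D\mapsto D$ of $\widehat M(4)$ restricts to $w_4$ on $M(4)$. One has $C\in M_2(4)^-$, $D\in M_2(4)^+$, these are algebraically independent, and $M(4)=\mathbb C[C,D]$ as graded rings. The ideal $S(4)$ is generated by $\eta_2^{12}=2^{-6}C(C^2-D^2)\in S_6(4)^-$. **Level 6.** $\Theta_1$, $\Theta_2$ are algebraically independent, and $M(6)=\mathbb C[\Theta_1^2,\Theta_1\Theta_2,\Theta_2^2]$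 is the even weight part of $\widehat M(6)=\mathbb C[\Theta_1,\Theta_2]$ (weights $1$, $1$), weight by weight. The space $M_2(6)$ has the basis $$s=\Theta_1^2+2\Theta_2^2\in M_2(6)^{+-},\quad p=\Theta_1\Theta_2\in M_2(6)^{-+},\quad d=\Theta_1^2-2\Theta_2^2\in M_2(6)^{--},$$ where $s^2-d^2=8p^2$, and every element of $M(6)$ is $f_1(s,p)+d\,f_2(s,p)$ for unique polynomials $f_1,f_2$. The ideal $S(6)$ is generated by $\eta_1^2\eta_2^2\eta_3^2\eta_6^2=2^{-2}3^{-2}(9p^2-s^2)\in S_4(6)^{++}$. **Level 8.** $\theta_1$, $\theta_2$ are algebraically independent; let $\widehat M(8)=\mathbb C[\theta_1,\theta_2]$ (weights $1/2$, $1/2$). Its integral weight part is generated by $\theta_1^2,\theta_2^2\in M_1(8,\chi_{-4})$ and $\theta_1\theta_2\in M_1(8,\chi_{-8})$. One has $M(8)=\mathbb C[\theta_1^4,\theta_1^2\theta_2^2,\theta_2^4]$. For even $k\ge0$ the weight $k$ part of $\widehat M(8)$ is $M_k(8)+M_k(8,\chi_8)$, where $M_k(8)$ is spanned by the monomials $\theta_1^i\theta_2^j$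 with $i+j=2k$ and $i,j$ both even, and $M_k(8,\chi_8)$ by those with $i+j=2k$ and $i,j$ both odd. The ideal $S(8)$ is generated by $\eta_2^4\eta_4^4=2^{-2}\theta_1^2\theta_2^2(-\theta_1^2+\theta_2^2)(\theta_1^2-2\theta_2^2)\in S_4(8)^+$. -/

import Mathlib

noncomputable section

open UpperHalfPlane CongruenceSubgroup
open scoped MatrixGroups ModularForm

namespace SmallLevel

/-! ### Spaces and graded rings of modular forms, as functions on the upper half plane -/

/-- The space `M_k(N)` of modular forms of weight `k` for `Γ₀(N)` with trivial character. -/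
def Mk (N : ℕ) (k : ℤ) : Submodule ℂ (ℍ → ℂ) where
  carrier := {f | ∃ F : ModularForm (Gamma0 N : Subgroup (GL (Fin 2) ℝ)) k, ⇑F = f}
  zero_mem' := ⟨0, rfl⟩
  add_mem' := by
    rintro _ _ ⟨F, rfl⟩ ⟨G, rfl⟩
    exact ⟨F + G, rfl⟩
  smul_mem' := by
    rintro c _ ⟨F, rfl⟩
    exact ⟨c • F, rfl⟩

/-- The space `S_k(N)` of cusp forms of weight `k` for `Γ₀(N)` with trivial character. -/
def Sk (N : ℕ) (k : ℤ) : Submodule ℂ (ℍ → ℂ) where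
  carrier := {f | ∃ F : CuspForm (Gamma0 N : Subgroup (GL (Fin 2) ℝ)) k, ⇑F = f}
  zero_mem' := ⟨0, rfl⟩
  add_mem' := by
    rintro _ _ ⟨F, rfl⟩ ⟨G, rfl⟩
    exact ⟨F + G, rfl⟩
  smul_mem' := by
    rintro c _ ⟨F, rfl⟩
    exact ⟨c • F, rfl⟩

/-- The space `M_k(N, χ)` for an integer-valued (quadratic) character `χ` modulo a divisor `m`
of `N`: modular forms `f` for `Γ₁(N)` with `f ∣[k] γ = χ(d) f` for every
`γ = (a, b; c, d) ∈ Γ₀(N)`. -/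
def MkChar (N : ℕ) {m : ℕ} (χ : MulChar (ZMod m) ℤ) (k : ℤ) : Submodule ℂ (ℍ → ℂ) where
  carrier := {f | (∃ F : ModularForm (Gamma1 N : Subgroup (GL (Fin 2) ℝ)) k, ⇑F = f) ∧
    ∀ γ ∈ Gamma0 N, f ∣[k] γ = ((χ ((γ 1 1 : ℤ) : ZMod m) : ℤ) : ℂ) • f}
  zero_mem' := ⟨⟨0, rfl⟩, fun γ _ => by simp⟩
  add_mem' := by
    rintro _ _ ⟨⟨F, rfl⟩, hF⟩ ⟨⟨G, rfl⟩, hG⟩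
    refine ⟨⟨F + G, rfl⟩, fun γ hγ => ?_⟩
    rw [SlashAction.add_slash, hF γ hγ, hG γ hγ, smul_add]
  smul_mem' := by
    rintro c _ ⟨⟨F, rfl⟩, hF⟩
    refine ⟨⟨c • F, rfl⟩, fun γ hγ => ?_⟩
    rw [ModularForm.SL_smul_slash, hF γ hγ, smul_comm]

theorem one_mem_Mk (N : ℕ) : (1 : ℍ → ℂ) ∈ Mk N 0 := ⟨1, rfl⟩

theorem mul_mem_Mk {N : ℕ} {k l : ℤ} {f g : ℍ → ℂ} (hf : f ∈ Mk N k) (hg : g ∈ Mk N l) :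
    f * g ∈ Mk N (k + l) := by
  obtain ⟨F, rfl⟩ := hf
  obtain ⟨G, rfl⟩ := hg
  exact ⟨F.mul G, rfl⟩

theorem mul_mem_Sk {N : ℕ} {k l : ℤ} {f g : ℍ → ℂ} (hf : f ∈ Mk N k) (hg : g ∈ Sk N l) :
    f * g ∈ Sk N (k + l) := by
  obtain ⟨F, rfl⟩ := hf
  obtain ⟨G, rfl⟩ := hg
  exact ⟨(G.mulModularForm F).mcast (add_comm l k), mul_comm _ _⟩

/-- The sum of all the `M_k(N)`, with `k` running over the non-negative even integers. -/
def MSum (N : ℕ) : Submodule ℂ (ℍ → ℂ) := ⨆ n : ℕ, Mk N (2 * n)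

/-- The sum of all the `S_k(N)`, with `k` running over the non-negative even integers. -/
def SSum (N : ℕ) : Submodule ℂ (ℍ → ℂ) := ⨆ n : ℕ, Sk N (2 * n)

theorem mul_mem_MSum {N : ℕ} {f g : ℍ → ℂ} (hf : f ∈ MSum N) (hg : g ∈ MSum N) :
    f * g ∈ MSum N := by
  refine Submodule.iSup_induction _ (motive := fun f => f * g ∈ MSum N) hf
    (fun m f hf => ?_) (by simp) (fun a b ha hb => by rw [add_mul]; exact add_mem ha hb)
  refine Submodule.iSup_induction _ (motive := fun g => f * g ∈ MSum N) hg
    (fun n g hg => ?_) (by simp) (fun a b ha hb => by rw [mul_add]; exact add_mem ha hb)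
  refine Submodule.mem_iSup_of_mem (m + n) ?_
  have h := mul_mem_Mk hf hg
  rwa [show (2 * m + 2 * n : ℤ) = 2 * ((m + n : ℕ) : ℤ) by push_cast; ring] at h

theorem mul_mem_SSum {N : ℕ} {f g : ℍ → ℂ} (hf : f ∈ MSum N) (hg : g ∈ SSum N) :
    f * g ∈ SSum N := by
  refine Submodule.iSup_induction _ (motive := fun f => f * g ∈ SSum N) hf
    (fun m f hf => ?_) (by simp) (fun a b ha hb => by rw [add_mul]; exact add_mem ha hb)
  refine Submodule.iSup_induction _ (motive := fun g => f * g ∈ SSum N) hg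
    (fun n g hg => ?_) (by simp) (fun a b ha hb => by rw [mul_add]; exact add_mem ha hb)
  refine Submodule.mem_iSup_of_mem (m + n) ?_
  have h := mul_mem_Sk hf hg
  rwa [show (2 * m + 2 * n : ℤ) = 2 * ((m + n : ℕ) : ℤ) by push_cast; ring] at h

/-- The ring `M(N)` of modular forms for `Γ₀(N)` with trivial character. -/
def M (N : ℕ) : Subalgebra ℂ (ℍ → ℂ) :=
  (MSum N).toSubalgebra
    (Submodule.mem_iSup_of_mem 0 (by simpa using one_mem_Mk N))
    (fun _ _ hf hg => mul_mem_MSum hf hg)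

/-- The cuspidal ideal `S(N)` of the ring `M(N)`. -/
def S (N : ℕ) : Ideal (M N) where
  carrier := {f | (f : ℍ → ℂ) ∈ SSum N}
  zero_mem' := (SSum N).zero_mem
  add_mem' := fun ha hb => (SSum N).add_mem ha hb
  smul_mem' := fun c _ hf => mul_mem_SSum c.2 hf

/-- The Atkin–Lehner operator `w_Q` on `M_k(N)`, `k` even, sends `f` to `g`. Every matrix
`W = (Q x, y; N z, Q w)` of determinant `Q` gives the operator, `W` acting as
`(w_Q f)(τ) = Q ^ (k/2) (N z τ + Q w) ^ (-k) f(W τ)`; the slash action of Mathlib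
carries the factor `Q ^ (k-1)` in place of `Q ^ (k/2)`. -/
def AtkinLehner (N Q : ℕ) (k : ℤ) (f g : ℍ → ℂ) : Prop :=
  ∀ (x y z w : ℤ) (W : GL (Fin 2) ℝ), (Q : ℤ) ^ 2 * x * w - N * y * z = Q →
    (W : Matrix (Fin 2) (Fin 2) ℝ) = !![(Q * x : ℝ), (y : ℝ); (N * z : ℝ), (Q * w : ℝ)] →
    (Q : ℂ) ^ (1 - k / 2) • (f ∣[k] W) = g

/-! ### Graded rings on two generators -/

/-- The ring `ℂ[f, g]` inside the ring of functions on the upper half plane. -/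
def hatM (f g : ℍ → ℂ) : Subalgebra ℂ (ℍ → ℂ) := Algebra.adjoin ℂ {f, g}

/-- The weight `k` part of `ℂ[f, g]`, where `f` and `g` are given the weights `a` and `b`. -/
def hatMk (f g : ℍ → ℂ) (a b k : ℚ) : Submodule ℂ (ℍ → ℂ) :=
  Submodule.span ℂ {F | ∃ i j : ℕ, a * i + b * j = k ∧ F = f ^ i * g ^ j}

/-- The even weight part of `ℂ[f, g]`, where `f` and `g` are given the weights `a` and `b`. -/
def hatMEven (f g : ℍ → ℂ) (a b : ℚ) : Submodule ℂ (ℍ → ℂ) :=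
  ⨆ n : ℕ, hatMk f g a b (2 * n)

/-! ### Theta series, eta function, and the forms built from them -/

/-- The push-up `f_t(z) = f(t z)`, as a function on the upper half plane. -/
def push (f : ℂ → ℂ) (t : ℕ) : ℍ → ℂ := fun z => f (t * z)

/-- `Θ = ∑_{(x, y) ∈ ℤ²} q ^ (x² + x y + y²)`, `q = exp (2 π i z)`. -/
def Theta (z : ℂ) : ℂ :=
  ∑' v : ℤ × ℤ,
    Complex.exp (2 * Real.pi * Complex.I * (v.1 ^ 2 + v.1 * v.2 + v.2 ^ 2 : ℤ) * z)

/-- `θ = ∑_{x ∈ ℤ} q ^ (x²)`, `q = exp (2 π i z)`. -/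
def theta (z : ℂ) : ℂ :=
  ∑' x : ℤ, Complex.exp (2 * Real.pi * Complex.I * (x ^ 2 : ℤ) * z)

/-- `Θ_t(z) = Θ(t z)`. -/
abbrev Th (t : ℕ) : ℍ → ℂ := push Theta t

/-- `θ_t(z) = θ(t z)`. -/
abbrev th (t : ℕ) : ℍ → ℂ := push theta t

/-- `η_t(z) = η(t z)`. -/
abbrev et (t : ℕ) : ℍ → ℂ := push ModularForm.eta t

/-- The Eisenstein series `Q = E₄` of level one. -/
def Q : ℍ → ℂ := ⇑ModularForm.E₄

/-- The Eisenstein series `R = E₆` of level one. -/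
def R : ℍ → ℂ := ⇑ModularForm.E₆

/-- The form `A` of level `2` and weight `2`. -/
def A : ℍ → ℂ := th 1 ^ 4 + 4 * th 1 ^ 2 * th 2 ^ 2 - 4 * th 2 ^ 4

/-- The form `B` of level `2` and weight `4`. -/
def B : ℍ → ℂ :=
  th 1 ^ 8 - 24 * th 1 ^ 6 * th 2 ^ 2 + 40 * th 1 ^ 4 * th 2 ^ 4 - 32 * th 1 ^ 2 * th 2 ^ 6
    + 16 * th 2 ^ 8

/-- The form `Φ` of level `3` and weight `3`. -/
def Phi : ℍ → ℂ := 4 * Th 2 ^ 3 - 3 * Th 1 ^ 2 * Th 2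

/-- The form `C = θ⁴` of level `4` and weight `2`. -/
def C : ℍ → ℂ := th 1 ^ 4

/-- The form `D` of level `4` and weight `2`. -/
def D : ℍ → ℂ := th 1 ^ 4 - 8 * th 1 ^ 2 * th 2 ^ 2 + 8 * th 2 ^ 4

/-- The form `s` of level `6` and weight `2`. -/
def s : ℍ → ℂ := Th 1 ^ 2 + 2 * Th 2 ^ 2

/-- The form `p` of level `6` and weight `2`. -/
def p : ℍ → ℂ := Th 1 * Th 2

/-- The form `d` of level `6` and weight `2`. -/
def d : ℍ → ℂ := Th 1 ^ 2 - 2 * Th 2 ^ 2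

/-- The character `χ_{-3}`, that is, the Legendre symbol modulo `3`. -/
def chi3 : MulChar (ZMod 3) ℤ := quadraticChar (ZMod 3)

end SmallLevel

end

open SmallLevel

/-!
The theta series `θ`, `Θ` and their push-ups are expressed in the three Jacobi theta functions
`T2`, `T3`, `T4`, which `SL₂(ℤ)` permutes up to an automorphy factor. The identities between Jacobi
theta functions of arguments `z`, `2 z`, `4 z` (and, for `Θ`, `3 z`) are proved by rearranging
double series. They give the behaviour of all the forms under `z ↦ z + 1` and under the Fricke
involution, and hence, for `N = 2, 3, 4`, their modularity (`IsForm.of_fricke`), since `Γ₀(N)` is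
generated up to sign by `T` and `(1, 0; N, 1)`; levels `6` and `8` are reached by the substitution
`z ↦ 2 z`. Only `θ₁ θ₂`, of character `χ₋₈`, needs an argument of its own (`isForm_th_mul_th`).

*Generators.* At each level there are two forms `g`, `G` of weights `a`, `m a`, with `g` having
limit `1` at `i∞`, for which `e = g ^ m - G` has a simple zero at the cusp `i∞` and no other zero. At
levels `2`, `4`, `8` this is read off from an expression of `e` as an eta quotient, whose orders at
the cusps are known (`hasCuspOrder_et`); at levels `3` and `6` the form `e` is a factor of an eta
product, and its values at the other cusps are computed by Atkin–Lehner matrices. If `f` is a form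
of weight `k a` with value `c` at `i∞`, then `f - c g ^ k` is divisible by `e`, and the quotient has
smaller weight. Induction shows that the monomials in `g` and `G` span (`IsForm.mem_span_pow`). This
covers the nontrivial characters as well; forms of level `8` and character `χ₈` are multiplied by
`θ₁ θ₂` first (`MkChar_eight_eq`).

*Cusp forms.* The eta products have no zeros in the upper half plane and vanish at every cusp
exactly to first order in the local parameter, so that every cusp form is divisible by them
(`IsCuspGenerator.S_eq_span`). They are identified with polynomials in theta series by means of
`T2 T3 T4 = 2 η ^ 3` (`thetaProd_eq`) and `η(z) T2(z) = 2 η(2 z) ^ 2`.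

*Algebraic independence.* Along an orbit of the powers of `(1, 0; N, 1)` a form of positive weight
takes infinitely many values while a quotient of weight zero is constant; if the quotient is not
constant, the forms satisfy no polynomial relation (`algebraicIndependent_of_tendsto`).

*Atkin–Lehner operators and level one.* On modular forms an Atkin–Lehner operator may be computed
with a single matrix (`atkinLehner_of_isForm`). The form `E₄` lies in the rings of level `2` and `3`
and `E₆` in that of level `2`, and the few coefficients are found from the values at the cusps
(`coeff_eq_of_fricke`). The expression of `E₆` in `Θ₁`, `Θ₂` follows from `A = 2 p + d`
(`A_eq_level_six`).
-/

namespace SmallLevel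

open UpperHalfPlane CongruenceSubgroup Asymptotics Filter Topology
open scoped MatrixGroups ModularForm Manifold

/-! ### The automorphy factor and rescalings of the upper half plane -/

/-- The automorphy factor `c z + d` of `γ = (a, b; c, d)`. -/
noncomputable def autJ (γ : SL(2, ℤ)) (z : ℍ) : ℂ := ((γ 1 0 : ℤ) : ℂ) * z + ((γ 1 1 : ℤ) : ℂ)

lemma denom_eq_autJ (γ : SL(2, ℤ)) (z : ℍ) :
    denom (Matrix.SpecialLinearGroup.toGL ((Matrix.SpecialLinearGroup.map (Int.castRingHom ℝ)) γ))
      (z : ℂ) = autJ γ z :=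
  ModularGroup.denom_apply γ z

lemma autJ_ne_zero (γ : SL(2, ℤ)) (z : ℍ) : autJ γ z ≠ 0 := by
  rw [← denom_eq_autJ]
  exact denom_ne_zero _ z

lemma coe_smul_eq (γ : SL(2, ℤ)) (z : ℍ) :
    ((γ • z : ℍ) : ℂ) = (((γ 0 0 : ℤ) : ℂ) * z + ((γ 0 1 : ℤ) : ℂ)) / autJ γ z := by
  rw [coe_specialLinearGroup_apply]
  simp [autJ]

lemma autJ_mul (γ δ : SL(2, ℤ)) (z : ℍ) : autJ (γ * δ) z = autJ γ (δ • z) * autJ δ z := by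
  have h := autJ_ne_zero δ z
  have e : autJ γ (δ • z) = ((γ 1 0 : ℤ) : ℂ) * ((δ • z : ℍ) : ℂ) + ((γ 1 1 : ℤ) : ℂ) := rfl
  rw [e, coe_smul_eq]
  field_simp
  simp only [autJ, Matrix.SpecialLinearGroup.coe_mul, Matrix.mul_apply, Fin.sum_univ_two]
  push_cast
  ring

lemma slash_eq (f : ℍ → ℂ) (k : ℤ) (γ : SL(2, ℤ)) (z : ℍ) :
    (f ∣[k] γ) z = f (γ • z) * autJ γ z ^ (-k) := by
  rw [ModularForm.SL_slash_apply, denom_eq_autJ]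

/-- The map `z ↦ t z` of the upper half plane. -/
noncomputable def scale (t : ℕ) [NeZero t] (z : ℍ) : ℍ :=
  ⟨t * z, by
    have : (0 : ℝ) < t := Nat.cast_pos.mpr (NeZero.pos t)
    simpa using mul_pos this z.im_pos⟩

@[simp] lemma coe_scale (t : ℕ) [NeZero t] (z : ℍ) : (scale t z : ℂ) = t * z := rfl

lemma im_scale (t : ℕ) [NeZero t] (z : ℍ) : (scale t z).im = t * z.im := by
  rw [← coe_im, coe_scale]
  simp

lemma push_comp_scale (F : ℂ → ℂ) (s t : ℕ) [NeZero t] :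
    push F s ∘ scale t = push F (s * t) := by
  ext z
  simp [push, mul_assoc]

lemma mdifferentiable_scale (t : ℕ) [NeZero t] :
    MDifferentiable 𝓘(ℂ) 𝓘(ℂ) (scale t) := by
  intro z
  have h : MDifferentiableAt 𝓘(ℂ) 𝓘(ℂ) (fun z : ℍ => ofComplex ((t : ℂ) * (z : ℂ))) z := by
    refine MDifferentiableAt.comp (I' := 𝓘(ℂ)) z (g := ofComplex)
      (mdifferentiableAt_ofComplex (scale t z).im_pos) ?_
    exact MDifferentiableAt.comp (I' := 𝓘(ℂ)) z (g := fun x : ℂ => (t : ℂ) * x)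
      (by fun_prop : DifferentiableAt ℂ (fun x : ℂ => (t : ℂ) * x) (z : ℂ)).mdifferentiableAt
      (mdifferentiable_coe z)
  refine h.congr_of_eventuallyEq (Eventually.of_forall fun w => ?_)
  exact (ofComplex_apply (scale t w)).symm

/-- Hermite normal form of `(t, 0; 0, 1) γ`: with `g = gcd(c, t)` it equals
`δ (g, B; 0, t / g)` for some `δ ∈ SL₂(ℤ)`. -/
lemma exists_scale_smul (t : ℕ) [NeZero t] (γ : SL(2, ℤ)) :
    ∃ (δ : SL(2, ℤ)) (w : ℍ → ℍ), ∀ z, scale t (γ • z) = δ • w z ∧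
      autJ γ z = (t / (Int.gcd (γ 1 0) t : ℕ) : ℂ) * autJ δ (w z) ∧
      (w z).im = (Int.gcd (γ 1 0) t : ℝ) ^ 2 / t * z.im := by
  have ht : (t : ℤ) ≠ 0 := by exact_mod_cast NeZero.ne t
  have hg0 : 0 < Int.gcd (γ 1 0) t := Int.gcd_pos_of_ne_zero_right _ ht
  obtain ⟨c', hc'⟩ : ((Int.gcd (γ 1 0) t : ℕ) : ℤ) ∣ γ 1 0 := Int.gcd_dvd_left ..
  obtain ⟨t', ht'⟩ : ((Int.gcd (γ 1 0) t : ℕ) : ℤ) ∣ t := Int.gcd_dvd_right ..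
  have hcop : IsCoprime c' t' := by
    have h1 := Int.isCoprime_iff_gcd_eq_one.mpr (Int.gcd_div_gcd_div_gcd (i := γ 1 0) (j := t) hg0)
    have hgz : ((Int.gcd (γ 1 0) t : ℕ) : ℤ) ≠ 0 := by exact_mod_cast hg0.ne'
    have e1 : γ 1 0 / ((Int.gcd (γ 1 0) t : ℕ) : ℤ) = c' :=
      Int.ediv_eq_of_eq_mul_right hgz hc'
    have e2 : (t : ℤ) / ((Int.gcd (γ 1 0) t : ℕ) : ℤ) = t' :=
      Int.ediv_eq_of_eq_mul_right hgz ht'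
    rwa [e1, e2] at h1
  set g : ℕ := Int.gcd (γ 1 0) t with hg
  have hdet : γ 0 0 * γ 1 1 - γ 0 1 * γ 1 0 = 1 := by
    have := γ.det_coe
    rwa [Matrix.det_fin_two] at this
  have hca : IsCoprime (γ 0 0) c' :=
    ⟨γ 1 1, -(γ 0 1 * g), by rw [hc'] at hdet; linear_combination hdet⟩
  obtain ⟨δ, hδ0, hδ1⟩ := IsCoprime.exists_SL2_col (hcop.symm.mul_left hca) 0
  have hdδ : t' * γ 0 0 * δ 1 1 - δ 0 1 * c' = 1 := by
    have := δ.det_coe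
    rwa [Matrix.det_fin_two, hδ0, hδ1] at this
  set B : ℤ := δ 1 1 * t * γ 0 1 - δ 0 1 * γ 1 1 with hB
  have htR : (0 : ℝ) < t := Nat.cast_pos.mpr (NeZero.pos t)
  have hgR : (0 : ℝ) < g := Nat.cast_pos.mpr hg0
  have ht'R : (t' : ℝ) = t / g := by
    rw [eq_div_iff hgR.ne']
    exact_mod_cast (by rw [mul_comm]; exact ht'.symm)
  have ht'C : (t' : ℂ) = t / g := by
    have := congrArg (fun x : ℝ => (x : ℂ)) ht'R
    push_cast at this
    exact this
  have ht'pos : (0 : ℝ) < t' := by rw [ht'R]; positivity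
  have ht'0 : (t' : ℂ) ≠ 0 := by
    exact_mod_cast ht'pos.ne'
  have him : ∀ z : ℍ, (((g : ℂ) * z + B) / t').im = (g : ℝ) ^ 2 / t * z.im := by
    intro z
    have : ((g : ℂ) * z + B) / t' = ((g / t' : ℝ) : ℂ) * z + ((B / t' : ℝ) : ℂ) := by
      push_cast; ring
    rw [this, Complex.add_im, Complex.im_ofReal_mul, Complex.ofReal_im, add_zero, ht'R, coe_im]
    field_simp
  refine ⟨δ, fun z => ⟨((g : ℂ) * z + B) / t', by rw [him]; have := z.im_pos; positivity⟩,
    fun z => ?_⟩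
  have hj : autJ γ z = (t / g : ℂ) * autJ δ ⟨((g : ℂ) * z + B) / t', by
      rw [him]; have := z.im_pos; positivity⟩ := by
    rw [← ht'C]
    simp only [autJ, hδ1]
    field_simp
    have e1 : γ 1 1 = c' * B + δ 1 1 * t' := by
      rw [hB]
      linear_combination δ 1 1 * t' * hdet - γ 1 1 * hdδ
        - c' * δ 1 1 * γ 0 1 * ht' + t' * δ 1 1 * γ 0 1 * hc'
    have e2 : ((γ 1 1 : ℤ) : ℂ) = c' * B + ((δ 1 1 : ℤ) : ℂ) * t' := by
      rw [e1]; push_cast; ring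
    have e3 : ((γ 1 0 : ℤ) : ℂ) = g * c' := by
      rw [hc']; push_cast; ring
    rw [e2, e3]
    ring
  refine ⟨?_, hj, him z⟩
  ext1
  rw [coe_scale, coe_smul_eq, coe_smul_eq, hj, ← ht'C]
  have h1 := autJ_ne_zero δ ⟨((g : ℂ) * z + B) / t', by
      rw [him]; have := z.im_pos; positivity⟩
  field_simp
  have e1 : γ 0 0 * B + δ 0 1 = γ 0 1 * g := by
    rw [hB]
    linear_combination (-δ 0 1) * hdet + γ 0 1 * g * hdδ
      + γ 0 0 * δ 1 1 * γ 0 1 * ht' - δ 0 1 * γ 0 1 * hc'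
  have e2 : ((δ 0 1 : ℤ) : ℂ) = ((γ 0 1 : ℤ) : ℂ) * g - ((γ 0 0 : ℤ) : ℂ) * B := by
    have := congrArg (fun x : ℤ => (x : ℂ)) e1
    push_cast at this
    linear_combination this
  have e3 : ((δ 0 0 : ℤ) : ℂ) = t' * ((γ 0 0 : ℤ) : ℂ) := by
    rw [hδ0]; push_cast; ring
  have e4 : (t : ℂ) = g * t' := by
    exact_mod_cast congrArg (fun x : ℤ => (x : ℂ)) ht'
  rw [e2, e3, e4]
  field_simp
  ring

/-! ### Boundedness at all cusps, and forms with character -/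

section

/-- `f` is bounded at all cusps, as a form of real weight `k`. Only the absolute value of the
automorphy factor enters, so that forms of half-integral weight are covered. -/
def CuspBdd (k : ℝ) (f : ℍ → ℂ) : Prop :=
  ∀ γ : SL(2, ℤ), (fun z : ℍ => f (γ • z)) =O[atImInfty] fun z => ‖autJ γ z‖ ^ k

lemma CuspBdd.mul {k l : ℝ} {f g : ℍ → ℂ} (hf : CuspBdd k f) (hg : CuspBdd l g) :
    CuspBdd (k + l) (f * g) := by
  intro γ
  refine ((hf γ).mul (hg γ)).congr_right fun z => ?_
  rw [Real.rpow_add (norm_pos_iff.mpr (autJ_ne_zero γ z))]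

lemma CuspBdd.add {k : ℝ} {f g : ℍ → ℂ} (hf : CuspBdd k f) (hg : CuspBdd k g) :
    CuspBdd k (f + g) :=
  fun γ => (hf γ).add (hg γ)

lemma CuspBdd.smul {k : ℝ} {f : ℍ → ℂ} (c : ℂ) (hf : CuspBdd k f) : CuspBdd k (c • f) :=
  fun γ => (hf γ).const_mul_left c

lemma cuspBdd_one : CuspBdd 0 1 := by
  intro γ
  simpa using! (isBigO_refl (fun _ : ℍ => (1 : ℝ)) atImInfty).norm_left

lemma CuspBdd.pow {k : ℝ} {f : ℍ → ℂ} (hf : CuspBdd k f) (n : ℕ) : CuspBdd (n * k) (f ^ n) := by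
  induction n with
  | zero => simpa using cuspBdd_one
  | succ n ih =>
    have := ih.mul hf
    rw [pow_succ]
    convert this using 1
    push_cast; ring

lemma CuspBdd.comp_scale {k : ℝ} {f : ℍ → ℂ} (hf : CuspBdd k f) (t : ℕ) [NeZero t] :
    CuspBdd k (f ∘ scale t) := by
  intro γ
  obtain ⟨δ, w, hw⟩ := exists_scale_smul t γ
  have htR : (0 : ℝ) < t := Nat.cast_pos.mpr (NeZero.pos t)
  have hg0 : (0 : ℝ) < (Int.gcd (γ 1 0) t : ℕ) :=
    Nat.cast_pos.mpr (Int.gcd_pos_of_ne_zero_right _ (by exact_mod_cast NeZero.ne t))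
  have hlim : Tendsto w atImInfty atImInfty := by
    rw [atImInfty, tendsto_comap_iff]
    refine Tendsto.congr (fun z => (hw z).2.2.symm) ?_
    exact tendsto_comap.const_mul_atTop (by positivity)
  refine (((hf δ).comp_tendsto hlim).congr_left fun z => ?_).trans ?_
  · simp only [Function.comp_apply, (hw z).1]
  · refine IsBigO.of_bound (((t / (Int.gcd (γ 1 0) t : ℕ) : ℝ) ^ k)⁻¹) (Eventually.of_forall
      fun z => ?_)
    have h1 : ‖autJ γ z‖ = (t / (Int.gcd (γ 1 0) t : ℕ) : ℝ) * ‖autJ δ (w z)‖ := by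
      rw [(hw z).2.1, norm_mul, norm_div]
      simp
    have hp : (0 : ℝ) < t / (Int.gcd (γ 1 0) t : ℕ) := by positivity
    rw [Function.comp_apply, h1, Real.mul_rpow hp.le (norm_nonneg _), norm_mul,
      Real.norm_of_nonneg (Real.rpow_nonneg hp.le k),
      inv_mul_cancel_left₀ (Real.rpow_pos_of_pos hp k).ne']

lemma isBoundedAtImInfty_slash_iff (f : ℍ → ℂ) (k : ℤ) (γ : SL(2, ℤ)) :
    IsBoundedAtImInfty (f ∣[k] γ) ↔
      (fun z : ℍ => f (γ • z)) =O[atImInfty] fun z => ‖autJ γ z‖ ^ (k : ℝ) := by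
  have h0 : ∀ z, ‖autJ γ z‖ ≠ 0 := fun z => (norm_pos_iff.mpr (autJ_ne_zero γ z)).ne'
  have e : (f ∣[k] γ) = fun z => f (γ • z) * autJ γ z ^ (-k) := funext (slash_eq f k γ)
  rw [IsBoundedAtImInfty, BoundedAtFilter, e]
  constructor
  · intro h
    have := h.mul (isBigO_refl (fun z => autJ γ z ^ k) atImInfty).norm_right
    refine (this.congr_left fun z => ?_).congr_right fun z => ?_
    · rw [mul_assoc, ← zpow_add₀ (autJ_ne_zero γ z)]
      simp
    · simp [Real.rpow_intCast]
  · intro h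
    have := h.mul (isBigO_refl (fun z => autJ γ z ^ (-k)) atImInfty).norm_right
    refine this.congr_right fun z => ?_
    rw [Real.rpow_intCast, norm_zpow, ← zpow_add₀ (h0 z)]
    simp

/-- `f` is a modular form of weight `k` for `Γ₀(N)` with `f ∣[k] γ = χ(d) f` for
`γ = (a, b; c, d)`. The character is any function on the integers; only its values at
integers prime to `N` matter. -/
structure IsForm (N : ℕ) (χ : ℤ → ℂ) (k : ℤ) (f : ℍ → ℂ) : Prop where
  holo : MDifferentiable 𝓘(ℂ) 𝓘(ℂ) f
  trans : ∀ γ ∈ Gamma0 N, ∀ z, f (γ • z) = χ (γ 1 1) * autJ γ z ^ k * f z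
  bdd : CuspBdd k f

variable {N : ℕ} {χ ψ : ℤ → ℂ} {k l : ℤ} {f g : ℍ → ℂ}

lemma mem_Gamma0_iff {γ : SL(2, ℤ)} : γ ∈ Gamma0 N ↔ (N : ℤ) ∣ γ 1 0 := by
  rw [Gamma0_mem, ZMod.intCast_zmod_eq_zero_iff_dvd]

lemma isCoprime_of_mem_Gamma0 {γ : SL(2, ℤ)} (h : γ ∈ Gamma0 N) : IsCoprime (γ 1 1) (N : ℤ) := by
  obtain ⟨c, hc⟩ := mem_Gamma0_iff.mp h
  have hdet := γ.det_coe
  rw [Matrix.det_fin_two] at hdet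
  exact ⟨γ 0 0, -(γ 0 1 * c), by rw [hc] at hdet; linear_combination hdet⟩

lemma IsForm.congr_char (hf : IsForm N χ k f) (h : ∀ d : ℤ, IsCoprime d N → χ d = ψ d) :
    IsForm N ψ k f :=
  ⟨hf.holo, fun γ hγ z => by rw [hf.trans γ hγ z, h _ (isCoprime_of_mem_Gamma0 hγ)], hf.bdd⟩

lemma IsForm.mul (hf : IsForm N χ k f) (hg : IsForm N ψ l g) :
    IsForm N (χ * ψ) (k + l) (f * g) where
  holo := hf.holo.mul hg.holo
  trans γ hγ z := by
    simp only [Pi.mul_apply, hf.trans γ hγ z, hg.trans γ hγ z, zpow_add₀ (autJ_ne_zero γ z)]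
    ring
  bdd := by simpa using hf.bdd.mul hg.bdd

lemma IsForm.add (hf : IsForm N χ k f) (hg : IsForm N χ k g) : IsForm N χ k (f + g) where
  holo := hf.holo.add hg.holo
  trans γ hγ z := by
    simp only [Pi.add_apply, hf.trans γ hγ z, hg.trans γ hγ z]
    ring
  bdd := hf.bdd.add hg.bdd

lemma IsForm.smul (c : ℂ) (hf : IsForm N χ k f) : IsForm N χ k (c • f) where
  holo := hf.holo.const_smul c
  trans γ hγ z := by
    simp only [Pi.smul_apply, smul_eq_mul, hf.trans γ hγ z]
    ring
  bdd := hf.bdd.smul c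

lemma IsForm.sub (hf : IsForm N χ k f) (hg : IsForm N χ k g) : IsForm N χ k (f - g) := by
  rw [sub_eq_add_neg, ← neg_one_smul ℂ g]
  exact hf.add (hg.smul _)

lemma isForm_one (N : ℕ) : IsForm N 1 0 1 where
  holo := mdifferentiable_const
  trans γ _ z := by simp
  bdd := by simpa using cuspBdd_one

lemma IsForm.pow (hf : IsForm N χ k f) (n : ℕ) : IsForm N (χ ^ n) (n * k) (f ^ n) := by
  induction n with
  | zero => simpa using isForm_one N
  | succ n ih =>
    rw [pow_succ, pow_succ]
    convert ih.mul hf using 1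
    push_cast; ring

lemma IsForm.mono {N' : ℕ} (hf : IsForm N χ k f) (h : N ∣ N') : IsForm N' χ k f :=
  ⟨hf.holo, fun γ hγ z => hf.trans γ
    (mem_Gamma0_iff.mpr ((Int.natCast_dvd_natCast.mpr h).trans (mem_Gamma0_iff.mp hγ))) z, hf.bdd⟩

/-- If `f(z)` is a form for `Γ₀(N)` then `f(t z)` is a form for `Γ₀(N t)`, with the same
character. -/
lemma IsForm.comp_scale (hf : IsForm N χ k f) (t : ℕ) [NeZero t] :
    IsForm (N * t) χ k (f ∘ scale t) where
  holo := hf.holo.comp (mdifferentiable_scale t)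
  bdd := hf.bdd.comp_scale t
  trans γ hγ z := by
    obtain ⟨c, hc⟩ := mem_Gamma0_iff.mp hγ
    have hdet := γ.det_coe
    rw [Matrix.det_fin_two, hc] at hdet
    push_cast at hc hdet
    let δ : SL(2, ℤ) := ⟨!![γ 0 0, t * γ 0 1; N * c, γ 1 1], by
      rw [Matrix.det_fin_two_of]; linear_combination hdet⟩
    have hj : autJ δ (scale t z) = autJ γ z := by
      have : autJ δ (scale t z) = ((N * c : ℤ) : ℂ) * (t * z) + ((γ 1 1 : ℤ) : ℂ) := rfl
      rw [this, autJ, hc]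
      push_cast; ring
    have hz : scale t (γ • z) = δ • scale t z := by
      ext1
      have h2 : (((δ 0 0 : ℤ) : ℂ) * (scale t z : ℍ) + ((δ 0 1 : ℤ) : ℂ)) =
        ((γ 0 0 : ℤ) : ℂ) * (t * z) + ((t * γ 0 1 : ℤ) : ℂ) := rfl
      rw [coe_scale, coe_smul_eq, coe_smul_eq, hj, h2]
      push_cast; ring
    have := hf.trans δ (mem_Gamma0_iff.mpr ⟨c, rfl⟩) (scale t z)
    simp only [Function.comp_apply, hz, this, hj]
    rfl

instance (N : ℕ) [NeZero N] : (Gamma0 N).FiniteIndex := (Gamma0_is_congruence N).finiteIndex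

instance (N : ℕ) [NeZero N] : (Gamma1 N).FiniteIndex := (Gamma1_is_congruence N).finiteIndex

lemma cuspBdd_of_modularForm {Γ : Subgroup SL(2, ℤ)} [Γ.FiniteIndex]
    (F : ModularForm (Γ : Subgroup (GL (Fin 2) ℝ)) k) : CuspBdd k F := by
  intro γ
  rw [← isBoundedAtImInfty_slash_iff]
  have hc : IsCusp (Matrix.SpecialLinearGroup.mapGL ℝ γ • OnePoint.infty)
      (Matrix.SpecialLinearGroup.mapGL (R := ℤ) (n := Fin 2) ℝ).range :=
    isCusp_SL2Z_iff'.mpr ⟨γ, rfl⟩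
  have h := F.bdd_at_cusps' ((Subgroup.IsArithmetic.isCusp_iff_isCusp_SL2Z _).mpr hc)
  exact (OnePoint.isBoundedAt_iff_forall_SL2Z hc).mp h γ rfl

lemma slash_eq_iff (γ : SL(2, ℤ)) (c : ℂ) :
    f ∣[k] γ = c • f ↔ ∀ z, f (γ • z) = c * autJ γ z ^ k * f z := by
  rw [funext_iff]
  refine forall_congr' fun z => ?_
  rw [slash_eq, Pi.smul_apply, smul_eq_mul, zpow_neg,
    mul_inv_eq_iff_eq_mul₀ (zpow_ne_zero _ (autJ_ne_zero γ z))]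
  constructor <;> intro h <;> rw [h] <;> ring

/-- A function with the transformation law of `Γ` that is holomorphic and bounded at the cusps,
as a modular form. -/
lemma exists_modularForm (Γ : Subgroup SL(2, ℤ)) [Γ.FiniteIndex]
    (holo : MDifferentiable 𝓘(ℂ) 𝓘(ℂ) f) (trans : ∀ γ ∈ Γ, ∀ z, f (γ • z) = autJ γ z ^ k * f z)
    (bdd : CuspBdd k f) : ∃ F : ModularForm (Γ : Subgroup (GL (Fin 2) ℝ)) k, ⇑F = f := by
  refine ⟨⟨⟨f, ?_⟩, holo, ?_⟩, rfl⟩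
  · rintro _ ⟨γ, hγ, rfl⟩
    have := (slash_eq_iff (f := f) (k := k) γ 1).mpr (by simpa using trans γ hγ)
    rwa [one_smul] at this
  · intro c hc
    have hc' := (Subgroup.IsArithmetic.isCusp_iff_isCusp_SL2Z _).mp hc
    exact (OnePoint.isBoundedAt_iff_forall_SL2Z hc').mpr fun γ _ =>
      (isBoundedAtImInfty_slash_iff f k γ).mpr (bdd γ)

lemma slash_eq_of_mem {Γ : Subgroup SL(2, ℤ)}
    (F : ModularForm (Γ : Subgroup (GL (Fin 2) ℝ)) k) {γ : SL(2, ℤ)} (hγ : γ ∈ Γ) (z : ℍ) :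
    F (γ • z) = autJ γ z ^ k * F z := by
  have h : ⇑F ∣[k] γ = ⇑F := F.slash_action_eq' _ ⟨γ, hγ, rfl⟩
  have := (slash_eq_iff (f := F) (k := k) γ 1).mp (by rw [one_smul, h]) z
  rwa [one_mul] at this

lemma mem_Mk_iff [NeZero N] : f ∈ Mk N k ↔ IsForm N 1 k f := by
  constructor
  · rintro ⟨F, rfl⟩
    exact ⟨F.holo', fun γ hγ z => by simpa using slash_eq_of_mem F hγ z,
      cuspBdd_of_modularForm F⟩
  · intro h
    exact exists_modularForm (Gamma0 N) h.holo
      (fun γ hγ z => by simpa using h.trans γ hγ z) h.bdd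

/-- The function on the integers underlying an integer-valued character. -/
def chr {m : ℕ} (χ : MulChar (ZMod m) ℤ) (d : ℤ) : ℂ := ((χ (d : ZMod m) : ℤ) : ℂ)

lemma mem_MkChar_iff [NeZero N] {m : ℕ} (hm : m ∣ N) (χ : MulChar (ZMod m) ℤ) :
    f ∈ MkChar N χ k ↔ IsForm N (chr χ) k f := by
  constructor
  · rintro ⟨⟨F, rfl⟩, h⟩
    exact ⟨F.holo', fun γ hγ => (slash_eq_iff γ _).mp (h γ hγ), cuspBdd_of_modularForm F⟩
  · intro h
    refine ⟨exists_modularForm (Gamma1 N) h.holo (fun γ hγ z => ?_) h.bdd,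
      fun γ hγ => (slash_eq_iff γ _).mpr (h.trans γ hγ)⟩
    rw [h.trans γ (Gamma1_in_Gamma0 N hγ) z, chr]
    have h1 := congrArg (ZMod.castHom hm (ZMod m)) ((Gamma1_mem N γ).mp hγ).2.1
    rw [map_intCast, map_one] at h1
    rw [h1]
    simp

/-- There are no forms of negative weight. -/
lemma IsForm.eq_zero_of_neg [NeZero N] (h : IsForm N χ k f)
    (hχ : ∀ d : ℤ, (N : ℤ) ∣ d - 1 → χ d = 1) (hk : k < 0) : f = 0 := by
  obtain ⟨F, rfl⟩ := exists_modularForm (Gamma1 N) h.holo (fun γ hγ z => by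
    rw [h.trans γ (Gamma1_in_Gamma0 N hγ) z, hχ, one_mul]
    have := ((Gamma1_mem N γ).mp hγ).2.1
    rw [← ZMod.intCast_zmod_eq_zero_iff_dvd]
    push_cast
    rw [this, sub_self]) h.bdd
  rw [ModularForm.isZero_of_neg_weight hk F]
  rfl

/-- Forms of weight zero are constant. -/
lemma IsForm.eq_const [NeZero N] (h : IsForm N χ 0 f)
    (hχ : ∀ d : ℤ, (N : ℤ) ∣ d - 1 → χ d = 1) : ∃ c : ℂ, f = c • 1 := by
  obtain ⟨F, rfl⟩ := exists_modularForm (Gamma1 N) h.holo (fun γ hγ z => by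
    rw [h.trans γ (Gamma1_in_Gamma0 N hγ) z, hχ, one_mul]
    have := ((Gamma1_mem N γ).mp hγ).2.1
    rw [← ZMod.intCast_zmod_eq_zero_iff_dvd]
    push_cast
    rw [this, sub_self]) h.bdd
  obtain ⟨c, hc⟩ := ModularForm.eq_const_of_weight_zero F
  exact ⟨c, by rw [hc]; ext; simp⟩

end

/-! ### Generators of `Γ₀(N)` for `N = 2, 3, 4` and the Fricke involution -/

section

/-- The matrix `(1, 0; n, 1)`. -/
def lowU (n : ℤ) : SL(2, ℤ) := ⟨!![1, 0; n, 1], by simp⟩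

lemma lowU_mul (m n : ℤ) : lowU m * lowU n = lowU (m + n) := by
  ext i j
  rw [Matrix.SpecialLinearGroup.coe_mul]
  fin_cases i <;> fin_cases j <;> simp [lowU, Matrix.mul_apply, Fin.sum_univ_two]

lemma lowU_mem_zpowers (n m : ℤ) : lowU (n * m) ∈ Subgroup.zpowers (lowU n) := by
  have h0 : lowU 0 = 1 := by
    ext i j
    fin_cases i <;> fin_cases j <;> simp [lowU]
  let φ : Multiplicative ℤ →* SL(2, ℤ) :=
    { toFun := fun a => lowU (n * a.toAdd)
      map_one' := by simpa using h0
      map_mul' := fun a b => by rw [lowU_mul, toAdd_mul, mul_add] }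
  have h1 : φ (Multiplicative.ofAdd 1) = lowU n := by simp [φ]
  have h2 : φ (Multiplicative.ofAdd m) = lowU (n * m) := by simp [φ]
  rw [← h2, ← h1]
  refine ⟨m, ?_⟩
  simp only
  rw [← map_zpow, ← ofAdd_zsmul]
  simp

lemma exists_abs_add_mul_le {a b : ℤ} (hb : b ≠ 0) : ∃ n : ℤ, 2 * |a + n * b| ≤ |b| := by
  refine ⟨-round ((a : ℚ) / b), ?_⟩
  have h := abs_sub_round ((a : ℚ) / b)
  have hb' : (0 : ℚ) < |(b : ℚ)| := abs_pos.mpr (by exact_mod_cast hb)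
  have hbne : (b : ℚ) ≠ 0 := by exact_mod_cast hb
  have : (2 : ℚ) * |(a : ℚ) + (-round ((a : ℚ) / b) : ℤ) * b| ≤ |(b : ℚ)| := by
    have e : (a : ℚ) + (-round ((a : ℚ) / b) : ℤ) * b =
        ((a : ℚ) / b - round ((a : ℚ) / b)) * b := by
      push_cast
      field_simp
      ring
    rw [e, abs_mul]
    nlinarith
  exact_mod_cast this

/-- The Euclidean algorithm: for `N = 2, 3, 4` alternately reducing `d` modulo `c` and `c` modulo
`N d` strictly decreases `c`. -/
lemma Gamma0_le_closure {N : ℕ} (h2 : 2 ≤ N) (h4 : N ≤ 4) :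
    Gamma0 N ≤ Subgroup.closure {ModularGroup.T, lowU N, -1} := by
  set H := Subgroup.closure {ModularGroup.T, lowU N, -1} with hH
  have hT : ModularGroup.T ∈ H := Subgroup.subset_closure (by simp)
  have hU : ∀ m : ℤ, lowU (N * m) ∈ H := fun m =>
    (Subgroup.zpowers_le.mpr (Subgroup.subset_closure (by simp))) (lowU_mem_zpowers N m)
  have hneg : (-1 : SL(2, ℤ)) ∈ H := Subgroup.subset_closure (by simp)
  suffices h : ∀ (n : ℕ) (γ : SL(2, ℤ)), (γ 1 0).natAbs = n → γ ∈ Gamma0 N → γ ∈ H from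
    fun γ hγ => h _ γ rfl hγ
  intro n
  induction n using Nat.strong_induction_on with
  | _ n ih =>
  intro γ hn hγ
  have hdet := γ.det_coe
  rw [Matrix.det_fin_two] at hdet
  obtain ⟨c, hc⟩ := mem_Gamma0_iff.mp hγ
  by_cases hc0 : γ 1 0 = 0
  · rw [hc0, mul_zero, sub_zero] at hdet
    have key : γ = ModularGroup.T ^ (γ 0 1 * γ 1 1) ∨
        γ = -1 * ModularGroup.T ^ (-(γ 0 1 * γ 1 1) * -1) := by
      rcases Int.eq_one_or_neg_one_of_mul_eq_one' hdet with ⟨ha, hd⟩ | ⟨ha, hd⟩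
      · left
        ext i j
        rw [ModularGroup.coe_T_zpow]
        fin_cases i <;> fin_cases j <;> simp [ha, hd, hc0]
      · right
        ext i j
        rw [Matrix.SpecialLinearGroup.coe_mul, ModularGroup.coe_T_zpow]
        fin_cases i <;> fin_cases j <;> simp [ha, hd, hc0]
    rcases key with h | h
    · rw [h]; exact H.zpow_mem hT _
    · rw [h]; exact H.mul_mem hneg (H.zpow_mem hT _)
  · obtain ⟨r, hr⟩ := exists_abs_add_mul_le (a := γ 1 1) hc0
    set d' := γ 1 1 + r * γ 1 0 with hd'
    have hNz : (N : ℤ) ≠ 0 := by positivity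
    have hd0 : d' ≠ 0 := by
      intro h0
      have hu : (N : ℤ) ∣ 1 := by
        refine ⟨-(c * (γ 0 1 + r * γ 0 0)), ?_⟩
        have : γ 1 1 = -r * γ 1 0 := by linarith
        rw [this, hc] at hdet
        linear_combination -hdet
      have := Int.le_of_dvd one_pos hu
      omega
    obtain ⟨m, hm⟩ := exists_abs_add_mul_le (a := γ 1 0) (mul_ne_zero hNz hd0)
    have e10 : (γ * ModularGroup.T ^ r * lowU (N * m)) 1 0 = γ 1 0 + m * (N * d') := by
      rw [Matrix.SpecialLinearGroup.coe_mul, Matrix.SpecialLinearGroup.coe_mul,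
        ModularGroup.coe_T_zpow]
      simp [lowU, Matrix.mul_apply, Fin.sum_univ_two, hd']
      ring
    have hlt : |γ 1 0 + m * (N * d')| < |γ 1 0| := by
      have hcp : 0 < |γ 1 0| := abs_pos.mpr hc0
      rw [abs_mul, Nat.abs_cast] at hm
      have hN4 : (N : ℤ) ≤ 4 := by exact_mod_cast h4
      have hdp : 0 ≤ |d'| := abs_nonneg _
      rcases hN4.lt_or_eq with h | h
      · have : (N : ℤ) ≤ 3 := by omega
        nlinarith
        -- For `N = 4` equality would make both entries of the bottom row even.
      · rw [h] at hm hc ⊢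
        refine lt_of_le_of_ne (by linarith) fun heq => ?_
        have h2d : 2 * |d'| = |γ 1 0| := by linarith
        have : (2 : ℤ) ∣ d' := by
          rw [hc, abs_mul] at h2d
          norm_num at h2d
          exact (dvd_abs _ _).mp ⟨|c|, by linarith⟩
        obtain ⟨e, he⟩ := this
        have : (2 : ℤ) ∣ 1 := by
          refine ⟨γ 0 0 * e - r * γ 0 0 * 2 * c - γ 0 1 * 2 * c, ?_⟩
          have h11 : γ 1 1 = 2 * e - r * γ 1 0 := by linarith
          rw [h11, hc] at hdet
          linear_combination -hdet
        omega
    have hmem := ih _ (by rw [← hn, e10]; zify; exact hlt)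
      (γ * ModularGroup.T ^ r * lowU (N * m)) rfl (mem_Gamma0_iff.mpr (by
        rw [e10, hc]
        exact ⟨c + m * d', by ring⟩))
    have e : γ = γ * ModularGroup.T ^ r * lowU (N * m) * (lowU (N * m))⁻¹ *
        (ModularGroup.T ^ r)⁻¹ := by group
    rw [e]
    exact H.mul_mem (H.mul_mem hmem (H.inv_mem (hU m))) (H.inv_mem (H.zpow_mem hT r))

/-- The Fricke involution `z ↦ -1 / (N z)`. -/
noncomputable def fricke (N : ℕ) [NeZero N] (z : ℍ) : ℍ := ModularGroup.S • scale N z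

lemma coe_fricke (N : ℕ) [NeZero N] (z : ℍ) : (fricke N z : ℂ) = -1 / (N * z) := by
  rw [fricke, modular_S_smul]
  simp [neg_div, inv_neg, one_div]

/-- The matrix `(1, 0; N, 1)` acts as the conjugate of `z ↦ z - 1` by the Fricke involution. -/
lemma lowU_smul (N : ℕ) [NeZero N] (z : ℍ) :
    lowU N • z = fricke N ((-1 : ℝ) +ᵥ fricke N z) := by
  have hz := ne_zero z
  have hN : (N : ℂ) ≠ 0 := Nat.cast_ne_zero.mpr (NeZero.ne N)
  have h0 : (N : ℂ) * z + 1 ≠ 0 := by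
    simpa [autJ, lowU] using autJ_ne_zero (lowU N) z
  have h1 : (-1 : ℂ) + -1 / (N * z) ≠ 0 := by
    intro h
    field_simp at h
    apply h0
    linear_combination -h
  ext1
  rw [coe_smul_eq, coe_fricke, coe_vadd, coe_fricke]
  simp only [autJ, lowU]
  simp
  field_simp
  have : -((N : ℂ) * z) - 1 ≠ 0 := by
    intro h; apply h0; linear_combination -h
  rw [neg_div', neg_div, ← div_neg]
  congr 1
  ring

variable {N : ℕ} {χ : ℤ → ℂ} {k : ℤ} {f : ℍ → ℂ}

lemma T_smul_eq (z : ℍ) : ModularGroup.T • z = (1 : ℝ) +ᵥ z := modular_T_smul z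

/-- Modularity for `Γ₀(N)`, `N = 2, 3, 4`, from the behaviour under `z ↦ z + 1` and the Fricke
involution. -/
lemma IsForm.of_fricke [NeZero N] (h2 : 2 ≤ N) (h4 : N ≤ 4) {κ : ℂ}
    (hχ : ∀ d c : ℤ, (N : ℤ) ∣ c → χ (d + c) = χ d) (hχ1 : χ 1 = 1)
    (hχn : ∀ d : ℤ, χ (-d) = (-1) ^ k * χ d)
    (holo : MDifferentiable 𝓘(ℂ) 𝓘(ℂ) f) (bdd : CuspBdd k f)
    (hT : ∀ z : ℍ, f ((1 : ℝ) +ᵥ z) = f z)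
    (hW : ∀ z : ℍ, f (fricke N z) = κ * (z : ℂ) ^ k * f z) (hκ : κ ^ 2 = (-N : ℂ) ^ k) :
    IsForm N χ k f := by
  have hN : (N : ℂ) ≠ 0 := Nat.cast_ne_zero.mpr (NeZero.ne N)
  have hT' : ∀ z : ℍ, f ((-1 : ℝ) +ᵥ z) = f z := fun z => by
    have := hT ((-1 : ℝ) +ᵥ z)
    rw [vadd_vadd] at this
    simpa using this.symm
  have hU : ∀ z : ℍ, f (lowU N • z) = autJ (lowU N) z ^ k * f z := fun z => by
    have hz := ne_zero z
    rw [lowU_smul, hW, hT', hW, coe_vadd, coe_fricke]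
    have e : autJ (lowU N) z = (-N : ℂ) * ((((-1 : ℝ) : ℂ) + -1 / (N * z)) * z) := by
      simp only [autJ, lowU]
      simp
      field_simp
      ring
    rw [e, mul_zpow, mul_zpow, ← hκ]
    ring
  refine ⟨holo, fun γ hγ => ?_, bdd⟩
  have hγ' := Gamma0_le_closure h2 h4 hγ
  have hstep : ∀ (γ y : SL(2, ℤ)) (ε : ℂ),
      (∀ z, f (γ • z) = χ (γ 1 1) * autJ γ z ^ k * f z) →
      (∀ z, f (y • z) = ε * autJ y z ^ k * f z) → χ ((γ * y) 1 1) = ε * χ (γ 1 1) →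
      ∀ z, f ((γ * y) • z) = χ ((γ * y) 1 1) * autJ (γ * y) z ^ k * f z := by
    intro γ y ε h1 h2 h3 z
    rw [mul_smul, h1, h2, h3, autJ_mul, mul_zpow]
    ring
  have hinv : ∀ (y : SL(2, ℤ)) (ε : ℂ), ε ^ 2 = 1 → (∀ z, f (y • z) = ε * autJ y z ^ k * f z) →
      ∀ z, f (y⁻¹ • z) = ε * autJ y⁻¹ z ^ k * f z := by
    intro y ε hε h z
    have h1 := h (y⁻¹ • z)
    rw [smul_inv_smul] at h1
    have h2 : autJ y (y⁻¹ • z) * autJ y⁻¹ z = 1 := by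
      rw [← autJ_mul, mul_inv_cancel]
      simp [autJ]
    have h3 : autJ y (y⁻¹ • z) ^ k * autJ y⁻¹ z ^ k = 1 := by
      rw [← mul_zpow, h2, one_zpow]
    rw [h1]
    linear_combination (-f (y⁻¹ • z)) * hε - f (y⁻¹ • z) * ε ^ 2 * h3
  have gT : ∀ z, f (ModularGroup.T • z) = 1 * autJ ModularGroup.T z ^ k * f z := fun z => by
    rw [T_smul_eq, hT]
    simp [autJ, ModularGroup.T]
  have gU : ∀ z, f (lowU N • z) = 1 * autJ (lowU N) z ^ k * f z := fun z => by
    rw [hU, one_mul]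
  have hm1 : ((-1 : ℂ) ^ k) ^ 2 = 1 := by
    rw [← zpow_natCast, ← zpow_mul, mul_comm, zpow_mul]
    norm_num
  have gN : ∀ z, f ((-1 : SL(2, ℤ)) • z) = (-1) ^ k * autJ (-1) z ^ k * f z := fun z => by
    have e1 : (-1 : SL(2, ℤ)) • z = z := by
      ext1
      rw [coe_smul_eq]
      simp [autJ]
    have e2 : autJ (-1) z = -1 := by simp [autJ]
    rw [e1, e2, ← pow_two, hm1, one_mul]
  suffices h : γ ∈ Gamma0 N ∧ ∀ z, f (γ • z) = χ (γ 1 1) * autJ γ z ^ k * f z from h.2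
  clear hγ
  have mT : ModularGroup.T ∈ Gamma0 N := mem_Gamma0_iff.mpr (by simp [ModularGroup.T])
  have mU : lowU N ∈ Gamma0 N := mem_Gamma0_iff.mpr (by simp [lowU])
  have mN : (-1 : SL(2, ℤ)) ∈ Gamma0 N := mem_Gamma0_iff.mpr (by simp)
  induction hγ' using Subgroup.closure_induction_right with
  | one => exact ⟨one_mem _, fun z => by simp [autJ, hχ1]⟩
  | mul_right x hx y hy ih =>
    have hdvd := mem_Gamma0_iff.mp ih.1
    rcases hy with rfl | rfl | rfl
    · refine ⟨mul_mem ih.1 mT, hstep _ _ _ ih.2 gT ?_⟩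
      rw [one_mul, ← hχ (x 1 1) _ hdvd]
      congr 1
      rw [Matrix.SpecialLinearGroup.coe_mul]
      simp [ModularGroup.T, Matrix.mul_apply, Fin.sum_univ_two, add_comm]
    · refine ⟨mul_mem ih.1 mU, hstep _ _ _ ih.2 gU ?_⟩
      rw [one_mul]
      congr 1
      rw [Matrix.SpecialLinearGroup.coe_mul]
      simp [lowU, Matrix.mul_apply, Fin.sum_univ_two]
    · refine ⟨mul_mem ih.1 mN, hstep _ _ _ ih.2 gN ?_⟩
      rw [← hχn]
      congr 1
      simp
  | mul_inv_cancel x hx y hy ih =>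
    have hdvd := mem_Gamma0_iff.mp ih.1
    rcases hy with rfl | rfl | rfl
    · refine ⟨mul_mem ih.1 (inv_mem mT), hstep _ _ _ ih.2 (hinv _ 1 (by norm_num) gT) ?_⟩
      rw [one_mul, ← hχ (x 1 1) _ (dvd_neg.mpr hdvd)]
      congr 1
      rw [Matrix.SpecialLinearGroup.coe_mul, Matrix.SpecialLinearGroup.coe_inv]
      simp [ModularGroup.T, Matrix.mul_apply, Fin.sum_univ_two, add_comm, Matrix.adjugate_fin_two]
    · refine ⟨mul_mem ih.1 (inv_mem mU), hstep _ _ _ ih.2 (hinv _ 1 (by norm_num) gU) ?_⟩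
      rw [one_mul]
      congr 1
      rw [Matrix.SpecialLinearGroup.coe_mul, Matrix.SpecialLinearGroup.coe_inv]
      simp [lowU, Matrix.mul_apply, Fin.sum_univ_two, Matrix.adjugate_fin_two]
    · refine ⟨mul_mem ih.1 (inv_mem mN), hstep _ _ _ ih.2 (hinv _ _ hm1 gN) ?_⟩
      rw [← hχn]
      congr 1
      simp

end

/-! ### The three Jacobi theta functions -/

/-- Jacobi's theta function `θ₃(z) = ∑ exp(π i n² z)`. -/
noncomputable def T3 (z : ℂ) : ℂ := jacobiTheta z

/-- Jacobi's theta function `θ₄(z) = ∑ (-1)ⁿ exp(π i n² z)`. -/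
noncomputable def T4 (z : ℂ) : ℂ := jacobiTheta (z + 1)

/-- Jacobi's theta function `θ₂(z) = ∑ exp(π i (n + 1/2)² z)`, defined as the part of
`θ₃(z / 4)` coming from odd integers. -/
noncomputable def T2 (z : ℂ) : ℂ := jacobiTheta (z / 4) - jacobiTheta z

lemma theta_eq_T3 (z : ℂ) : theta z = T3 (2 * z) := by
  rw [theta, T3, jacobiTheta]
  refine tsum_congr fun n => ?_
  push_cast
  ring_nf

lemma hasSum_of_isCompl {α β γ : Type*} {f : γ → ℂ} {g : α → γ} {h : β → γ}
    (hg : g.Injective) (hh : h.Injective) (hc : IsCompl (Set.range g) (Set.range h)) {a b : ℂ}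
    (ha : HasSum (fun x => f (g x)) a) (hb : HasSum (fun x => f (h x)) b) :
    HasSum f (a + b) :=
  ((hg.hasSum_range_iff).mpr ha).add_isCompl hc ((hh.hasSum_range_iff).mpr hb)

lemma hasSum_T3 {z : ℂ} (hz : 0 < z.im) :
    HasSum (fun n : ℤ => Complex.exp (Real.pi * Complex.I * (n : ℂ) ^ 2 * z)) (T3 z) := by
  have := hasSum_jacobiTheta₂_term 0 hz
  rw [← jacobiTheta_eq_jacobiTheta₂] at this
  simpa [jacobiTheta₂_term, T3] using this

lemma isCompl_range_even_odd :
    IsCompl (Set.range fun n : ℤ => 2 * n) (Set.range fun n : ℤ => 2 * n + 1) := by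
  constructor
  · rw [Set.disjoint_left]
    rintro _ ⟨a, rfl⟩ ⟨b, hb⟩
    simp only at hb
    omega
  · rw [codisjoint_iff]
    refine Set.eq_univ_of_forall fun n => ?_
    rcases Int.even_or_odd' n with ⟨k, h | h⟩
    · exact Or.inl ⟨k, h.symm⟩
    · exact Or.inr ⟨k, h.symm⟩

lemma hasSum_T2 {z : ℂ} (hz : 0 < z.im) :
    HasSum (fun n : ℤ => Complex.exp (Real.pi * Complex.I * ((n : ℂ) + 1 / 2) ^ 2 * z))
      (T2 z) := by
  have hz4 : 0 < (z / 4).im := by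
    rw [Complex.div_ofNat_im]
    positivity
  have h := hasSum_T3 hz4
  have hodd : Summable (fun n : ℤ =>
      Complex.exp (Real.pi * Complex.I * (((2 * n + 1 : ℤ) : ℂ)) ^ 2 * (z / 4))) :=
    h.summable.comp_injective (i := fun n : ℤ => 2 * n + 1) (fun a b hab => by
      simp only at hab; omega)
  have heven : HasSum (fun n : ℤ =>
      Complex.exp (Real.pi * Complex.I * (((2 * n : ℤ) : ℂ)) ^ 2 * (z / 4))) (T3 z) := by
    refine (hasSum_T3 hz).congr_fun fun n => ?_
    congr 1
    push_cast
    ring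
  have := (hasSum_of_isCompl
    (f := fun n : ℤ => Complex.exp (Real.pi * Complex.I * (n : ℂ) ^ 2 * (z / 4)))
    (g := fun n : ℤ => 2 * n) (h := fun n : ℤ => 2 * n + 1)
    (fun a b hab => by simp only at hab; omega) (fun a b hab => by simp only at hab; omega)
    isCompl_range_even_odd heven hodd.hasSum).unique h
  have e : T2 z = ∑' n : ℤ,
      Complex.exp (Real.pi * Complex.I * (((2 * n + 1 : ℤ) : ℂ)) ^ 2 * (z / 4)) := by
    rw [T2, ← T3, ← T3, ← this]
    ring
  rw [e]
  refine hodd.hasSum.congr_fun fun n => ?_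
  congr 1
  push_cast
  ring

lemma hasSum_mul_of_int {a b : ℤ → ℂ} {s t : ℂ} (ha : HasSum a s) (hb : HasSum b t) :
    HasSum (fun p : ℤ × ℤ => a p.1 * b p.2) (s * t) :=
  ha.mul hb (summable_mul_of_summable_norm ha.summable.norm hb.summable.norm)

lemma im_natCast_mul_pos {z : ℂ} (hz : 0 < z.im) (t : ℕ) [NeZero t] : 0 < ((t : ℂ) * z).im :=
  (scale t ⟨z, hz⟩).im_pos

lemma im_two_mul_pos {z : ℂ} (hz : 0 < z.im) : 0 < (2 * z).im := by
  simpa using im_natCast_mul_pos hz 2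

lemma im_four_mul_pos {z : ℂ} (hz : 0 < z.im) : 0 < (4 * z).im := by
  simpa using im_natCast_mul_pos hz 4

/-- Sum over `x + y` even and odd separately. -/
lemma T3_sq {z : ℂ} (hz : 0 < z.im) : T3 z ^ 2 = T3 (2 * z) ^ 2 + T2 (2 * z) ^ 2 := by
  have h2 := im_two_mul_pos hz
  have h := hasSum_mul_of_int (hasSum_T3 hz) (hasSum_T3 hz)
  have he := hasSum_mul_of_int (hasSum_T3 h2) (hasSum_T3 h2)
  have ho := hasSum_mul_of_int (hasSum_T2 h2) (hasSum_T2 h2)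
  rw [← pow_two] at h he ho
  refine h.unique (hasSum_of_isCompl (g := fun p : ℤ × ℤ => (p.1 + p.2, p.1 - p.2))
    (h := fun p : ℤ × ℤ => (p.1 + p.2 + 1, p.1 - p.2)) ?_ ?_ ⟨?_, ?_⟩ ?_ ?_)
  · rintro ⟨a, b⟩ ⟨c, d⟩ h
    simp only [Prod.mk.injEq] at h ⊢
    omega
  · rintro ⟨a, b⟩ ⟨c, d⟩ h
    simp only [Prod.mk.injEq] at h ⊢
    omega
  · rw [Set.disjoint_left]
    rintro _ ⟨⟨a, b⟩, rfl⟩ ⟨⟨c, d⟩, h⟩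
    simp only [Prod.mk.injEq] at h
    omega
  · rw [codisjoint_iff]
    refine Set.eq_univ_of_forall fun ⟨x, y⟩ => ?_
    rcases Int.even_or_odd' (x + y) with ⟨k, h | h⟩
    · exact Or.inl ⟨(k, x - k), by simp only [Prod.mk.injEq]; omega⟩
    · exact Or.inr ⟨(k, x - k - 1), by simp only [Prod.mk.injEq]; omega⟩
  · refine he.congr_fun fun p => ?_
    rw [← Complex.exp_add, ← Complex.exp_add]
    congr 1
    push_cast
    ring
  · refine ho.congr_fun fun p => ?_
    rw [← Complex.exp_add, ← Complex.exp_add]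
    congr 1
    push_cast
    ring

lemma T3_eq (z : ℂ) : T3 z = T3 (4 * z) + T2 (4 * z) := by
  rw [T2, T3, T3]
  ring_nf

lemma T2_four_mul (z : ℂ) : T2 (4 * z) = T3 z - T3 (4 * z) := by
  rw [T3_eq z]
  ring

lemma T4_eq {z : ℂ} (hz : 0 < z.im) : T4 z = T3 (4 * z) - T2 (4 * z) := by
  have hz1 : 0 < (z + 1).im := by simpa using hz
  have h4 := im_four_mul_pos hz
  refine (hasSum_T3 hz1).unique ?_
  rw [sub_eq_add_neg]
  refine hasSum_of_isCompl
    (g := fun n : ℤ => 2 * n) (h := fun n : ℤ => 2 * n + 1)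
    (fun a b hab => by simp only at hab; omega) (fun a b hab => by simp only at hab; omega)
    isCompl_range_even_odd ((hasSum_T3 h4).congr_fun fun n => ?_)
    ((hasSum_T2 h4).neg.congr_fun fun n => ?_)
  · rw [Complex.exp_eq_exp_iff_exists_int]
    exact ⟨2 * n ^ 2, by push_cast; ring⟩
  · rw [← neg_one_mul, ← Complex.exp_pi_mul_I, ← Complex.exp_add,
      Complex.exp_eq_exp_iff_exists_int]
    exact ⟨2 * n ^ 2 + 2 * n, by push_cast; ring⟩

lemma T2_add_one {z : ℂ} (hz : 0 < z.im) :
    T2 (z + 1) = Complex.exp (Real.pi * Complex.I / 4) * T2 z := by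
  have hz1 : 0 < (z + 1).im := by simpa using hz
  refine (hasSum_T2 hz1).unique (((hasSum_T2 hz).mul_left _).congr_fun fun n => ?_)
  rw [← Complex.exp_add, Complex.exp_eq_exp_iff_exists_int]
  obtain ⟨m, hm⟩ := Int.even_mul_succ_self n
  refine ⟨m, ?_⟩
  have : ((n : ℂ) * (n + 1)) = m + m := by exact_mod_cast hm
  linear_combination (Real.pi * Complex.I) * this

lemma T3_add_one (z : ℂ) : T3 (z + 1) = T4 z := rfl

lemma T4_add_one (z : ℂ) : T4 (z + 1) = T3 z := by
  rw [T4, T3, ← jacobiTheta_two_add z]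
  ring_nf

lemma T2_sq {z : ℂ} (hz : 0 < z.im) : T2 z ^ 2 = 2 * T3 (2 * z) * T2 (2 * z) := by
  obtain ⟨w, rfl⟩ : ∃ w, z = 2 * w := ⟨z / 2, by ring⟩
  have hw : 0 < w.im := by simpa using hz
  have h1 := T3_sq hw
  have h2 := T3_sq hz
  have h3 := T3_eq w
  rw [show 2 * (2 * w) = 4 * w by ring] at *
  rw [h3] at h1
  linear_combination -h1 - h2

lemma T3_mul_T4 {z : ℂ} (hz : 0 < z.im) : T3 z * T4 z = T4 (2 * z) ^ 2 := by
  have h2 := im_two_mul_pos hz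
  have h4 := im_four_mul_pos hz
  have e : 4 * (2 * z) = 2 * (4 * z) := by ring
  rw [T3_eq z, T4_eq hz, T4_eq h2, e]
  linear_combination T3_sq h4 - T2_sq h4

lemma T4_sq {z : ℂ} (hz : 0 < z.im) : T4 z ^ 2 = T3 (2 * z) ^ 2 - T2 (2 * z) ^ 2 := by
  obtain ⟨w, rfl⟩ : ∃ w, z = 2 * w := ⟨z / 2, by ring⟩
  have hw : 0 < w.im := by simpa using hz
  rw [← T3_mul_T4 hw, T3_eq w, T4_eq hw, show 2 * (2 * w) = 4 * w by ring]
  ring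

/-- `(-i z)^{1/2}`, the automorphy factor of the Jacobi theta functions under `z ↦ -1 / z`. -/
noncomputable def sqrtJ (z : ℂ) : ℂ := (-Complex.I * z) ^ (1 / 2 : ℂ)

lemma sqrtJ_sq (z : ℂ) : sqrtJ z ^ 2 = -Complex.I * z := by
  rw [sqrtJ, ← Complex.cpow_nat_mul]
  norm_num

lemma neg_I_mul_re (z : ℂ) : (-Complex.I * z).re = z.im := by simp

lemma sqrtJ_real_mul {z : ℂ} (hz : 0 < z.im) {t : ℝ} (ht : 0 < t) :
    sqrtJ (t * z) = (Real.sqrt t : ℝ) * sqrtJ z := by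
  have h0 : -Complex.I * z ≠ 0 := fun h => by
    have := neg_I_mul_re z
    rw [h, Complex.zero_re] at this
    exact hz.ne this
  have ht' : (t : ℂ) ≠ 0 := Complex.ofReal_ne_zero.mpr ht.ne'
  rw [sqrtJ, sqrtJ, show -Complex.I * (t * z) = (t : ℂ) * (-Complex.I * z) by ring,
    Complex.cpow_def_of_ne_zero (mul_ne_zero ht' h0), Complex.cpow_def_of_ne_zero h0,
    Complex.log_ofReal_mul ht h0, add_mul, Complex.exp_add, Real.sqrt_eq_rpow,
    Complex.ofReal_cpow ht.le, Complex.cpow_def_of_ne_zero ht', Complex.ofReal_log ht.le]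
  norm_num

lemma sqrtJ_four_mul {z : ℂ} (hz : 0 < z.im) : sqrtJ (4 * z) = 2 * sqrtJ z := by
  have := sqrtJ_real_mul hz (t := 2 ^ 2) (by norm_num)
  rw [Real.sqrt_sq (by norm_num)] at this
  rw [← Complex.ofReal_ofNat 2, ← this]
  norm_num

lemma T3_neg_inv {z : ℂ} (hz : 0 < z.im) : T3 (-1 / z) = sqrtJ z * T3 z := by
  have := jacobiTheta_S_smul ⟨z, hz⟩
  rw [modular_S_smul] at this
  rw [T3, T3, sqrtJ, ← this]
  congr 1
  simp [neg_div, inv_neg]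

lemma T2_neg_inv {z : ℂ} (hz : 0 < z.im) : T2 (-1 / z) = sqrtJ z * T4 z := by
  have hz0 : z ≠ 0 := by rintro rfl; simp at hz
  have h4 := im_four_mul_pos hz
  have e : -1 / z / 4 = -1 / (4 * z) := by field_simp
  rw [T2, ← T3, ← T3, e, T3_neg_inv hz, T3_neg_inv h4, sqrtJ_four_mul hz, T4_eq hz, T2_four_mul]
  ring

lemma im_neg_inv_pos {z : ℂ} (hz : 0 < z.im) : 0 < (-1 / z).im := by
  have := (ModularGroup.S • (⟨z, hz⟩ : ℍ)).im_pos
  rw [modular_S_smul] at this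
  simpa [neg_div, inv_neg, ← coe_im] using this

lemma sqrtJ_neg_inv {z : ℂ} (hz : 0 < z.im) : sqrtJ z * sqrtJ (-1 / z) = 1 := by
  have hz0 : z ≠ 0 := by rintro rfl; simp at hz
  have hs : -Complex.I * z ∈ Complex.slitPlane := Or.inl (by rw [neg_I_mul_re]; exact hz)
  have e : -Complex.I * (-1 / z) = (-Complex.I * z)⁻¹ := by
    rw [mul_inv, inv_neg, Complex.inv_I]
    field_simp
  rw [sqrtJ, sqrtJ, e, Complex.inv_cpow _ _ (Complex.slitPlane_arg_ne_pi hs), mul_inv_cancel₀]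
  rw [Ne, Complex.cpow_eq_zero_iff, not_and_or]
  exact Or.inl (Complex.slitPlane_ne_zero hs)

lemma T4_neg_inv {z : ℂ} (hz : 0 < z.im) : T4 (-1 / z) = sqrtJ z * T2 z := by
  have hz0 : z ≠ 0 := by rintro rfl; simp at hz
  have h := T2_neg_inv (im_neg_inv_pos hz)
  rw [show -1 / (-1 / z) = z by field_simp] at h
  rw [h, ← mul_assoc, sqrtJ_neg_inv hz, one_mul]

/-! ### Theta functions at the cusps -/

lemma mdifferentiable_of_differentiableAt {F : ℂ → ℂ}
    (h : ∀ z : ℂ, 0 < z.im → DifferentiableAt ℂ F z) :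
    MDifferentiable 𝓘(ℂ) 𝓘(ℂ) fun z : ℍ => F z := fun z =>
  MDifferentiableAt.comp (I' := 𝓘(ℂ)) z (g := F) (h z z.im_pos).mdifferentiableAt
    (mdifferentiable_coe z)

lemma differentiableAt_T3 {z : ℂ} (hz : 0 < z.im) : DifferentiableAt ℂ T3 z :=
  differentiableAt_jacobiTheta hz

lemma differentiableAt_T4 {z : ℂ} (hz : 0 < z.im) : DifferentiableAt ℂ T4 z :=
  (differentiableAt_jacobiTheta (by simpa using hz : 0 < (z + 1).im)).comp z (by fun_prop)

lemma differentiableAt_T2 {z : ℂ} (hz : 0 < z.im) : DifferentiableAt ℂ T2 z := by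
  have hz4 : 0 < (z / 4).im := by
    rw [Complex.div_ofNat_im]
    positivity
  exact (DifferentiableAt.comp (f := fun w : ℂ => w / 4) z (differentiableAt_jacobiTheta hz4)
    (by fun_prop)).sub (differentiableAt_jacobiTheta hz)

lemma tendsto_jacobiTheta : Tendsto jacobiTheta (comap Complex.im atTop) (𝓝 1) := by
  have h : Tendsto (fun z : ℂ => Real.exp (-Real.pi * z.im)) (comap Complex.im atTop) (𝓝 0) := by
    refine Real.tendsto_exp_atBot.comp ?_
    exact tendsto_comap.const_mul_atTop_of_neg (by simpa using Real.pi_pos)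
  have := isBigO_at_im_infty_jacobiTheta_sub_one.trans_tendsto h
  simpa using this.add_const 1

lemma tendsto_coe_atImInfty : Tendsto ((↑) : ℍ → ℂ) atImInfty (comap Complex.im atTop) :=
  tendsto_comap_iff.mpr tendsto_comap

lemma tendsto_T3 : Tendsto (fun z : ℍ => T3 z) atImInfty (𝓝 1) :=
  tendsto_jacobiTheta.comp tendsto_coe_atImInfty

lemma tendsto_T4 : Tendsto (fun z : ℍ => T4 z) atImInfty (𝓝 1) := by
  refine tendsto_jacobiTheta.comp (tendsto_comap_iff.mpr ?_)
  refine Tendsto.congr (fun z => ?_) (tendsto_comap : Tendsto UpperHalfPlane.im atImInfty atTop)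
  simp

lemma tendsto_T2 : Tendsto (fun z : ℍ => T2 z) atImInfty (𝓝 0) := by
  have h : Tendsto (fun z : ℍ => (z / 4 : ℂ)) atImInfty (comap Complex.im atTop) := by
    refine tendsto_comap_iff.mpr (Tendsto.congr (fun z => ?_)
      ((tendsto_comap : Tendsto UpperHalfPlane.im atImInfty atTop).atTop_div_const
        (by norm_num : (0 : ℝ) < 4)))
    rw [Function.comp_apply, Complex.div_ofNat_im, coe_im]
  have := (tendsto_jacobiTheta.comp h).sub tendsto_T3
  rwa [sub_self] at this

/-- The terms `n = 0, -1` of `θ₂(z) / exp(π i z / 4) = ∑ exp(π i n (n + 1) z)` survive. -/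
lemma tendsto_T2_div :
    Tendsto (fun z : ℍ => T2 z / Complex.exp (Real.pi * Complex.I / 4 * z)) atImInfty (𝓝 2) := by
  have hn (n : ℤ) : 0 ≤ n * (n + 1) := by
    rcases le_or_gt 0 n with h | h
    · positivity
    · nlinarith
  have hs (z : ℍ) : HasSum (fun n : ℤ => Complex.exp (Real.pi * Complex.I * (n * (n + 1) : ℤ) * z))
      (T2 z / Complex.exp (Real.pi * Complex.I / 4 * z)) := by
    refine ((hasSum_T2 z.im_pos).div_const _).congr_fun fun n => ?_
    rw [← Complex.exp_sub]
    congr 1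
    push_cast
    ring
  have hnorm (z : ℍ) (n : ℤ) :
      ‖Complex.exp (Real.pi * Complex.I * (n * (n + 1) : ℤ) * z)‖ =
        Real.exp (-(Real.pi * ((n * (n + 1) : ℤ) : ℝ)) * z.im) := by
    rw [Complex.norm_exp]
    congr 1
    have : (Real.pi * Complex.I * (n * (n + 1) : ℤ) * z : ℂ) =
      ((Real.pi * ((n * (n + 1) : ℤ) : ℝ) : ℝ) : ℂ) * (Complex.I * z) := by push_cast; ring
    rw [this, Complex.re_ofReal_mul]
    simp
  have hlim : Tendsto (fun z : ℍ => ∑' n : ℤ,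
      Complex.exp (Real.pi * Complex.I * (n * (n + 1) : ℤ) * z)) atImInfty
      (𝓝 (∑' n : ℤ, if n ∈ ({0, -1} : Finset ℤ) then 1 else 0)) := by
    refine tendsto_tsum_of_dominated_convergence (hs I).summable.norm (fun n => ?_) ?_
    · split_ifs with h
      · have : n * (n + 1) = 0 := by
          simp only [Finset.mem_insert, Finset.mem_singleton] at h
          rcases h with rfl | rfl <;> simp
        simp [this]
      · have h1 : 0 < n * (n + 1) := by
          refine lt_of_le_of_ne (hn n) fun h0 => h ?_
          rcases mul_eq_zero.mp h0.symm with h2 | h2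
          · simp [h2]
          · simp [show n = -1 by omega]
        rw [tendsto_zero_iff_norm_tendsto_zero]
        simp only [hnorm]
        refine Real.tendsto_exp_atBot.comp ?_
        refine tendsto_comap.const_mul_atTop_of_neg ?_
        have : (0 : ℝ) < ((n * (n + 1) : ℤ) : ℝ) := by exact_mod_cast h1
        have := mul_pos Real.pi_pos this
        linarith
    · have : ∀ᶠ z : ℍ in atImInfty, 1 ≤ z.im := tendsto_comap.eventually_ge_atTop 1
      filter_upwards [this] with z hz n
      rw [hnorm, hnorm, Real.exp_le_exp]
      have h1 : (0 : ℝ) ≤ ((n * (n + 1) : ℤ) : ℝ) := by exact_mod_cast hn n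
      have := mul_nonneg Real.pi_pos.le h1
      rw [UpperHalfPlane.I_im]
      nlinarith
  rw [tsum_eq_sum (s := {0, -1}) fun n hn => if_neg hn] at hlim
  convert Tendsto.congr (fun z => (hs z).tsum_eq) hlim using 2
  rw [Finset.sum_insert (by simp), Finset.sum_singleton, if_pos (by simp), if_pos (by simp)]
  norm_num

lemma norm_sqrtJ (z : ℂ) : ‖sqrtJ z‖ = ‖z‖ ^ (1 / 2 : ℝ) := by
  rw [← Real.sqrt_eq_rpow, eq_comm, Real.sqrt_eq_iff_mul_self_eq (norm_nonneg _) (norm_nonneg _),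
    ← norm_mul, ← pow_two, sqrtJ_sq]
  simp

/-- The group `SL₂(ℤ)` permutes the absolute values of the three theta functions. -/
lemma exists_norm_theta_smul (γ : SL(2, ℤ)) : ∃ σ : Equiv.Perm (Fin 3), ∀ (i : Fin 3) (z : ℍ),
    ‖(![T2, T3, T4] i) ((γ • z : ℍ) : ℂ)‖ =
      ‖autJ γ z‖ ^ (1 / 2 : ℝ) * ‖(![T2, T3, T4] (σ i)) z‖ := by
  have hmem : γ ∈ Subgroup.closure {ModularGroup.S, ModularGroup.T} := by
    rw [SpecialLinearGroup.SL2Z_generators]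
    trivial
  induction hmem using Subgroup.closure_induction with
  | mem x hx =>
    rcases hx with rfl | rfl
    · refine ⟨Equiv.swap 0 2, fun i z => ?_⟩
      have e : ((ModularGroup.S • z : ℍ) : ℂ) = -1 / z := by
        rw [coe_smul_eq]
        simp [autJ, ModularGroup.S]
      have e2 : autJ ModularGroup.S z = z := by simp [autJ, ModularGroup.S]
      rw [e, e2, ← norm_sqrtJ, ← norm_mul]
      fin_cases i
      · exact congrArg _ (T2_neg_inv z.im_pos)
      · exact congrArg _ (T3_neg_inv z.im_pos)
      · exact congrArg _ (T4_neg_inv z.im_pos)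
    · refine ⟨Equiv.swap 1 2, fun i z => ?_⟩
      have hj : autJ ModularGroup.T z = 1 := by simp [autJ, ModularGroup.T]
      have e : ((ModularGroup.T • z : ℍ) : ℂ) = z + 1 := by
        rw [coe_smul_eq]
        simp [autJ, ModularGroup.T]
      rw [e, hj, norm_one, Real.one_rpow, one_mul]
      fin_cases i
      · have h : ‖Complex.exp (Real.pi * Complex.I / 4)‖ = 1 := by
          rw [show (Real.pi * Complex.I / 4 : ℂ) = ((Real.pi / 4 : ℝ) : ℂ) * Complex.I by
            push_cast; ring, Complex.norm_exp_ofReal_mul_I]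
        refine (congrArg _ (T2_add_one z.im_pos)).trans ?_
        rw [norm_mul, h, one_mul]
        rfl
      · rfl
      · exact congrArg _ (T4_add_one z)
  | one => exact ⟨1, fun i z => by simp [autJ]⟩
  | mul x y _ _ hx hy =>
    obtain ⟨σ, hσ⟩ := hx
    obtain ⟨τ, hτ⟩ := hy
    refine ⟨σ.trans τ, fun i z => ?_⟩
    rw [mul_smul, hσ, hτ, autJ_mul, norm_mul, Real.mul_rpow (norm_nonneg _) (norm_nonneg _),
      Equiv.trans_apply]
    ring
  | inv x _ hx =>
    obtain ⟨σ, hσ⟩ := hx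
    refine ⟨σ.symm, fun i z => ?_⟩
    have h := hσ (σ.symm i) (x⁻¹ • z)
    rw [smul_inv_smul, Equiv.apply_symm_apply] at h
    have h2 : ‖autJ x⁻¹ z‖ * ‖autJ x (x⁻¹ • z)‖ = 1 := by
      rw [mul_comm, ← norm_mul, ← autJ_mul, mul_inv_cancel]
      simp [autJ]
    rw [h, ← mul_assoc, ← Real.mul_rpow (norm_nonneg _) (norm_nonneg _), h2, Real.one_rpow,
      one_mul]

lemma cuspBdd_theta (i : Fin 3) : CuspBdd (1 / 2) fun z : ℍ => (![T2, T3, T4] i) z := by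
  intro γ
  obtain ⟨σ, hσ⟩ := exists_norm_theta_smul γ
  generalize hj : σ i = j
  have hb : (fun z : ℍ => (![T2, T3, T4] j) z) =O[atImInfty] fun _ => (1 : ℝ) := by
    fin_cases j
    · exact tendsto_T2.isBigO_one ℝ
    · exact tendsto_T3.isBigO_one ℝ
    · exact tendsto_T4.isBigO_one ℝ
  have := (isBigO_refl (fun z : ℍ => ‖autJ γ z‖ ^ (1 / 2 : ℝ)) atImInfty).mul hb.norm_left
  refine IsBigO.of_norm_left ((this.congr_left fun z => (by rw [hσ, hj])).congr_right fun z => ?_)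
  rw [mul_one]

lemma cuspBdd_T2 : CuspBdd (1 / 2) fun z : ℍ => T2 z := cuspBdd_theta 0

lemma cuspBdd_T3 : CuspBdd (1 / 2) fun z : ℍ => T3 z := cuspBdd_theta 1

/-! ### The hexagonal theta series in terms of the Jacobi theta functions -/

/-- The summand of the hexagonal theta series. -/
noncomputable def thetaTerm (z : ℂ) (v : ℤ × ℤ) : ℂ :=
  Complex.exp (2 * Real.pi * Complex.I * (v.1 ^ 2 + v.1 * v.2 + v.2 ^ 2 : ℤ) * z)

lemma isCompl_range_snd_even_odd :
    IsCompl (Set.range fun v : ℤ × ℤ => (v.1, 2 * v.2))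
      (Set.range fun v : ℤ × ℤ => (v.1, 2 * v.2 + 1)) := by
  constructor
  · rw [Set.disjoint_left]
    rintro _ ⟨⟨a, b⟩, rfl⟩ ⟨⟨c, d⟩, h⟩
    simp only [Prod.mk.injEq] at h
    omega
  · rw [codisjoint_iff]
    refine Set.eq_univ_of_forall fun ⟨x, y⟩ => ?_
    rcases Int.even_or_odd' y with ⟨k, h | h⟩
    · exact Or.inl ⟨(x, k), by simp [h]⟩
    · exact Or.inr ⟨(x, k), by simp [h]⟩

lemma isCompl_range_fst_even_odd :
    IsCompl (Set.range fun v : ℤ × ℤ => (2 * v.1, v.2))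
      (Set.range fun v : ℤ × ℤ => (2 * v.1 + 1, v.2)) := by
  constructor
  · rw [Set.disjoint_left]
    rintro _ ⟨⟨a, b⟩, rfl⟩ ⟨⟨c, d⟩, h⟩
    simp only [Prod.mk.injEq] at h
    omega
  · rw [codisjoint_iff]
    refine Set.eq_univ_of_forall fun ⟨x, y⟩ => ?_
    rcases Int.even_or_odd' x with ⟨k, h | h⟩
    · exact Or.inl ⟨(k, y), by simp [h]⟩
    · exact Or.inr ⟨(k, y), by simp [h]⟩

lemma injective_snd_even : Function.Injective fun v : ℤ × ℤ => (v.1, 2 * v.2) := by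
  rintro ⟨a, b⟩ ⟨c, d⟩ h
  simp only [Prod.mk.injEq] at h ⊢
  omega

lemma injective_snd_odd : Function.Injective fun v : ℤ × ℤ => (v.1, 2 * v.2 + 1) := by
  rintro ⟨a, b⟩ ⟨c, d⟩ h
  simp only [Prod.mk.injEq] at h ⊢
  omega

lemma injective_fst_even : Function.Injective fun v : ℤ × ℤ => (2 * v.1, v.2) := by
  rintro ⟨a, b⟩ ⟨c, d⟩ h
  simp only [Prod.mk.injEq] at h ⊢
  omega

lemma injective_fst_odd : Function.Injective fun v : ℤ × ℤ => (2 * v.1 + 1, v.2) := by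
  rintro ⟨a, b⟩ ⟨c, d⟩ h
  simp only [Prod.mk.injEq] at h ⊢
  omega

lemma im_three_mul_pos {z : ℂ} (hz : 0 < z.im) : 0 < (3 * z).im := by
  simpa using im_natCast_mul_pos hz 3

/-- `(m, n) ↦ (m - n, n)`. -/
def shearEquiv : ℤ × ℤ ≃ ℤ × ℤ where
  toFun v := (v.1 - v.2, v.2)
  invFun v := (v.1 + v.2, v.2)
  left_inv v := by simp
  right_inv v := by simp

/-- The part of the hexagonal theta series with `y` even. -/
lemma hasSum_thetaTerm_even {z : ℂ} (hz : 0 < z.im) :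
    HasSum (fun v : ℤ × ℤ => thetaTerm z (v.1, 2 * v.2)) (T3 (2 * z) * T3 (2 * (3 * z))) := by
  have h := hasSum_mul_of_int (hasSum_T3 (im_two_mul_pos hz))
    (hasSum_T3 (im_two_mul_pos (im_three_mul_pos hz)))
  rw [← shearEquiv.hasSum_iff]
  refine h.congr_fun fun v => ?_
  rw [← Complex.exp_add, Function.comp_apply, thetaTerm]
  congr 1
  simp only [shearEquiv, Equiv.coe_fn_mk]
  push_cast
  ring

/-- The part of the hexagonal theta series with `y` odd. -/
lemma hasSum_thetaTerm_odd {z : ℂ} (hz : 0 < z.im) :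
    HasSum (fun v : ℤ × ℤ => thetaTerm z (v.1, 2 * v.2 + 1))
      (T2 (2 * z) * T2 (2 * (3 * z))) := by
  have h := hasSum_mul_of_int (hasSum_T2 (im_two_mul_pos hz))
    (hasSum_T2 (im_two_mul_pos (im_three_mul_pos hz)))
  rw [← shearEquiv.hasSum_iff]
  refine h.congr_fun fun v => ?_
  rw [← Complex.exp_add, Function.comp_apply, thetaTerm]
  congr 1
  simp only [shearEquiv, Equiv.coe_fn_mk]
  push_cast
  ring

lemma hasSum_thetaTerm {z : ℂ} (hz : 0 < z.im) :
    HasSum (thetaTerm z) (T3 (2 * z) * T3 (2 * (3 * z)) + T2 (2 * z) * T2 (2 * (3 * z))) :=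
  hasSum_of_isCompl injective_snd_even injective_snd_odd isCompl_range_snd_even_odd
    (hasSum_thetaTerm_even hz) (hasSum_thetaTerm_odd hz)

lemma Theta_eq {z : ℂ} (hz : 0 < z.im) :
    Theta z = T3 (2 * z) * T3 (2 * (3 * z)) + T2 (2 * z) * T2 (2 * (3 * z)) :=
  (hasSum_thetaTerm hz).tsum_eq

/-- The three nonzero classes of `(x, y)` modulo `2` contribute equally, being permuted by
automorphisms of the quadratic form, and the zero class contributes `Θ(4 z)`. -/
lemma three_mul_T3_mul_T3 {z : ℂ} (hz : 0 < z.im) :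
    3 * (T3 (2 * z) * T3 (2 * (3 * z))) = Theta z + 2 * Theta (4 * z) := by
  have hT := hasSum_thetaTerm hz
  rw [← Theta_eq hz] at hT
  have h4 := hasSum_thetaTerm (im_four_mul_pos hz)
  rw [← Theta_eq (im_four_mul_pos hz)] at h4
  have h00 : HasSum (fun v : ℤ × ℤ => thetaTerm z (2 * v.1, 2 * v.2)) (Theta (4 * z)) := by
    refine h4.congr_fun fun v => ?_
    rw [thetaTerm, thetaTerm]
    congr 1
    push_cast
    ring
  have h10 : Summable fun v : ℤ × ℤ => thetaTerm z (2 * v.1 + 1, 2 * v.2) :=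
    hT.summable.comp_injective (injective_snd_even.comp injective_fst_odd)
  set K := ∑' v : ℤ × ℤ, thetaTerm z (2 * v.1 + 1, 2 * v.2) with hK
  have h10 : HasSum (fun v : ℤ × ℤ => thetaTerm z (2 * v.1 + 1, 2 * v.2)) K := h10.hasSum
  have h01 : HasSum (fun v : ℤ × ℤ => thetaTerm z (2 * v.1, 2 * v.2 + 1)) K := by
    rw [← (Equiv.prodComm ℤ ℤ).hasSum_iff]
    refine h10.congr_fun fun v => ?_
    simp only [Function.comp_apply, Equiv.prodComm_apply, Prod.fst_swap, Prod.snd_swap]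
    rw [thetaTerm, thetaTerm]
    congr 1
    push_cast
    ring
  have h11 : HasSum (fun v : ℤ × ℤ => thetaTerm z (2 * v.1 + 1, 2 * v.2 + 1)) K := by
    -- the form takes equal values at `(x, y)` and `(x, -x - y)`
    let e : ℤ × ℤ ≃ ℤ × ℤ :=
      { toFun := fun v => (v.1, -v.1 - v.2 - 1)
        invFun := fun v => (v.1, -v.1 - v.2 - 1)
        left_inv := fun v => by ext <;> simp; ring
        right_inv := fun v => by ext <;> simp; ring }
    rw [← e.hasSum_iff]
    refine h10.congr_fun fun v => ?_
    simp only [Function.comp_apply, e, Equiv.coe_fn_mk]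
    rw [thetaTerm, thetaTerm]
    congr 1
    push_cast
    ring
  have he := (hasSum_of_isCompl (f := fun v : ℤ × ℤ => thetaTerm z (v.1, 2 * v.2))
    injective_fst_even injective_fst_odd isCompl_range_fst_even_odd h00 h10)
  have ho := (hasSum_of_isCompl (f := fun v : ℤ × ℤ => thetaTerm z (v.1, 2 * v.2 + 1))
    injective_fst_even injective_fst_odd isCompl_range_fst_even_odd h01 h11)
  have h1 := he.unique (hasSum_thetaTerm_even hz)
  have h2 := hT.unique (hasSum_of_isCompl injective_snd_even injective_snd_odd
    isCompl_range_snd_even_odd he ho)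
  rw [← h1, h2]
  ring

/-- `T₃(z) T₃(3 z)`; the functions `Θ(2 z)`, `Θ(z / 2)` and `Θ(z) ^ 2` are polynomials in this
function and `rr`. -/
noncomputable def pp (z : ℂ) : ℂ := T3 z * T3 (3 * z)

/-- `T₄(z) T₄(3 z)`. -/
noncomputable def rr (z : ℂ) : ℂ := T4 z * T4 (3 * z)

lemma Theta_two_mul {z : ℂ} (hz : 0 < z.im) : Theta (2 * z) = (pp z + rr z) / 2 := by
  have h3 := im_three_mul_pos hz
  rw [Theta_eq (im_two_mul_pos hz), pp, rr, T3_eq z, T3_eq (3 * z), T4_eq hz, T4_eq h3,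
    show 2 * (2 * z) = 4 * z by ring, show 2 * (3 * (2 * z)) = 4 * (3 * z) by ring]
  ring

lemma Theta_half {z : ℂ} (hz : 0 < z.im) : Theta (z / 2) = 2 * pp z - rr z := by
  have h2 : 0 < (z / 2).im := by
    rw [Complex.div_ofNat_im]
    positivity
  have h := three_mul_T3_mul_T3 h2
  rw [show 4 * (z / 2) = 2 * z by ring, Theta_two_mul hz, show 2 * (z / 2) = z by ring,
    show 2 * (3 * (z / 2)) = 3 * z by ring] at h
  rw [pp, rr] at *
  linear_combination -h

lemma T2_mul_T2 {z : ℂ} (hz : 0 < z.im) : T2 z * T2 (3 * z) = pp z - rr z := by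
  have h2 : 0 < (z / 2).im := by
    rw [Complex.div_ofNat_im]
    positivity
  have h := Theta_eq h2
  rw [Theta_half hz, show 2 * (z / 2) = z by ring,
    show 2 * (3 * (z / 2)) = 3 * z by ring, ← pp] at h
  linear_combination -h

lemma Theta_sq {z : ℂ} (hz : 0 < z.im) :
    Theta z ^ 2 = pp z ^ 2 - pp z * rr z + rr z ^ 2 := by
  have h3 := im_three_mul_pos hz
  have e1 := T3_sq hz
  have e2 := T4_sq hz
  have e3 := T3_sq h3
  have e4 := T4_sq h3
  have e5 := T2_sq hz
  have e6 := T2_sq h3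
  have e7 : (pp z - rr z) ^ 2 = T2 z ^ 2 * T2 (3 * z) ^ 2 := by
    rw [← T2_mul_T2 hz]
    ring
  have e8 : pp z ^ 2 = T3 z ^ 2 * T3 (3 * z) ^ 2 := by rw [pp]; ring
  have e9 : rr z ^ 2 = T4 z ^ 2 * T4 (3 * z) ^ 2 := by rw [rr]; ring
  rw [e5, e6] at e7
  rw [e1, e3] at e8
  rw [e2, e4] at e9
  rw [Theta_eq hz]
  linear_combination (-1 / 2) * e7 - (1 / 2) * e8 - (1 / 2) * e9

lemma Theta_neg_inv {z : ℂ} (hz : 0 < z.im) :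
    Theta (-1 / (3 * z)) = -Complex.I * Real.sqrt 3 * z * Theta z := by
  obtain ⟨w, rfl⟩ : ∃ w, z = 2 * w := ⟨z / 2, by ring⟩
  have hw : 0 < w.im := by simpa using hz
  have hw0 : w ≠ 0 := by rintro rfl; simp at hw
  have h3 := im_three_mul_pos hw
  have hp : 0 < (-1 / (3 * (2 * w))).im := im_neg_inv_pos (im_three_mul_pos hz)
  have e1 : 2 * (-1 / (3 * (2 * w))) = -1 / (3 * w) := by field_simp
  have e2 : 2 * (3 * (-1 / (3 * (2 * w)))) = -1 / w := by field_simp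
  have e3 : sqrtJ (3 * w) = (Real.sqrt 3 : ℝ) * sqrtJ w := by
    have := sqrtJ_real_mul hw (t := 3) (by norm_num)
    exact_mod_cast this
  rw [Theta_eq hp, e1, e2, T3_neg_inv hw, T3_neg_inv h3, T2_neg_inv hw, T2_neg_inv h3, e3,
    Theta_two_mul hw, pp, rr]
  linear_combination (Real.sqrt 3 * (T3 w * T3 (3 * w) + T4 w * T4 (3 * w))) * sqrtJ_sq w

lemma Theta_add_one (z : ℂ) : Theta (z + 1) = Theta z := by
  refine tsum_congr fun v => ?_
  rw [Complex.exp_eq_exp_iff_exists_int]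
  exact ⟨v.1 ^ 2 + v.1 * v.2 + v.2 ^ 2, by push_cast; ring⟩

/-- The value of the form `Φ` at `z`. -/
lemma Phi_apply (z : ℍ) : Phi z = 4 * Theta (2 * z) ^ 3 - 3 * Theta z ^ 2 * Theta (2 * z) := by
  simp [Phi, push]

lemma Phi_fricke (z : ℍ) :
    Phi (fricke 3 z) = -(-Complex.I * Real.sqrt 3 * z) ^ 3 * Phi z := by
  have hz := z.im_pos
  have hz2 : 0 < ((z : ℂ) / 2).im := by
    rw [Complex.div_ofNat_im]
    exact div_pos hz two_pos
  have hz0 : (z : ℂ) ≠ 0 := z.ne_zero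
  rw [Phi_apply, Phi_apply, coe_fricke, Nat.cast_ofNat, Theta_neg_inv hz,
    show 2 * (-1 / (3 * (z : ℂ))) = -1 / (3 * ((z : ℂ) / 2)) by field_simp, Theta_neg_inv hz2]
  have h1 := Theta_half hz
  have h2 := Theta_two_mul hz
  rw [h1, h2]
  linear_combination (-(-Complex.I * Real.sqrt 3 * z) ^ 3 * (9 / 2) * pp z) * Theta_sq hz

/-! ### The forms of levels 2, 3, 4, 6 and 8 -/

section

lemma th_one_apply (z : ℍ) : th 1 z = T3 (2 * z) := by
  simp [push, theta_eq_T3]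

lemma th_two_apply (z : ℍ) : th 2 z = T3 (4 * z) := by
  simp only [push]
  rw [theta_eq_T3, Nat.cast_ofNat, ← mul_assoc]
  norm_num

lemma mdifferentiable_T3 : MDifferentiable 𝓘(ℂ) 𝓘(ℂ) fun z : ℍ => T3 z :=
  mdifferentiable_of_differentiableAt fun _ => differentiableAt_T3

lemma mdifferentiable_T2 : MDifferentiable 𝓘(ℂ) 𝓘(ℂ) fun z : ℍ => T2 z :=
  mdifferentiable_of_differentiableAt fun _ => differentiableAt_T2

lemma mdifferentiable_push {F : ℂ → ℂ} (hF : MDifferentiable 𝓘(ℂ) 𝓘(ℂ) fun z : ℍ => F z)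
    (t : ℕ) [NeZero t] : MDifferentiable 𝓘(ℂ) 𝓘(ℂ) (push F t) :=
  hF.comp (mdifferentiable_scale t)

lemma push_theta_eq (t : ℕ) : th t = push T3 (2 * t) := by
  ext z
  simp only [push]
  rw [theta_eq_T3, Nat.cast_mul, Nat.cast_ofNat, mul_assoc]

lemma mdifferentiable_th (t : ℕ) [NeZero t] : MDifferentiable 𝓘(ℂ) 𝓘(ℂ) (th t) := by
  rw [push_theta_eq]
  exact mdifferentiable_push mdifferentiable_T3 (2 * t)

lemma cuspBdd_th (t : ℕ) [NeZero t] : CuspBdd (1 / 2) (th t) := by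
  rw [push_theta_eq]
  exact cuspBdd_T3.comp_scale (2 * t)

lemma T3_add_two (z : ℂ) : T3 (z + 2) = T3 z := by
  rw [show z + 2 = z + 1 + 1 by ring, T3_add_one, T4_add_one]

lemma th_one_add_one (z : ℍ) : th 1 ((1 : ℝ) +ᵥ z) = th 1 z := by
  rw [th_one_apply, th_one_apply, coe_vadd, ← T3_add_two (2 * (z : ℂ))]
  push_cast
  ring_nf

lemma th_two_add_one (z : ℍ) : th 2 ((1 : ℝ) +ᵥ z) = th 2 z := by
  rw [th_two_apply, th_two_apply, coe_vadd, ← T3_add_two (4 * (z : ℂ)),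
    ← T3_add_two (4 * (z : ℂ) + 2)]
  push_cast
  ring_nf

lemma chi4_periodic (d c : ℤ) (h : ((4 : ℕ) : ℤ) ∣ c) : chr ZMod.χ₄ (d + c) = chr ZMod.χ₄ d := by
  have := (ZMod.intCast_zmod_eq_zero_iff_dvd c 4).mpr h
  rw [chr, chr, Int.cast_add, this, add_zero]

lemma chi4_neg (d : ℤ) : chr ZMod.χ₄ (-d) = (-1) ^ (1 : ℤ) * chr ZMod.χ₄ d := by
  have : ∀ x : ZMod 4, ZMod.χ₄ (-x) = -ZMod.χ₄ x := by decide
  rw [chr, chr, Int.cast_neg, this]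
  push_cast
  simp

lemma chr_one {m : ℕ} (χ : MulChar (ZMod m) ℤ) : chr χ 1 = 1 := by simp [chr]

lemma isForm_th_one_sq : IsForm 4 (chr ZMod.χ₄) 1 (th 1 ^ 2) := by
  refine IsForm.of_fricke (by norm_num) (by norm_num) (κ := -2 * Complex.I) chi4_periodic
    (chr_one _) chi4_neg ((mdifferentiable_th 1).pow 2) ?_ (fun z => ?_) (fun z => ?_) ?_
  · convert (cuspBdd_th 1).pow 2 using 1
    norm_num
  · simp only [Pi.pow_apply, th_one_add_one]
  · have h2 := im_two_mul_pos z.im_pos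
    have hz0 : (z : ℂ) ≠ 0 := z.ne_zero
    simp only [Pi.pow_apply]
    rw [th_one_apply, th_one_apply, coe_fricke, Nat.cast_ofNat,
      show 2 * (-1 / (4 * (z : ℂ))) = -1 / (2 * z) by field_simp; ring, T3_neg_inv h2,
      mul_pow, sqrtJ_sq, zpow_one]
    ring
  · rw [mul_pow, Complex.I_sq]
    norm_num

lemma isForm_th_one_sq_eight : IsForm 8 (chr ZMod.χ₄) 1 (th 1 ^ 2) :=
  isForm_th_one_sq.mono (by norm_num)

lemma isForm_th_two_sq : IsForm 8 (chr ZMod.χ₄) 1 (th 2 ^ 2) := by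
  have h := isForm_th_one_sq.comp_scale 2
  have e : (th 1 ^ 2) ∘ scale 2 = th 2 ^ 2 := by
    have := push_comp_scale theta 1 2
    rw [one_mul] at this
    exact congrArg (fun f : ℍ → ℂ => f ^ 2) this
  rwa [e] at h

/-- `θ₂(2 z)⁴` in terms of `θ(z)` and `θ(2 z)`. -/
lemma T2_two_mul_pow_four (z : ℍ) :
    T2 (2 * z) ^ 4 = 4 * th 2 z ^ 2 * (th 1 z ^ 2 - th 2 z ^ 2) := by
  have h2 := im_two_mul_pos z.im_pos
  have h1 := T2_sq h2
  have h3 := T3_sq h2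
  rw [show 2 * (2 * (z : ℂ)) = 4 * z by ring] at h1 h3
  rw [th_one_apply, th_two_apply, h3]
  linear_combination (T2 (2 * z) ^ 2 + 2 * T3 (4 * z) * T2 (4 * z)) * h1

lemma A_apply (z : ℍ) : A z = T3 (2 * z) ^ 4 + T2 (2 * z) ^ 4 := by
  rw [T2_two_mul_pow_four, ← th_one_apply]
  simp [A]
  ring

lemma A_apply' (z : ℍ) : A z = (T3 z ^ 4 + T4 z ^ 4) / 2 := by
  rw [A_apply]
  linear_combination (-1 / 2 * (T3 z ^ 2 + T3 (2 * z) ^ 2 + T2 (2 * z) ^ 2)) * T3_sq z.im_pos -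
    1 / 2 * (T4 z ^ 2 + T3 (2 * z) ^ 2 - T2 (2 * z) ^ 2) * T4_sq z.im_pos

lemma D_apply (z : ℍ) : D z = T3 (2 * z) ^ 4 - 2 * T2 (2 * z) ^ 4 := by
  rw [T2_two_mul_pow_four, ← th_one_apply]
  simp [D]
  ring

lemma C_apply (z : ℍ) : C z = T3 (2 * z) ^ 4 := by
  rw [C, Pi.pow_apply, th_one_apply]

lemma B_apply (z : ℍ) :
    B z = T3 (2 * z) ^ 8 - 6 * T3 (2 * z) ^ 4 * T2 (2 * z) ^ 4 + T2 (2 * z) ^ 8 := by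
  rw [show T2 (2 * z) ^ 8 = (T2 (2 * z) ^ 4) ^ 2 by ring, T2_two_mul_pow_four, ← th_one_apply]
  simp [B]
  ring

lemma T2_pow_eight (z : ℍ) : T2 z ^ 8 = 16 * T3 (2 * z) ^ 4 * T2 (2 * z) ^ 4 := by
  rw [show T2 z ^ 8 = (T2 z ^ 2) ^ 4 by ring, T2_sq z.im_pos]
  ring

/-- Jacobi's identity. -/
lemma T3_pow_four {z : ℂ} (hz : 0 < z.im) : T3 z ^ 4 = T2 z ^ 4 + T4 z ^ 4 := by
  linear_combination (T3 z ^ 2 + T3 (2 * z) ^ 2 + T2 (2 * z) ^ 2) * T3_sq hz -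
    (T4 z ^ 2 + T3 (2 * z) ^ 2 - T2 (2 * z) ^ 2) * T4_sq hz -
    (T2 z ^ 2 + 2 * T3 (2 * z) * T2 (2 * z)) * T2_sq hz

lemma A_sq_sub_B (z : ℍ) : A z ^ 2 - B z = T2 z ^ 8 / 2 := by
  rw [A_apply, B_apply, T2_pow_eight]
  ring

lemma sqrtJ_pow_four (z : ℂ) : sqrtJ z ^ 4 = -z ^ 2 := by
  rw [show sqrtJ z ^ 4 = (sqrtJ z ^ 2) ^ 2 by ring, sqrtJ_sq, mul_pow, neg_sq, Complex.I_sq]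
  ring

lemma A_fricke (z : ℍ) : A (fricke 2 z) = -2 * (z : ℂ) ^ 2 * A z := by
  have h2 := im_two_mul_pos z.im_pos
  rw [A_apply', A_apply, coe_fricke, Nat.cast_ofNat, T3_neg_inv h2, T4_neg_inv h2, mul_pow,
    mul_pow, sqrtJ_pow_four]
  ring

lemma B_fricke (z : ℍ) : B (fricke 2 z) = -4 * (z : ℂ) ^ 4 * B z := by
  have h2 := im_two_mul_pos z.im_pos
  have h1 := A_sq_sub_B (fricke 2 z)
  rw [A_fricke, coe_fricke, Nat.cast_ofNat, T2_neg_inv h2, mul_pow (sqrtJ (2 * (z : ℂ))),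
    show sqrtJ (2 * z) ^ 8 = (sqrtJ (2 * z) ^ 4) ^ 2 by ring, sqrtJ_pow_four] at h1
  have h3 := T3_pow_four h2
  have h4 : T4 (2 * (z : ℂ)) ^ 8 = (T3 (2 * z) ^ 4 - T2 (2 * z) ^ 4) ^ 2 := by
    rw [h3]
    ring
  rw [h4] at h1
  rw [A_apply] at h1
  rw [B_apply z]
  linear_combination -h1

lemma D_fricke (z : ℍ) : D (fricke 4 z) = 4 * (z : ℂ) ^ 2 * D z := by
  have h2 := im_two_mul_pos z.im_pos
  have hz0 : (z : ℂ) ≠ 0 := z.ne_zero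
  rw [D_apply, D_apply, coe_fricke, Nat.cast_ofNat,
      show 2 * (-1 / (4 * (z : ℂ))) = -1 / (2 * z) by field_simp; ring, T3_neg_inv h2,
      T2_neg_inv h2, mul_pow, mul_pow, sqrtJ_pow_four]
  linear_combination (-8 * (z : ℂ) ^ 2) * T3_pow_four h2

lemma C_fricke (z : ℍ) : C (fricke 4 z) = -4 * (z : ℂ) ^ 2 * C z := by
  have h2 := im_two_mul_pos z.im_pos
  have hz0 : (z : ℂ) ≠ 0 := z.ne_zero
  rw [C_apply, C_apply, coe_fricke, Nat.cast_ofNat,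
      show 2 * (-1 / (4 * (z : ℂ))) = -1 / (2 * z) by field_simp; ring, T3_neg_inv h2,
      mul_pow, sqrtJ_pow_four]
  ring

variable {N : ℕ} {χ : ℤ → ℂ} {k a b m : ℕ} {g G : ℍ → ℂ}

lemma IsForm.pow_mul_pow (hg : IsForm N χ a g) (hG : IsForm N (χ ^ m) (m * a : ℕ) G) {i j : ℕ}
    (h : i + m * j = k) : IsForm N (χ ^ k) (k * a : ℕ) (g ^ i * G ^ j) := by
  convert (hg.pow i).mul (hG.pow j) using 1
  · rw [← h, pow_add, pow_mul]
  · rw [← h]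
    push_cast
    ring

lemma isForm_th_monomial {i j : ℕ} (h : i + j = k) :
    IsForm 8 (chr ZMod.χ₄ ^ k) k ((th 1 ^ 2) ^ i * (th 2 ^ 2) ^ j) := by
  have := IsForm.pow_mul_pow (N := 8) (χ := chr ZMod.χ₄) (k := k) (a := 1) (m := 1)
    (g := th 1 ^ 2) (G := th 2 ^ 2) (i := i) (j := j)
    isForm_th_one_sq_eight (by simpa using! isForm_th_two_sq) (by omega)
  simpa using! this

/-- Holomorphy and boundedness of `A` at the cusps, as needed for the smaller level of `A`. -/
lemma isForm_eight_A : IsForm 8 (chr ZMod.χ₄ ^ 2) (2 : ℕ) A := by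
  convert! ((isForm_th_monomial (i := 2) (j := 0) (k := 2) rfl).add
    ((isForm_th_monomial (i := 1) (j := 1) (k := 2) rfl).smul 4)).sub
    ((isForm_th_monomial (i := 0) (j := 2) (k := 2) rfl).smul 4) using 1
  ext z
  simp [A]
  ring

/-- Holomorphy and boundedness of `D` at the cusps, as needed for the smaller level of `D`. -/
lemma isForm_eight_D : IsForm 8 (chr ZMod.χ₄ ^ 2) (2 : ℕ) D := by
  convert! ((isForm_th_monomial (i := 2) (j := 0) (k := 2) rfl).sub
    ((isForm_th_monomial (i := 1) (j := 1) (k := 2) rfl).smul 8)).add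
    ((isForm_th_monomial (i := 0) (j := 2) (k := 2) rfl).smul 8) using 1
  ext z
  simp [D]
  ring

/-- Holomorphy and boundedness of `B` at the cusps, as needed for the smaller level of `B`. -/
lemma isForm_eight_B : IsForm 8 (chr ZMod.χ₄ ^ 4) (4 : ℕ) B := by
  convert! ((((isForm_th_monomial (i := 4) (j := 0) (k := 4) rfl).sub
    ((isForm_th_monomial (i := 3) (j := 1) (k := 4) rfl).smul 24)).add
    ((isForm_th_monomial (i := 2) (j := 2) (k := 4) rfl).smul 40)).sub
    ((isForm_th_monomial (i := 1) (j := 3) (k := 4) rfl).smul 32)).add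
    ((isForm_th_monomial (i := 0) (j := 4) (k := 4) rfl).smul 16) using 1
  ext z
  simp [B]
  ring

lemma isForm_A : IsForm 2 1 2 A := by
  refine IsForm.of_fricke (by norm_num) (by norm_num) (κ := -2) (fun _ _ _ => rfl) rfl
    (fun _ => by simp) isForm_eight_A.holo isForm_eight_A.bdd (fun z => ?_)
    (fun z => A_fricke z) (by norm_num)
  simp only [A, Pi.add_apply, Pi.sub_apply, Pi.mul_apply, Pi.pow_apply, th_one_add_one,
    th_two_add_one, Pi.ofNat_apply]

lemma isForm_B : IsForm 2 1 4 B := by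
  refine IsForm.of_fricke (by norm_num) (by norm_num) (κ := -4) (fun _ _ _ => rfl) rfl
    (fun _ => by simp [Even.neg_one_zpow (by decide : Even (4 : ℤ))])
    isForm_eight_B.holo isForm_eight_B.bdd (fun z => ?_)
    (fun z => B_fricke z) (by norm_num)
  simp only [B, Pi.add_apply, Pi.sub_apply, Pi.mul_apply, Pi.pow_apply, th_one_add_one,
    th_two_add_one, Pi.ofNat_apply]

lemma isForm_D : IsForm 4 1 2 D := by
  refine IsForm.of_fricke (by norm_num) (by norm_num) (κ := 4) (fun _ _ _ => rfl) rfl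
    (fun _ => by simp) isForm_eight_D.holo isForm_eight_D.bdd (fun z => ?_)
    (fun z => D_fricke z) (by norm_num)
  simp only [D, Pi.add_apply, Pi.sub_apply, Pi.mul_apply, Pi.pow_apply, th_one_add_one,
    th_two_add_one, Pi.ofNat_apply]

lemma chr_sq_of_isCoprime {m : ℕ} (χ : MulChar (ZMod m) ℤ) (hχ : ∀ x, IsUnit x → χ x ^ 2 = 1)
    {N : ℕ} (h : m ∣ N) {d : ℤ} (hd : IsCoprime d N) : (chr χ ^ 2) d = 1 := by
  rw [Pi.pow_apply, chr]
  have h1 : IsUnit (d : ZMod m) := by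
    obtain ⟨a, b, hab⟩ := hd
    have := congrArg (fun x : ℤ => (x : ZMod m)) hab
    push_cast at this
    rw [(ZMod.natCast_eq_zero_iff N m).mpr h, mul_zero, add_zero] at this
    exact IsUnit.of_mul_eq_one_right _ this
  exact_mod_cast hχ _ h1

lemma chi4_sq {N : ℕ} (h : 4 ∣ N) {d : ℤ} (hd : IsCoprime d N) : (chr ZMod.χ₄ ^ 2) d = 1 :=
  chr_sq_of_isCoprime _ (by decide) h hd

lemma isForm_C : IsForm 4 1 2 C := by
  have := (isForm_th_one_sq.pow 2).congr_char (ψ := 1) fun d hd => chi4_sq dvd_rfl hd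
  rwa [← pow_mul] at this

lemma chi3_periodic (d c : ℤ) (h : ((3 : ℕ) : ℤ) ∣ c) : chr chi3 (d + c) = chr chi3 d := by
  have := (ZMod.intCast_zmod_eq_zero_iff_dvd c 3).mpr h
  rw [chr, chr, Int.cast_add, this, add_zero]

lemma chi3_neg (d : ℤ) : chr chi3 (-d) = -chr chi3 d := by
  have h : chi3 (-1) = -1 := by
    rw [chi3, quadraticChar_neg_one (by simp [ringChar.eq (ZMod 3) 3]), ZMod.card]
    rfl
  rw [chr, chr, Int.cast_neg, ← neg_one_mul (d : ZMod 3), map_mul, h]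
  push_cast
  ring

lemma chi3_sq {N : ℕ} (h : 3 ∣ N) {d : ℤ} (hd : IsCoprime d N) : (chr chi3 ^ 2) d = 1 :=
  chr_sq_of_isCoprime _ (fun _ hx => quadraticChar_sq_one hx.ne_zero) h hd

lemma Th_eq (t : ℕ) [NeZero t] :
    Th t = th t * th (t * 3) + push T2 (2 * t) * push T2 (2 * (t * 3)) := by
  ext z
  have := Theta_eq (im_natCast_mul_pos z.im_pos t)
  simp only [push_theta_eq]
  simp only [push, Pi.add_apply, Pi.mul_apply]
  push_cast
  rw [this]
  ring_nf

lemma cuspBdd_Th (t : ℕ) [NeZero t] : CuspBdd 1 (Th t) := by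
  rw [Th_eq]
  have h := ((cuspBdd_th t).mul (cuspBdd_th (t * 3))).add
    ((cuspBdd_T2.comp_scale (2 * t)).mul (cuspBdd_T2.comp_scale (2 * (t * 3))))
  norm_num at h
  exact h

lemma mdifferentiable_Th (t : ℕ) [NeZero t] : MDifferentiable 𝓘(ℂ) 𝓘(ℂ) (Th t) := by
  rw [Th_eq]
  exact ((mdifferentiable_th t).mul (mdifferentiable_th (t * 3))).add
    ((mdifferentiable_push mdifferentiable_T2 (2 * t)).mul
      (mdifferentiable_push mdifferentiable_T2 (2 * (t * 3))))

lemma Th_one_apply (z : ℍ) : Th 1 z = Theta z := by simp [push]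

lemma Th_two_apply (z : ℍ) : Th 2 z = Theta (2 * z) := by simp [push]

lemma Th_one_add_one (z : ℍ) : Th 1 ((1 : ℝ) +ᵥ z) = Th 1 z := by
  rw [Th_one_apply, Th_one_apply, coe_vadd, add_comm, Complex.ofReal_one, Theta_add_one]

lemma Th_two_add_one (z : ℍ) : Th 2 ((1 : ℝ) +ᵥ z) = Th 2 z := by
  rw [Th_two_apply, Th_two_apply, coe_vadd, Complex.ofReal_one,
    show 2 * (1 + (z : ℂ)) = 2 * z + 1 + 1 by ring, Theta_add_one, Theta_add_one]

lemma Th_one_fricke (z : ℍ) : Th 1 (fricke 3 z) = -Complex.I * Real.sqrt 3 * z * Th 1 z := by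
  rw [Th_one_apply, Th_one_apply, coe_fricke, Nat.cast_ofNat, Theta_neg_inv z.im_pos]

lemma sqrt_three_sq : (Real.sqrt 3 : ℂ) ^ 2 = 3 := by
  rw [← Complex.ofReal_pow, Real.sq_sqrt (by norm_num)]
  norm_num

lemma isForm_Th_one : IsForm 3 (chr chi3) 1 (Th 1) := by
  refine IsForm.of_fricke (by norm_num) (by norm_num) (κ := -Complex.I * Real.sqrt 3)
    chi3_periodic (chr_one _) (fun d => by simp [chi3_neg]) (mdifferentiable_Th 1)
    (by simpa using cuspBdd_Th 1) Th_one_add_one (fun z => by rw [Th_one_fricke, zpow_one]) ?_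
  rw [mul_pow, neg_sq, Complex.I_sq, sqrt_three_sq]
  norm_num

lemma isForm_Th_one_six : IsForm 6 (chr chi3) 1 (Th 1) := isForm_Th_one.mono (by norm_num)

lemma isForm_Th_two : IsForm 6 (chr chi3) 1 (Th 2) := by
  have h := isForm_Th_one.comp_scale 2
  rwa [push_comp_scale, one_mul] at h

lemma isForm_Th_monomial {i j : ℕ} (h : i + j = k) :
    IsForm 6 (chr chi3 ^ k) k (Th 1 ^ i * Th 2 ^ j) := by
  have := IsForm.pow_mul_pow (N := 6) (χ := chr chi3) (k := k) (a := 1) (m := 1)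
    (g := Th 1) (G := Th 2) (i := i) (j := j)
    isForm_Th_one_six (by simpa using! isForm_Th_two) (by omega)
  simpa using! this

/-- Holomorphy and boundedness of `Φ` at the cusps, as needed for level `3`. -/
lemma isForm_six_Phi : IsForm 6 (chr chi3 ^ 3) (3 : ℕ) Phi := by
  convert! ((isForm_Th_monomial (i := 0) (j := 3) (k := 3) rfl).smul 4).sub
    ((isForm_Th_monomial (i := 2) (j := 1) (k := 3) rfl).smul 3) using 1
  ext z
  simp [Phi]
  ring

lemma isForm_Phi : IsForm 3 (chr chi3) 3 Phi := by
  refine IsForm.of_fricke (by norm_num) (by norm_num) (κ := -(-Complex.I * Real.sqrt 3) ^ 3)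
    chi3_periodic (chr_one _)
    (fun d => by rw [chi3_neg, Odd.neg_one_zpow (by decide : Odd (3 : ℤ))]; ring)
    isForm_six_Phi.holo isForm_six_Phi.bdd
    (fun z => ?_) (fun z => ?_) ?_
  · simp only [Phi, Pi.sub_apply, Pi.mul_apply, Pi.pow_apply, Th_one_add_one,
      Th_two_add_one, Pi.ofNat_apply]
  · rw [Phi_fricke]
    norm_cast
    ring
  · rw [neg_sq, ← pow_mul, mul_pow, Even.neg_pow (by decide : Even (3 * 2)),
      show Complex.I ^ (3 * 2) = (Complex.I ^ 2) ^ 3 by ring,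
      show (Real.sqrt 3 : ℂ) ^ (3 * 2) = ((Real.sqrt 3 : ℂ) ^ 2) ^ 3 by ring, Complex.I_sq,
      sqrt_three_sq]
    norm_cast

end

/-! ### The form `θ₁ θ₂` of character `χ₋₈` -/

/-- Up to the automorphy factor, `(1, 0; 4, 1)` exchanges `T₃(2 z) T₃(4 z)` and `T₃(2 z) T₂(4 z)`. -/
lemma th_mul_th_lowU (z : ℍ) :
    (th 1 * th 2) (lowU 4 • z) = autJ (lowU 4) z * (T3 (2 * z) * T2 (4 * z)) ∧
    T3 (2 * (lowU 4 • z : ℍ)) * T2 (4 * (lowU 4 • z : ℍ)) =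
      autJ (lowU 4) z * (th 1 * th 2) z := by
  have hz := z.im_pos
  have h2 := im_two_mul_pos hz
  have h4 := im_four_mul_pos hz
  have hz0 : (z : ℂ) ≠ 0 := z.ne_zero
  obtain ⟨v, hv⟩ : ∃ v : ℂ, v = -1 / (4 * z) - 1 := ⟨_, rfl⟩
  have hj : autJ (lowU 4) z = 4 * z + 1 := by simp [autJ, lowU]
  have hj0 : (4 * z + 1 : ℂ) ≠ 0 := hj ▸ autJ_ne_zero _ z
  have hv' : v = -(4 * z + 1) / (4 * z) := by
    rw [hv]; field_simp; ring
  have hv0 : v ≠ 0 := by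
    rw [hv']
    exact div_ne_zero (neg_ne_zero.mpr hj0) (by simpa using hz0)
  have hvim : 0 < v.im := by
    rw [hv, Complex.sub_im, Complex.one_im, sub_zero]
    exact im_neg_inv_pos h4
  have hU : ((lowU 4 • z : ℍ) : ℂ) = -1 / (4 * v) := by
    rw [coe_smul_eq, hj, hv']
    have h1 : ((lowU 4 0 0 : ℤ) : ℂ) * z + ((lowU 4 0 1 : ℤ) : ℂ) = z := by simp [lowU]
    rw [h1, show 4 * (-(4 * z + 1) / (4 * z) : ℂ) = -((4 * z + 1) / z) by field_simp, div_neg,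
      neg_div, neg_neg, one_div_div]
  have e2 : 2 * (-1 / (4 * v)) = -1 / (2 * v) := by field_simp; ring
  have e4 : 4 * (-1 / (4 * v)) = -1 / v := by field_simp
  have k2 : T3 (2 * v) = sqrtJ (2 * z) * T3 (2 * z) := by
    rw [← T3_neg_inv h2, ← T3_add_two (2 * v), hv]
    congr 1
    field_simp
    ring
  have ev : v + 1 = -1 / (4 * z) := by rw [hv]; ring
  have k3 : T3 v = sqrtJ (4 * z) * T2 (4 * z) := by
    rw [← T4_add_one, ev, T4_neg_inv h4]
  have k4 : T4 v = sqrtJ (4 * z) * T3 (4 * z) := by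
    rw [← T3_add_one, ev, T3_neg_inv h4]
  have kJ : sqrtJ (2 * v) * sqrtJ (2 * z) * (sqrtJ v * sqrtJ (4 * z)) = 4 * z + 1 := by
    have r1 := sqrtJ_real_mul hvim (t := 2) (by norm_num)
    have r2 := sqrtJ_real_mul h2 (t := 2) (by norm_num)
    push_cast at r1 r2
    rw [show 2 * (2 * (z : ℂ)) = 4 * z by ring] at r2
    have r3 : (Real.sqrt 2 : ℂ) ^ 2 = 2 := by
      rw [← Complex.ofReal_pow, Real.sq_sqrt (by norm_num)]
      norm_num
    have e : -4 * (v * z) = 4 * z + 1 := by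
      rw [hv']; field_simp
    rw [r1, r2, show (Real.sqrt 2 : ℂ) * sqrtJ v * sqrtJ (2 * z) *
      (sqrtJ v * ((Real.sqrt 2 : ℂ) * sqrtJ (2 * z))) =
      (Real.sqrt 2 : ℂ) ^ 2 * sqrtJ v ^ 2 * sqrtJ (2 * z) ^ 2 by ring, r3, sqrtJ_sq, sqrtJ_sq]
    linear_combination e + 4 * v * z * Complex.I_sq
  rw [Pi.mul_apply, Pi.mul_apply, th_one_apply, th_two_apply, th_one_apply, th_two_apply, hU,
    e2, e4, T3_neg_inv (im_two_mul_pos hvim), T3_neg_inv hvim, T2_neg_inv hvim, k2, k3, k4, hj,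
    ← kJ]
  constructor <;> ring

lemma T2_add_four {z : ℂ} (hz : 0 < z.im) : T2 (z + 4) = -T2 z := by
  have h (r : ℝ) : 0 < (z + r).im := by simpa using hz
  have h1 := h 1
  have h2 := h 2
  have h3 := h 3
  push_cast at h1 h2 h3
  rw [show z + 4 = z + 3 + 1 by ring, T2_add_one h3, show z + 3 = z + 2 + 1 by ring,
    T2_add_one h2, show z + 2 = z + 1 + 1 by ring, T2_add_one h1, T2_add_one hz,
    ← mul_assoc, ← mul_assoc, ← mul_assoc, ← Complex.exp_add, ← Complex.exp_add,
    ← Complex.exp_add, show (Real.pi * Complex.I / 4 + Real.pi * Complex.I / 4 +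
      Real.pi * Complex.I / 4 + Real.pi * Complex.I / 4 : ℂ) = Real.pi * Complex.I by ring,
    Complex.exp_pi_mul_I]
  ring

/-- The pair `(θ₃(2 z) θ₃(4 z), θ₃(2 z) θ₂(4 z))`. -/
noncomputable def thetaPair (b : Bool) (z : ℍ) : ℂ :=
  if b then (th 1 * th 2) z else T3 (2 * z) * T2 (4 * z)

/-- `Γ₀(4)` acts on the pair `thetaPair` through signed permutations. -/
lemma thetaPair_smul {γ : SL(2, ℤ)} (hγ : γ ∈ Gamma0 4) (z : ℍ) :
    (th 1 * th 2) (γ • z) = chr ZMod.χ₈' (γ 1 1) * autJ γ z *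
      thetaPair (decide ((8 : ℤ) ∣ γ 1 0)) z := by
  have jT (z : ℍ) : autJ ModularGroup.T z = 1 := by simp [autJ, ModularGroup.T]
  have jN (z : ℍ) : autJ (-1) z = -1 := by simp [autJ]
  have sN (z : ℍ) : (-1 : SL(2, ℤ)) • z = z := by
    ext1
    rw [coe_smul_eq, jN]
    simp
  have hT (b : Bool) (z : ℍ) : thetaPair b (ModularGroup.T • z) =
      (if b then 1 else -1) * thetaPair b z := by
    rw [T_smul_eq]
    cases b
    · have e1 : T3 (2 * (((1 : ℝ) +ᵥ z : ℍ) : ℂ)) = T3 (2 * z) := by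
        rw [← th_one_apply, th_one_add_one, th_one_apply]
      have e2 : T2 (4 * (((1 : ℝ) +ᵥ z : ℍ) : ℂ)) = -T2 (4 * z) := by
        rw [← T2_add_four (im_four_mul_pos z.im_pos), coe_vadd]
        push_cast
        ring_nf
      simp only [thetaPair, Bool.false_eq_true, if_false, e1, e2]
      ring
    · simp [thetaPair, th_one_add_one, th_two_add_one]
  have hU (b : Bool) (z : ℍ) : thetaPair b (lowU 4 • z) =
      autJ (lowU 4) z * thetaPair (!b) z := by
    cases b
    · simpa [thetaPair] using (th_mul_th_lowU z).2
    · simpa [thetaPair] using (th_mul_th_lowU z).1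
  have hT' (b : Bool) (z : ℍ) : thetaPair b (ModularGroup.T⁻¹ • z) =
      (if b then 1 else -1) * thetaPair b z := by
    have := hT b (ModularGroup.T⁻¹ • z)
    rw [smul_inv_smul] at this
    rw [this]
    cases b <;> simp
  have jinv (γ : SL(2, ℤ)) (z : ℍ) : autJ γ⁻¹ z * autJ γ (γ⁻¹ • z) = 1 := by
    rw [mul_comm, ← autJ_mul, mul_inv_cancel]
    simp [autJ]
  have hU' (b : Bool) (z : ℍ) : thetaPair b ((lowU 4)⁻¹ • z) =
      autJ (lowU 4)⁻¹ z * thetaPair (!b) z := by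
    have := hU (!b) ((lowU 4)⁻¹ • z)
    rw [smul_inv_smul, Bool.not_not] at this
    rw [this, ← mul_assoc, jinv, one_mul]
  have hχ4 : ∀ x : ZMod 8, ZMod.χ₈' (x + 4) = -ZMod.χ₈' x := by decide
  have hχn (x : ℤ) : chr ZMod.χ₈' (-x) = -chr ZMod.χ₈' x := by
    have h : ∀ x : ZMod 8, ZMod.χ₈' (-x) = -ZMod.χ₈' x := by decide
    rw [chr, Int.cast_neg, h, chr]
    push_cast
    ring
  have h8 (c : ℤ) (h4 : ((4 : ℕ) : ℤ) ∣ c) (h : ¬ (8 : ℤ) ∣ c) : (c : ZMod 8) = 4 := by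
    have : ((c - 4 : ℤ) : ZMod 8) = 0 :=
      (ZMod.intCast_zmod_eq_zero_iff_dvd _ 8).mpr (by push_cast at *; omega)
    push_cast at this
    linear_combination this
  have h0 (c : ℤ) (h : (8 : ℤ) ∣ c) : (c : ZMod 8) = 0 :=
    (ZMod.intCast_zmod_eq_zero_iff_dvd _ 8).mpr h
  have mT : ModularGroup.T ∈ Gamma0 4 := mem_Gamma0_iff.mpr (by simp [ModularGroup.T])
  have mU : lowU 4 ∈ Gamma0 4 := mem_Gamma0_iff.mpr (by simp [lowU])
  have mN : (-1 : SL(2, ℤ)) ∈ Gamma0 4 := mem_Gamma0_iff.mpr (by simp)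
  have hchr {x y : ℤ} (hx : (4 : ℤ) ∣ x) : chr ZMod.χ₈' (y + x) =
      (if (8 : ℤ) ∣ x then 1 else -1) * chr ZMod.χ₈' y := by
    split_ifs with h
    · rw [chr, chr, Int.cast_add, h0 x h, add_zero, one_mul]
    · rw [chr, chr, Int.cast_add, h8 x hx h, hχ4]
      push_cast
      ring
  suffices h : γ ∈ Gamma0 4 ∧ ∀ z, (th 1 * th 2) (γ • z) = chr ZMod.χ₈' (γ 1 1) * autJ γ z *
      thetaPair (decide ((8 : ℤ) ∣ γ 1 0)) z from h.2 z
  have hγ' := Gamma0_le_closure (by norm_num) le_rfl hγ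
  rw [Nat.cast_ofNat] at hγ'
  clear hγ
  induction hγ' using Subgroup.closure_induction_right with
  | one => exact ⟨one_mem _, fun z => by simp [autJ, chr_one, thetaPair]⟩
  | mul_right x hx y hy ih =>
    have hdvd := mem_Gamma0_iff.mp ih.1
    rw [Nat.cast_ofNat] at hdvd
    rcases hy with rfl | rfl | rfl
    · refine ⟨mul_mem ih.1 mT, fun z => ?_⟩
      have e0 : (x * ModularGroup.T) 1 0 = x 1 0 := by
        rw [Matrix.SpecialLinearGroup.coe_mul]
        simp [ModularGroup.T, Matrix.mul_apply, Fin.sum_univ_two]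
      have e1 : (x * ModularGroup.T) 1 1 = x 1 1 + x 1 0 := by
        rw [Matrix.SpecialLinearGroup.coe_mul]
        simp [ModularGroup.T, Matrix.mul_apply, Fin.sum_univ_two, add_comm]
      rw [mul_smul, ih.2, e0, e1, hT, autJ_mul, jT, hchr hdvd]
      simp only [decide_eq_true_eq]
      ring
    · refine ⟨mul_mem ih.1 mU, fun z => ?_⟩
      have e0 : (x * lowU 4) 1 0 = x 1 0 + 4 * x 1 1 := by
        rw [Matrix.SpecialLinearGroup.coe_mul]
        simp [lowU, Matrix.mul_apply, Fin.sum_univ_two, mul_comm]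
      have e1 : (x * lowU 4) 1 1 = x 1 1 := by
        rw [Matrix.SpecialLinearGroup.coe_mul]
        simp [lowU, Matrix.mul_apply, Fin.sum_univ_two]
      have hodd : ¬ (2 : ℤ) ∣ x 1 1 := fun h => by
        obtain ⟨a, b, hab⟩ := isCoprime_of_mem_Gamma0 ih.1
        obtain ⟨t, ht⟩ := h
        rw [ht] at hab
        push_cast at hab
        have h1 : (2 : ℤ) ∣ 1 := ⟨a * t + b * 2, by linear_combination -hab⟩
        omega
      have e2 : decide ((8 : ℤ) ∣ x 1 0 + 4 * x 1 1) = !decide ((8 : ℤ) ∣ x 1 0) := by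
        rw [← decide_not, decide_eq_decide]
        omega
      rw [mul_smul, ih.2, e0, e1, hU, autJ_mul, e2]
      ring
    · refine ⟨mul_mem ih.1 mN, fun z => ?_⟩
      have e0 : (x * -1) 1 0 = -x 1 0 := by simp
      have e1 : (x * -1) 1 1 = -x 1 1 := by simp
      rw [mul_smul, ih.2, e0, e1, autJ_mul, sN, jN, hχn]
      simp only [dvd_neg]
      ring
  | mul_inv_cancel x hx y hy ih =>
    have hdvd := mem_Gamma0_iff.mp ih.1
    rw [Nat.cast_ofNat] at hdvd
    rcases hy with rfl | rfl | rfl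
    · refine ⟨mul_mem ih.1 (inv_mem mT), fun z => ?_⟩
      have e0 : (x * ModularGroup.T⁻¹) 1 0 = x 1 0 := by
        rw [Matrix.SpecialLinearGroup.coe_mul, Matrix.SpecialLinearGroup.coe_inv]
        simp [ModularGroup.T, Matrix.mul_apply, Fin.sum_univ_two, Matrix.adjugate_fin_two]
      have e1 : (x * ModularGroup.T⁻¹) 1 1 = x 1 1 + -x 1 0 := by
        rw [Matrix.SpecialLinearGroup.coe_mul, Matrix.SpecialLinearGroup.coe_inv]
        simp [ModularGroup.T, Matrix.mul_apply, Fin.sum_univ_two, add_comm,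
          Matrix.adjugate_fin_two]
      have jT' : autJ ModularGroup.T⁻¹ z = 1 := by
        have := jinv ModularGroup.T z
        rwa [jT, mul_one] at this
      rw [mul_smul, ih.2, e0, e1, hT', autJ_mul, jT', hchr (dvd_neg.mpr hdvd)]
      simp only [decide_eq_true_eq, dvd_neg]
      ring
    · refine ⟨mul_mem ih.1 (inv_mem mU), fun z => ?_⟩
      have e0 : (x * (lowU 4)⁻¹) 1 0 = x 1 0 + -4 * x 1 1 := by
        rw [Matrix.SpecialLinearGroup.coe_mul, Matrix.SpecialLinearGroup.coe_inv]
        simp [lowU, Matrix.mul_apply, Fin.sum_univ_two, mul_comm, Matrix.adjugate_fin_two]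
      have e1 : (x * (lowU 4)⁻¹) 1 1 = x 1 1 := by
        rw [Matrix.SpecialLinearGroup.coe_mul, Matrix.SpecialLinearGroup.coe_inv]
        simp [lowU, Matrix.mul_apply, Fin.sum_univ_two, Matrix.adjugate_fin_two]
      have hodd : ¬ (2 : ℤ) ∣ x 1 1 := fun h => by
        obtain ⟨a, b, hab⟩ := isCoprime_of_mem_Gamma0 ih.1
        obtain ⟨t, ht⟩ := h
        rw [ht] at hab
        push_cast at hab
        have h1 : (2 : ℤ) ∣ 1 := ⟨a * t + b * 2, by linear_combination -hab⟩
        omega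
      have e2 : decide ((8 : ℤ) ∣ x 1 0 + -4 * x 1 1) = !decide ((8 : ℤ) ∣ x 1 0) := by
        rw [← decide_not, decide_eq_decide]
        omega
      rw [mul_smul, ih.2, e0, e1, hU', autJ_mul, e2]
      ring
    · refine ⟨mul_mem ih.1 (inv_mem mN), fun z => ?_⟩
      rw [inv_neg_one]
      have e0 : (x * -1) 1 0 = -x 1 0 := by simp
      have e1 : (x * -1) 1 1 = -x 1 1 := by simp
      rw [mul_smul, ih.2, e0, e1, autJ_mul, sN, jN, hχn]
      simp only [dvd_neg]
      ring

lemma isForm_th_mul_th : IsForm 8 (chr ZMod.χ₈') 1 (th 1 * th 2) where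
  holo := (mdifferentiable_th 1).mul (mdifferentiable_th 2)
  bdd := by
    convert (cuspBdd_th 1).mul (cuspBdd_th 2) using 1
    norm_num
  trans γ hγ z := by
    have h8 := mem_Gamma0_iff.mp hγ
    rw [Nat.cast_ofNat] at h8
    rw [thetaPair_smul (mem_Gamma0_iff.mpr (dvd_trans (by norm_num) h8)), zpow_one]
    simp [thetaPair, h8]

/-! ### The eta function -/

lemma eta_eq (z : ℂ) : ModularForm.eta z = Complex.exp (Real.pi * Complex.I / 12 * z) *
    ∏' n : ℕ, (1 - ModularForm.eta_q n z) := by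
  rw [ModularForm.eta, Function.Periodic.qParam]
  congr 2
  push_cast
  ring

lemma tendsto_tprod_one_sub_eta_q :
    Tendsto (fun z : ℍ => ∏' n : ℕ, (1 - ModularForm.eta_q n z)) atImInfty (𝓝 1) := by
  have htprod : Tendsto (fun q : ℂ ↦ ∏' (n : ℕ), (1 - q ^ (n + 1))) (𝓝 0) (𝓝 1) := by
    have := tendsto_tprod_one_add_of_dominated_convergence (𝓕 := 𝓝 0) (g := 0)
      (f := fun (q : ℂ) (n : ℕ) ↦ -q ^ (n + 1)) (bound := fun n ↦ (1 / 2 : ℝ) ^ (n + 1))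
    simp only [Pi.zero_apply, norm_neg, norm_pow, add_zero, tprod_one] at this
    simp_rw [sub_eq_add_neg]
    refine this ?_ (fun k ↦ ?_) ?_
    · exact (summable_nat_add_iff 1).mpr summable_geometric_two
    · simpa using ((continuous_pow (M := ℂ) (k + 1)).tendsto 0).neg
    · filter_upwards [Metric.ball_mem_nhds (0 : ℂ) (by norm_num : (0 : ℝ) < 1 / 2)] with q hq k
      exact pow_le_pow_left₀ (norm_nonneg _) (by simpa using (Metric.mem_ball.mp hq).le) _
  exact htprod.comp (qParam_tendsto_atImInfty zero_lt_one)

lemma tendsto_eta_div : Tendsto (fun z : ℍ => ModularForm.eta z /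
    Complex.exp (Real.pi * Complex.I / 12 * z)) atImInfty (𝓝 1) := by
  refine tendsto_tprod_one_sub_eta_q.congr fun z => ?_
  rw [eta_eq, mul_div_cancel_left₀ _ (Complex.exp_ne_zero _)]

lemma eta_ne_zero (z : ℍ) : ModularForm.eta z ≠ 0 := ModularForm.eta_ne_zero z.im_pos

lemma mdifferentiable_eta : MDifferentiable 𝓘(ℂ) 𝓘(ℂ) fun z : ℍ => ModularForm.eta z :=
  mdifferentiable_of_differentiableAt fun _ hz =>
    ModularForm.differentiableAt_eta_of_mem_upperHalfPlaneSet hz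

/-- A function vanishing near `i∞` vanishes. -/
lemma eq_zero_of_eventually {f : ℍ → ℂ} (hf : MDifferentiable 𝓘(ℂ) 𝓘(ℂ) f)
    (h : ∀ᶠ z in atImInfty, f z = 0) : f = 0 := by
  obtain ⟨a, ha⟩ := (atImInfty_mem _).mp h
  have hopen : IsOpen {z : ℍ | a < z.im} := isOpen_lt continuous_const continuous_im
  let τ : ℍ := ⟨(|a| + 1) * Complex.I, by
    have := abs_nonneg a
    simp
    positivity⟩
  have hτ : τ ∈ {z : ℍ | a < z.im} := by
    have e : τ.im = |a| + 1 := by simp [τ, ← coe_im]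
    rw [Set.mem_ofPred_eq, e]
    have := le_abs_self a
    linarith
  refine UpperHalfPlane.eq_zero_of_frequently hf (τ := τ) (Eventually.frequently ?_)
  filter_upwards [mem_nhdsWithin_of_mem_nhds (hopen.mem_nhds hτ)] with z hz
  exact ha z (le_of_lt hz)

/-- Extraction of roots: functions with equal `n`-th powers and asymptotic at `i∞` are equal. -/
lemma eq_of_pow_eq {f g : ℍ → ℂ} (hf : MDifferentiable 𝓘(ℂ) 𝓘(ℂ) f)
    (hg : MDifferentiable 𝓘(ℂ) 𝓘(ℂ) g) (h0 : ∀ z, g z ≠ 0) {n : ℕ} (hn : n ≠ 0)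
    (h : ∀ z, f z ^ n = g z ^ n)
    (hlim : Tendsto (fun z => f z / g z) atImInfty (𝓝 1)) : f = g := by
  have h1 : Tendsto (fun z => ∑ i ∈ Finset.range n, (f z / g z) ^ i) atImInfty (𝓝 (n : ℂ)) := by
    have := tendsto_finsetSum (Finset.range n) fun i _ => hlim.pow i
    simpa using this
  have h2 : ∀ᶠ z in atImInfty, (f - g) z = 0 := by
    filter_upwards [h1.eventually_ne (Nat.cast_ne_zero.mpr hn)] with z hz
    have h3 := mul_geom_sum (f z / g z) n
    rw [div_pow, h, div_self (pow_ne_zero _ (h0 z)), sub_self] at h3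
    have h4 := (mul_eq_zero.mp h3).resolve_right hz
    rw [sub_eq_zero, div_eq_one_iff_eq (h0 z)] at h4
    simp [h4]
  exact sub_eq_zero.mp (eq_zero_of_eventually (hf.sub hg) h2)

lemma discriminant_smul_eq (γ : SL(2, ℤ)) (z : ℍ) :
    ModularForm.discriminant (γ • z) = autJ γ z ^ 12 * ModularForm.discriminant z := by
  have h := SlashInvariantForm.slash_action_generators_SL2Z ModularForm.discriminant_S_invariant
    ModularForm.discriminant_T_invariant γ
  have := (slash_eq_iff (f := ModularForm.discriminant) (k := 12) γ 1).mp (by rw [one_smul, h]) z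
  rw [this, one_mul]
  norm_cast

/-- The product of the three theta functions. -/
noncomputable def thetaProd (z : ℂ) : ℂ := T2 z * T3 z * T4 z

lemma thetaProd_pow_smul (γ : SL(2, ℤ)) (z : ℍ) :
    thetaProd (γ • z : ℍ) ^ 8 = autJ γ z ^ 12 * thetaProd z ^ 8 := by
  have hS : (fun z : ℍ => thetaProd z ^ 8) ∣[(12 : ℤ)] ModularGroup.S =
      fun z : ℍ => thetaProd z ^ 8 := by
    rw [← one_smul ℂ (fun z : ℍ => thetaProd z ^ 8), ModularForm.SL_smul_slash, one_smul,
      ← one_smul ℂ (fun z : ℍ => thetaProd z ^ 8), slash_eq_iff]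
    intro z
    have e : ((ModularGroup.S • z : ℍ) : ℂ) = -1 / z := by
      rw [coe_smul_eq]
      simp [autJ, ModularGroup.S]
    have e2 : autJ ModularGroup.S z = z := by simp [autJ, ModularGroup.S]
    simp only [one_smul]
    rw [e, e2, thetaProd, T2_neg_inv z.im_pos, T3_neg_inv z.im_pos, T4_neg_inv z.im_pos, thetaProd,
      show (sqrtJ z * T4 z * (sqrtJ z * T3 z) * (sqrtJ z * T2 z)) ^ 8 =
        (sqrtJ z ^ 4) ^ 6 * (T2 z * T3 z * T4 z) ^ 8 by ring, sqrtJ_pow_four]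
    norm_cast
    ring
  have hT : (fun z : ℍ => thetaProd z ^ 8) ∣[(12 : ℤ)] ModularGroup.T =
      fun z : ℍ => thetaProd z ^ 8 := by
    rw [← one_smul ℂ (fun z : ℍ => thetaProd z ^ 8), ModularForm.SL_smul_slash, one_smul,
      ← one_smul ℂ (fun z : ℍ => thetaProd z ^ 8), slash_eq_iff]
    intro z
    have hj : autJ ModularGroup.T z = 1 := by simp [autJ, ModularGroup.T]
    have e : ((ModularGroup.T • z : ℍ) : ℂ) = z + 1 := by
      rw [coe_smul_eq]
      simp [autJ, ModularGroup.T]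
    have h8 : Complex.exp (Real.pi * Complex.I / 4) ^ 8 = 1 := by
      rw [← Complex.exp_nat_mul, ← Complex.exp_two_pi_mul_I]
      congr 1
      push_cast
      ring
    simp only [one_smul]
    rw [e, hj, one_zpow, thetaProd, T2_add_one z.im_pos, T3_add_one, T4_add_one, thetaProd]
    linear_combination ((T2 z * T3 z * T4 z) ^ 8) * h8
  have h := SlashInvariantForm.slash_action_generators_SL2Z hS hT γ
  have := (slash_eq_iff (f := fun z : ℍ => thetaProd z ^ 8) (k := 12) γ 1).mp
    (by rw [one_smul, h]) z
  rw [this, one_mul]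
  norm_cast

lemma mdifferentiable_T4 : MDifferentiable 𝓘(ℂ) 𝓘(ℂ) fun z : ℍ => T4 z :=
  mdifferentiable_of_differentiableAt fun _ => differentiableAt_T4

lemma mdifferentiable_thetaProd : MDifferentiable 𝓘(ℂ) 𝓘(ℂ) fun z : ℍ => thetaProd z :=
  (mdifferentiable_T2.mul mdifferentiable_T3).mul mdifferentiable_T4

lemma tendsto_thetaProd_div_eta_pow :
    Tendsto (fun z : ℍ => thetaProd z / (2 * ModularForm.eta z ^ 3)) atImInfty (𝓝 1) := by
  have h := ((tendsto_T2_div.mul tendsto_T3).mul tendsto_T4).div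
    ((tendsto_eta_div.pow 3).const_mul 2) (by norm_num)
  norm_num at h
  refine h.congr fun z => ?_
  have e : Complex.exp (Real.pi * Complex.I / 4 * z) =
      Complex.exp (Real.pi * Complex.I / 12 * z) ^ 3 := by
    rw [← Complex.exp_nat_mul]
    congr 1
    push_cast
    ring
  have h1 := Complex.exp_ne_zero (Real.pi * Complex.I / 12 * z)
  have h2 := eta_ne_zero z
  rw [Pi.div_apply, e, thetaProd]
  field_simp

/-- Both sides are forms of level one and weight `12`, and the right-hand side is `256 Δ`. The
quotient has weight zero, so it is constant and equal to its limit `1` at `i∞`. -/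
lemma thetaProd_pow_eight (z : ℍ) : thetaProd z ^ 8 = (2 * ModularForm.eta z ^ 3) ^ 8 := by
  have hΔ (z : ℍ) : (2 * ModularForm.eta z ^ 3) ^ 8 = 256 * ModularForm.discriminant z := by
    rw [ModularForm.discriminant]
    ring
  have h0 (z : ℍ) : (2 * ModularForm.eta z ^ 3) ^ 8 ≠ 0 :=
    pow_ne_zero _ (mul_ne_zero two_ne_zero (pow_ne_zero _ (eta_ne_zero z)))
  have hlim := tendsto_thetaProd_div_eta_pow.pow 8
  have hform : IsForm 1 1 0 fun z : ℍ => thetaProd z ^ 8 / (2 * ModularForm.eta z ^ 3) ^ 8 := by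
    have hinv (γ : SL(2, ℤ)) (z : ℍ) :
        thetaProd (γ • z : ℍ) ^ 8 / (2 * ModularForm.eta (γ • z : ℍ) ^ 3) ^ 8 =
          thetaProd z ^ 8 / (2 * ModularForm.eta z ^ 3) ^ 8 := by
      rw [hΔ, hΔ, thetaProd_pow_smul, discriminant_smul_eq, mul_left_comm,
        mul_div_mul_left _ _ (pow_ne_zero _ (autJ_ne_zero γ z))]
    refine ⟨?_, fun γ _ z => ?_, fun γ => ?_⟩
    · have h1 := mdifferentiable_thetaProd.pow 8
      have h2 := ((mdifferentiable_eta.pow 3).const_smul (2 : ℂ)).pow 8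
      exact h1.div h2 h0
    · simp only [hinv]
      simp
    · simp only [hinv]
      refine (IsBigO.trans ?_ (isBigO_of_le _ (g := fun _ : ℍ => (1 : ℝ))
        fun z => le_rfl)).congr_right ?_
      · exact (hlim.congr fun z => div_pow _ _ _).isBigO_one ℝ
      · simp
  obtain ⟨c, hc⟩ := hform.eq_const fun _ _ => rfl
  have hc' (z : ℍ) : thetaProd z ^ 8 / (2 * ModularForm.eta z ^ 3) ^ 8 = c := by
    simpa using congrFun hc z
  have h1 : c = 1 := by
    have h2 : Tendsto (fun _ : ℍ => c) atImInfty (𝓝 (1 ^ 8)) :=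
      hlim.congr fun z => by rw [div_pow, hc']
    rw [one_pow] at h2
    exact tendsto_nhds_unique tendsto_const_nhds h2
  have := hc' z
  rwa [h1, div_eq_one_iff_eq (h0 z)] at this

/-- Jacobi's derivative formula in product form. -/
lemma thetaProd_eq (z : ℍ) : thetaProd z = 2 * ModularForm.eta z ^ 3 := by
  have := eq_of_pow_eq (f := fun z : ℍ => thetaProd z)
    (g := fun z : ℍ => 2 * ModularForm.eta z ^ 3) mdifferentiable_thetaProd
    ((mdifferentiable_eta.pow 3).const_smul (2 : ℂ))
    (fun z => mul_ne_zero two_ne_zero (pow_ne_zero _ (eta_ne_zero z))) (by norm_num : 8 ≠ 0)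
    thetaProd_pow_eight tendsto_thetaProd_div_eta_pow
  exact congrFun this z

lemma two_mul_scale (z : ℍ) : (2 * z : ℂ) = scale 2 z := by simp

/-- Both sides have the same cube, by `thetaProd_eq` at `z` and `2 z`, and their quotient tends to
`1` at `i∞`. -/
lemma eta_mul_T2 (z : ℍ) : ModularForm.eta z * T2 z = 2 * ModularForm.eta (2 * z) ^ 2 := by
  have h0 (z : ℍ) : 2 * ModularForm.eta (2 * z) ^ 2 ≠ 0 := by
    rw [two_mul_scale]
    exact mul_ne_zero two_ne_zero (pow_ne_zero _ (eta_ne_zero _))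
  have hs : Tendsto (scale 2) atImInfty atImInfty := by
    refine tendsto_comap_iff.mpr (Tendsto.congr (fun z => (im_scale 2 z).symm) ?_)
    exact tendsto_comap.const_mul_atTop (by norm_num)
  have := eq_of_pow_eq (f := fun z : ℍ => ModularForm.eta z * T2 z)
    (g := fun z : ℍ => 2 * ModularForm.eta (2 * z) ^ 2) (mdifferentiable_eta.mul mdifferentiable_T2)
    ?_ h0 (by norm_num : 3 ≠ 0) (fun z => ?_) ?_
  · exact congrFun this z
  · simp only [two_mul_scale]
    exact ((mdifferentiable_eta.comp (mdifferentiable_scale 2)).pow 2).const_smul (2 : ℂ)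
  · have h1 := thetaProd_eq z
    have h2 := thetaProd_eq (scale 2 z)
    rw [← two_mul_scale] at h2
    rw [thetaProd] at h1 h2
    have h3 := T2_sq z.im_pos
    have h4 := T3_mul_T4 z.im_pos
    have h5 : (2 * ModularForm.eta (2 * z) ^ 3) ^ 2 =
      (T2 (2 * z) * T3 (2 * z)) ^ 2 * (T3 z * T4 z) := by rw [← h2, h4]; ring
    calc (ModularForm.eta z * T2 z) ^ 3 = (2 * ModularForm.eta z ^ 3) * T2 z ^ 3 / 2 := by ring
      _ = (T2 z ^ 2) ^ 2 * (T3 z * T4 z) / 2 := by rw [← h1]; ring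
      _ = 2 * (2 * ModularForm.eta (2 * z) ^ 3) ^ 2 := by rw [h5, h3]; ring
      _ = _ := by ring
  · have h := (tendsto_eta_div.mul tendsto_T2_div).div
      (((tendsto_eta_div.comp hs).pow 2).const_mul 2) (by norm_num)
    norm_num at h
    refine h.congr fun z => ?_
    have e : Complex.exp (Real.pi * Complex.I / 4 * z) =
        Complex.exp (Real.pi * Complex.I / 12 * z) ^ 3 := by
      rw [← Complex.exp_nat_mul]
      congr 1
      push_cast
      ring
    have e2 : Complex.exp (Real.pi * Complex.I / 12 * (2 * z)) =
        Complex.exp (Real.pi * Complex.I / 12 * z) ^ 2 := by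
      rw [← Complex.exp_nat_mul]
      congr 1
      push_cast
      ring
    have h1 := Complex.exp_ne_zero (Real.pi * Complex.I / 12 * z)
    have h2 := h0 z
    have h3 : ModularForm.eta (2 * z) ≠ 0 := by
      rw [two_mul_scale]
      exact eta_ne_zero _
    simp only [Pi.div_apply]
    rw [e, e2]
    field_simp

/-! ### Division of forms -/

section

variable {N : ℕ} {χ ψ : ℤ → ℂ} {k l : ℤ} {f e : ℍ → ℂ}

/-- Division of forms; the boundedness of the quotient at the cusps has to be supplied. -/
lemma IsForm.div (hf : IsForm N χ k f) (he : IsForm N ψ l e) (hne : ∀ z, e z ≠ 0)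
    (hψ : ∀ d : ℤ, IsCoprime d N → ψ d ≠ 0)
    (hb : CuspBdd ((k : ℝ) - l) (f / e)) : IsForm N (χ / ψ) (k - l) (f / e) where
  holo := hf.holo.div he.holo hne
  trans γ hγ z := by
    have h1 := hψ _ (isCoprime_of_mem_Gamma0 hγ)
    have h2 := autJ_ne_zero γ z
    have h3 := hne z
    simp only [Pi.div_apply, hf.trans γ hγ z, he.trans γ hγ z, zpow_sub₀ h2]
    field_simp
  bdd := by
    rw [Int.cast_sub]
    exact hb

lemma tendsto_im_atImInfty : Tendsto UpperHalfPlane.im atImInfty atTop := tendsto_comap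

/-- A form has a limit at `i∞`, approached at the rate of `q`. -/
lemma IsForm.exists_isBigO_sub (hf : IsForm N χ k f) (h1 : χ 1 = 1) :
    ∃ c : ℂ, (fun z => f z - c) =O[atImInfty] fun z => Real.exp (-2 * Real.pi * z.im) := by
  have hbdd : IsBoundedAtImInfty f := by
    refine ((hf.bdd 1).congr_left fun z => ?_).congr_right fun z => ?_
    · rw [one_smul]
    · simp [autJ]
  have hper : Function.Periodic (f ∘ ofComplex) (1 : ℝ) := by
    have hT (z : ℍ) : f ((1 : ℝ) +ᵥ z) = f z := by
      have := hf.trans ModularGroup.T (mem_Gamma0_iff.mpr (by simp [ModularGroup.T])) z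
      rw [T_smul_eq] at this
      rw [this]
      simp [autJ, ModularGroup.T, h1]
    intro w
    simp only [Function.comp_apply]
    by_cases hw : 0 < w.im
    · have hw' : 0 < (w + (1 : ℝ)).im := by simpa using hw
      rw [ofComplex_apply_of_im_pos hw, ofComplex_apply_of_im_pos hw', ← hT ⟨w, hw⟩]
      congr 1
      ext1
      simp [add_comm]
    · have hw' : ¬ 0 < (w + (1 : ℝ)).im := by simpa using hw
      rw [ofComplex_apply_of_im_nonpos (not_lt.mp hw), ofComplex_apply_of_im_nonpos (not_lt.mp hw')]
  have := UpperHalfPlane.exp_decay_sub_atImInfty one_pos hper hf.holo hbdd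
  exact ⟨_, by simpa using! this⟩

lemma tendsto_exp_neg_im {c : ℝ} (hc : c < 0) :
    Tendsto (fun z : ℍ => Real.exp (c * z.im)) atImInfty (𝓝 0) :=
  Real.tendsto_exp_atBot.comp (tendsto_im_atImInfty.const_mul_atTop_of_neg hc)

/-- The ring of forms generated by `g` and `G`: if `e = g ^ m - G` has no zeros except for a simple
one at the cusp `∞`, where `g` does not vanish, then every form of weight `k a` is a polynomial in
`g` and `G`, by induction on the weight: subtract a multiple of `g ^ k` and divide by `e`. -/
lemma IsForm.mem_span_pow [NeZero N] {a m : ℕ} {g G : ℍ → ℂ} (ha : 0 < a) (hm : 0 < m)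
    (hχ : ∀ d : ℤ, (N : ℤ) ∣ d - 1 → χ d = 1) (hχ0 : ∀ d : ℤ, IsCoprime d N → χ d ≠ 0)
    (hg : IsForm N χ a g) (hG : IsForm N (χ ^ m) (m * a : ℕ) G)
    (hg1 : Tendsto g atImInfty (𝓝 1)) (hne : ∀ z, g z ^ m - G z ≠ 0)
    (hinf : (fun z : ℍ => Real.exp (-2 * Real.pi * z.im)) =O[atImInfty] fun z => g z ^ m - G z)
    (hcusp : ∀ γ : SL(2, ℤ), γ ∉ Gamma0 N → (fun z => ‖autJ γ z‖ ^ (m * a : ℝ)) =O[atImInfty]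
      fun z => g (γ • z) ^ m - G (γ • z)) (k : ℕ) {f : ℍ → ℂ}
    (hf : IsForm N (χ ^ k) (k * a : ℕ) f) :
    f ∈ Submodule.span ℂ {F | ∃ i j : ℕ, i + m * j = k ∧ F = g ^ i * G ^ j} := by
  have he : IsForm N (χ ^ m) (m * a : ℕ) (g ^ m - G) := by
    have := hg.pow m
    refine IsForm.sub ?_ hG
    exact_mod_cast this
  induction k using Nat.strong_induction_on generalizing f with
  | _ k ih =>
  obtain ⟨c, hc⟩ := hf.exists_isBigO_sub (by simp [hχ 1])
  have hgk : IsForm N (χ ^ k) (k * a : ℕ) (c • g ^ k) := by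
    have := (hg.pow k).smul c
    exact_mod_cast this
  have hgk1 : Tendsto (g ^ k) atImInfty (𝓝 1) := by simpa using! hg1.pow k
  have hfg := hf.sub hgk
  have hdecay : (f - c • g ^ k) =O[atImInfty] fun z => Real.exp (-2 * Real.pi * z.im) := by
    obtain ⟨b, hb⟩ := hfg.exists_isBigO_sub (by simp [hχ 1])
    have hz := tendsto_exp_neg_im (c := -2 * Real.pi) (by linarith [Real.pi_pos])
    have h1 : Tendsto f atImInfty (𝓝 c) := by
      have := (hc.trans_tendsto hz).add_const c
      simpa using this
    have h2 : Tendsto (f - c • g ^ k) atImInfty (𝓝 0) := by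
      have := h1.sub (hgk1.const_mul c)
      rw [mul_one, sub_self] at this
      exact this
    have h3 := tendsto_nhds_unique ((hb.trans_tendsto hz).add_const b) (by simpa using! h2)
    rw [zero_add] at h3
    subst h3
    simpa using! hb
  have hq := hfg.div he hne (fun d hd => pow_ne_zero _ (hχ0 d hd)) (by
    intro γ
    have hpos (z) : (0 : ℝ) < ‖autJ γ z‖ := norm_pos_iff.mpr (autJ_ne_zero γ z)
    by_cases hγ : γ ∈ Gamma0 N
    · have h1 : (fun z => (f - c • g ^ k) z / (g ^ m - G) z) =O[atImInfty] fun _ => (1 : ℝ) := by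
        refine ((hdecay.trans hinf).mul (isBigO_refl (fun z => ((g ^ m - G) z)⁻¹) _)).trans ?_
        refine IsBigO.of_bound 1 (Eventually.of_forall fun z => ?_)
        rw [Pi.sub_apply, Pi.pow_apply, mul_inv_cancel₀ (hne z)]
        simp
      have h2 := (h1.const_mul_left (((χ ^ k) (γ 1 1)) / ((χ ^ m) (γ 1 1)))).norm_left.mul
        (isBigO_refl (fun z => ‖autJ γ z‖ ^ (((k * a : ℕ) : ℝ) - ((m * a : ℕ) : ℝ))) _)
      refine IsBigO.of_norm_left ((h2.congr_left fun z => ?_).congr_right fun z => one_mul _)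
      have hr : ‖autJ γ z‖ ^ (((k * a : ℕ) : ℝ) - ((m * a : ℕ) : ℝ)) =
          ‖autJ γ z ^ ((k * a : ℕ) : ℤ) / autJ γ z ^ ((m * a : ℕ) : ℤ)‖ := by
        rw [Real.rpow_sub (hpos z), Real.rpow_natCast, Real.rpow_natCast, norm_div, norm_zpow,
          norm_zpow, zpow_natCast, zpow_natCast]
      rw [hr, ← norm_mul]
      congr 1
      rw [Pi.div_apply, hfg.trans γ hγ, he.trans γ hγ]
      have h5 : (χ ^ m) (γ 1 1) ≠ 0 := pow_ne_zero _ (hχ0 _ (isCoprime_of_mem_Gamma0 hγ))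
      have h6 := autJ_ne_zero γ z
      have h7 : (g ^ m - G) z ≠ 0 := hne z
      field_simp
    · have h1 := hfg.bdd γ
      have h2 := h1.mul ((hcusp γ hγ).inv_rev (Eventually.of_forall fun z h =>
        absurd h (Real.rpow_pos_of_pos (hpos z) _).ne'))
      refine (h2.congr_left fun z => ?_).congr_right fun z => ?_
      · rw [Pi.div_apply, Pi.sub_apply (g ^ m), Pi.pow_apply, div_eq_mul_inv]
      · rw [Real.rpow_sub (hpos z), div_eq_mul_inv]
        push_cast
        rfl)
  set h := (f - c • g ^ k) / (g ^ m - G) with hh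
  have hfe : f = c • (g ^ k * G ^ 0) + (g ^ m - G) * h := by
    ext z
    have h7 : g z ^ m - G z ≠ 0 := hne z
    simp only [hh, Pi.add_apply, Pi.mul_apply, Pi.sub_apply, Pi.pow_apply, Pi.div_apply,
      Pi.smul_apply, smul_eq_mul, pow_zero, mul_one]
    field_simp
    ring
  rw [hfe]
  refine Submodule.add_mem _ (Submodule.smul_mem _ _ (Submodule.subset_span
    ⟨k, 0, by simp, rfl⟩)) ?_
  rcases lt_or_ge k m with hkm | hkm
  · have : h = 0 := by
      refine hq.eq_zero_of_neg (fun d hd => by simp [hχ d hd]) ?_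
      have := Nat.mul_lt_mul_of_pos_right hkm ha
      push_cast at this ⊢
      zify at this
      omega
    rw [this, mul_zero]
    exact Submodule.zero_mem _
  · have hform : IsForm N (χ ^ (k - m)) ((k - m) * a : ℕ) h := by
      have h8 := hq.congr_char (ψ := χ ^ (k - m)) fun d hd => by
        have := pow_sub₀ (χ d) (hχ0 d hd) hkm
        simp only [Pi.div_apply, Pi.pow_apply, this, div_eq_mul_inv]
      convert h8 using 1
      rw [Nat.sub_mul, Nat.cast_sub (Nat.mul_le_mul_right a hkm)]
    have hmem := ih (k - m) (by omega) hform
    refine Submodule.span_induction (p := fun h _ => (g ^ m - G) * h ∈ Submodule.span ℂ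
      {F | ∃ i j : ℕ, i + m * j = k ∧ F = g ^ i * G ^ j}) ?_ ?_ ?_ ?_ hmem
    · rintro _ ⟨i, j, hij, rfl⟩
      rw [sub_mul]
      refine Submodule.sub_mem _ (Submodule.subset_span ⟨i + m, j, by omega, by ring⟩)
        (Submodule.subset_span ⟨i, j + 1, ?_, by ring⟩)
      rw [mul_add]
      omega
    · rw [mul_zero]
      exact Submodule.zero_mem _
    · intro x y _ _ hx hy
      rw [mul_add]
      exact Submodule.add_mem _ hx hy
    · intro b x _ hx
      rw [mul_smul_comm]
      exact Submodule.smul_mem _ _ hx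

end

/-! ### Atkin–Lehner operators -/

/-- The Atkin–Lehner operator may be computed with a single matrix `(Q x, y; N z, Q w)`, since any
two of them differ by an element of `Γ₀(N)`. -/
lemma atkinLehner_of_isForm {N Q : ℕ} (hQ : Q ∣ N) (hQ0 : 0 < Q) {k : ℤ} {n : ℕ} (hk : k = 2 * n)
    {f g : ℍ → ℂ} (hf : IsForm N 1 k f) {x₀ y₀ z₀ w₀ : ℤ}
    (hdet : (Q : ℤ) ^ 2 * x₀ * w₀ - N * y₀ * z₀ = Q)
    (h : ∀ z w : ℍ, (w : ℂ) = (Q * x₀ * z + y₀) / (N * z₀ * z + Q * w₀) →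
      (Q : ℂ) ^ n * f w = (N * z₀ * z + Q * w₀) ^ (2 * n) * g z) :
    AtkinLehner N Q k f g := by
  intro x y z w W hW hWc
  obtain ⟨N', rfl⟩ := hQ
  have hQR : (0 : ℝ) < Q := Nat.cast_pos.mpr hQ0
  have hQC : (Q : ℂ) ≠ 0 := by exact_mod_cast hQ0.ne'
  have hQZ : (Q : ℤ) ≠ 0 := by exact_mod_cast hQ0.ne'
  have hdetR : ((Q : ℝ) * x₀) * (Q * w₀) - y₀ * (((Q * N' : ℕ) : ℝ) * z₀) = Q := by
    have := congrArg (fun t : ℤ => (t : ℝ)) hdet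
    push_cast at this ⊢
    linear_combination this
  have hWR : ((Q : ℝ) * x) * (Q * w) - y * (((Q * N' : ℕ) : ℝ) * z) = Q := by
    have := congrArg (fun t : ℤ => (t : ℝ)) hW
    push_cast at this ⊢
    linear_combination this
  -- determinants divided by `Q`
  have d0 : (Q : ℤ) * x₀ * w₀ - N' * y₀ * z₀ = 1 := by
    push_cast at hdet
    exact mul_left_cancel₀ hQZ (by linear_combination hdet)
  have d1 : (Q : ℤ) * x * w - N' * y * z = 1 := by
    push_cast at hW
    exact mul_left_cancel₀ hQZ (by linear_combination hW)
  let W₀ : GL (Fin 2) ℝ := Matrix.GeneralLinearGroup.mkOfDetNeZero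
    !![(Q * x₀ : ℝ), (y₀ : ℝ); ((Q * N' : ℕ) * z₀ : ℝ), (Q * w₀ : ℝ)]
    (by rw [Matrix.det_fin_two_of, hdetR]; exact hQR.ne')
  have hW₀c : (W₀ : Matrix (Fin 2) (Fin 2) ℝ) =
    !![(Q * x₀ : ℝ), (y₀ : ℝ); ((Q * N' : ℕ) * z₀ : ℝ), (Q * w₀ : ℝ)] := rfl
  let σ : SL(2, ℤ) := ⟨!![Q * x * w₀ - N' * y * z₀, y * x₀ - x * y₀;
    (Q * N' : ℕ) * (z * w₀ - w * z₀), Q * w * x₀ - N' * z * y₀], by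
      rw [Matrix.det_fin_two_of]
      push_cast
      linear_combination (Q * x * w - N' * y * z) * d0 + d1⟩
  have hσ : σ ∈ Gamma0 (Q * N') := mem_Gamma0_iff.mpr ⟨z * w₀ - w * z₀, rfl⟩
  have hd : (Matrix.GeneralLinearGroup.det W : ℝ) = Q := by
    rw [Matrix.GeneralLinearGroup.val_det_apply, hWc, Matrix.det_fin_two_of, hWR]
  have hd₀ : (Matrix.GeneralLinearGroup.det W₀ : ℝ) = Q := by
    rw [Matrix.GeneralLinearGroup.val_det_apply, hW₀c, Matrix.det_fin_two_of, hdetR]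
  ext τ
  have hcoe : ((W • τ : ℍ) : ℂ) = (Q * x * τ + y) / ((Q * N' : ℕ) * z * τ + Q * w) := by
    rw [coe_smul_of_det_pos (by rw [hd]; exact hQR), num, denom, hWc]
    simp
  have hcoe₀ : ((W₀ • τ : ℍ) : ℂ) = (Q * x₀ * τ + y₀) / ((Q * N' : ℕ) * z₀ * τ + Q * w₀) := by
    rw [coe_smul_of_det_pos (by rw [hd₀]; exact hQR), num, denom, hW₀c]
    simp
  have hden : denom W τ = (Q * N' : ℕ) * z * τ + Q * w := by
    rw [denom, hWc]
    simp
  have hden0 : ((Q * N' : ℕ) * z * τ + Q * w : ℂ) ≠ 0 := hden ▸ denom_ne_zero W τ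
  have hden0' : ((Q * N' : ℕ) * z₀ * τ + Q * w₀ : ℂ) ≠ 0 := by
    have : denom W₀ τ = (Q * N' : ℕ) * z₀ * τ + Q * w₀ := by
      rw [denom, hW₀c]
      simp
    exact this ▸ denom_ne_zero W₀ τ
  have d0C : (Q : ℂ) * x₀ * w₀ - N' * y₀ * z₀ = 1 := by
    exact_mod_cast congrArg (Int.cast : ℤ → ℂ) d0
  have hj : autJ σ (W₀ • τ) * ((Q * N' : ℕ) * z₀ * τ + Q * w₀) = (Q * N' : ℕ) * z * τ + Q * w := by
    have : autJ σ (W₀ • τ) = (((Q * N' : ℕ) * (z * w₀ - w * z₀) : ℤ) : ℂ) * ((W₀ • τ : ℍ) : ℂ) +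
      ((Q * w * x₀ - N' * z * y₀ : ℤ) : ℂ) := rfl
    rw [this, hcoe₀, add_mul, mul_assoc, div_mul_cancel₀ _ hden0']
    push_cast
    linear_combination ((Q : ℂ) * N' * z * τ + Q * w) * d0C
  have hpt : W • τ = σ • (W₀ • τ) := by
    ext1
    have e : ((σ 0 0 : ℤ) : ℂ) * ((W₀ • τ : ℍ) : ℂ) + ((σ 0 1 : ℤ) : ℂ) =
      ((Q * x * w₀ - N' * y * z₀ : ℤ) : ℂ) * ((W₀ • τ : ℍ) : ℂ) + ((y * x₀ - x * y₀ : ℤ) : ℂ) := rfl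
    have hnum : ((Q * x * w₀ - N' * y * z₀ : ℤ) : ℂ) * (Q * x₀ * τ + y₀) +
        ((y * x₀ - x * y₀ : ℤ) : ℂ) * ((Q * N' : ℕ) * z₀ * τ + Q * w₀) = Q * x * τ + y := by
      push_cast
      linear_combination ((Q : ℂ) * x * τ + y) * d0C
    have hja := autJ_ne_zero σ (W₀ • τ)
    rw [coe_smul_eq, e, hcoe, ← hj, ← hnum, hcoe₀]
    generalize autJ σ (W₀ • τ) = J at hja
    generalize ((Q * N' : ℕ) * z₀ * τ + Q * w₀ : ℂ) = D₀ at hden0'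
    field_simp
  have hf' := hf.trans σ hσ (W₀ • τ)
  have h0 := h τ (W₀ • τ) hcoe₀
  have hpos : (0 : ℝ) < (Matrix.GeneralLinearGroup.det W : ℝ) := by rw [hd]; exact hQR
  rw [Pi.smul_apply, smul_eq_mul, ModularForm.slash_apply, UpperHalfPlane.σ, if_pos hpos, hd,
    abs_of_pos hQR, hden, hpt, ← hj]
  simp only [ContinuousAlgEquiv.coe_refl', id_eq]
  rw [hf', Pi.one_apply, one_mul, hk] at *
  have hja := autJ_ne_zero σ (W₀ • τ)
  have e1 : (2 * (n : ℤ)) / 2 = n := by omega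
  rw [e1]
  have e2 : (Q : ℂ) ^ (1 - (n : ℤ)) * ((Q : ℝ) : ℂ) ^ (2 * (n : ℤ) - 1) = (Q : ℂ) ^ n := by
    rw [Complex.ofReal_natCast, ← zpow_add₀ hQC, ← zpow_natCast]
    congr 1
    ring
  have e3 (t : ℂ) : t ^ (2 * (n : ℤ)) = t ^ (2 * n) := by exact_mod_cast zpow_natCast t (2 * n)
  rw [zpow_neg, mul_zpow, e3, e3]
  calc _ = ((Q : ℂ) ^ (1 - (n : ℤ)) * ((Q : ℝ) : ℂ) ^ (2 * (n : ℤ) - 1)) * f (W₀ • τ) *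
      ((autJ σ (W₀ • τ) ^ (2 * n)) * ((autJ σ (W₀ • τ)) ^ (2 * n) *
        ((Q * N' : ℕ) * z₀ * τ + Q * w₀) ^ (2 * n))⁻¹) := by ring
    _ = _ := by
      rw [e2, h0, mul_inv, mul_inv_cancel_left₀ (pow_ne_zero _ hja)]
      field_simp

/-! ### Eta quotients at the cusps -/

section

lemma norm_eta_smul (γ : SL(2, ℤ)) (z : ℍ) :
    ‖ModularForm.eta (γ • z : ℍ)‖ = ‖autJ γ z‖ ^ (1 / 2 : ℝ) * ‖ModularForm.eta z‖ := by
  have h := discriminant_smul_eq γ z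
  rw [ModularForm.discriminant, ModularForm.discriminant] at h
  have h1 := congrArg norm h
  rw [norm_mul, norm_pow, norm_pow, norm_pow] at h1
  have h2 : (‖autJ γ z‖ ^ (1 / 2 : ℝ)) ^ 24 = ‖autJ γ z‖ ^ 12 := by
    rw [← Real.rpow_natCast, ← Real.rpow_mul (norm_nonneg _), ← Real.rpow_natCast]
    norm_num
  rw [← h2, ← mul_pow] at h1
  exact (pow_left_inj₀ (norm_nonneg _) (by positivity) (by norm_num)).mp h1

lemma isTheta_eta : (fun z : ℍ => ModularForm.eta z) =Θ[atImInfty]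
    fun z => Real.exp (-(Real.pi / 12) * z.im) := by
  have h1 : (fun z : ℍ => ModularForm.eta z) =Θ[atImInfty]
      fun z : ℍ => Complex.exp (Real.pi * Complex.I / 12 * z) :=
    (isTheta_of_div_tendsto_nhds_ne_zero tendsto_eta_div one_ne_zero).symm
  refine h1.trans (IsTheta.of_norm_eventuallyEq_norm (Eventually.of_forall fun z => ?_))
  dsimp only
  rw [Complex.norm_exp, Real.norm_of_nonneg (Real.exp_pos _).le]
  congr 1
  rw [show (Real.pi * Complex.I / 12 * z : ℂ) = ((Real.pi / 12 : ℝ) : ℂ) * (Complex.I * z) by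
    push_cast; ring, Complex.re_ofReal_mul]
  simp

/-- `f` has weight `k` and vanishing order `v` at the cusp `γ ∞`, in the sense that
`f(γ z) / |c z + d| ^ k` is of the exact order of `exp(-π v y / 12)`. The normalization is such
that the eta function has order `1` at `∞`. -/
def HasCuspOrder (γ : SL(2, ℤ)) (k v : ℝ) (f : ℍ → ℂ) : Prop :=
  (fun z : ℍ => f (γ • z)) =Θ[atImInfty]
    fun z => ‖autJ γ z‖ ^ k * Real.exp (-(Real.pi / 12) * v * z.im)

variable {γ : SL(2, ℤ)} {k l v w : ℝ} {f g : ℍ → ℂ}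

lemma HasCuspOrder.mul (hf : HasCuspOrder γ k v f) (hg : HasCuspOrder γ l w g) :
    HasCuspOrder γ (k + l) (v + w) (f * g) := by
  refine (IsTheta.mul hf hg).trans (IsTheta.of_norm_eventuallyEq_norm
    (Eventually.of_forall fun z => congrArg norm ?_))
  rw [Real.rpow_add (norm_pos_iff.mpr (autJ_ne_zero γ z)), mul_add, add_mul, Real.exp_add]
  ring

lemma HasCuspOrder.div (hf : HasCuspOrder γ k v f) (hg : HasCuspOrder γ l w g) :
    HasCuspOrder γ (k - l) (v - w) (f / g) := by
  refine (IsTheta.div hf hg).trans (IsTheta.of_norm_eventuallyEq_norm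
    (Eventually.of_forall fun z => congrArg norm ?_))
  rw [Real.rpow_sub (norm_pos_iff.mpr (autJ_ne_zero γ z)), mul_sub, sub_mul, Real.exp_sub]
  have := (Real.exp_pos (-(Real.pi / 12) * w * z.im)).ne'
  have := (Real.rpow_pos_of_pos (norm_pos_iff.mpr (autJ_ne_zero γ z)) l).ne'
  field_simp

lemma HasCuspOrder.pow (hf : HasCuspOrder γ k v f) (n : ℕ) :
    HasCuspOrder γ (n * k) (n * v) (f ^ n) := by
  refine (IsTheta.pow hf n).trans (IsTheta.of_norm_eventuallyEq_norm
    (Eventually.of_forall fun z => congrArg norm ?_))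
  rw [mul_pow, ← Real.rpow_natCast (_ ^ k), ← Real.rpow_mul (norm_nonneg _), ← Real.exp_nat_mul]
  ring_nf

lemma HasCuspOrder.smul (hf : HasCuspOrder γ k v f) {c : ℂ} (hc : c ≠ 0) :
    HasCuspOrder γ k v (c • f) :=
  IsTheta.const_mul_left hc hf

/-- The order of `η(t z)` at the cusp `a / c` is `gcd(c, t) ^ 2 / t`, in the normalization for which
`η` has order `1` at `i∞`. -/
lemma hasCuspOrder_et (γ : SL(2, ℤ)) (t : ℕ) [NeZero t] :
    HasCuspOrder γ (1 / 2) ((Int.gcd (γ 1 0) t : ℝ) ^ 2 / t) (et t) := by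
  obtain ⟨δ, w, hw⟩ := exists_scale_smul t γ
  have htR : (0 : ℝ) < t := Nat.cast_pos.mpr (NeZero.pos t)
  have hg0 : (0 : ℝ) < (Int.gcd (γ 1 0) t : ℕ) :=
    Nat.cast_pos.mpr (Int.gcd_pos_of_ne_zero_right _ (by exact_mod_cast NeZero.ne t))
  have hlim : Tendsto w atImInfty atImInfty := by
    rw [atImInfty, tendsto_comap_iff]
    refine Tendsto.congr (fun z => (hw z).2.2.symm) ?_
    exact tendsto_comap.const_mul_atTop (by positivity)
  set c : ℝ := ((t / (Int.gcd (γ 1 0) t : ℕ) : ℝ) ^ (1 / 2 : ℝ))⁻¹ with hc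
  have hc0 : c ≠ 0 := inv_ne_zero (Real.rpow_pos_of_pos (by positivity) _).ne'
  have h1 : (fun z => ModularForm.eta (w z)) =Θ[atImInfty]
      fun z => Real.exp (-(Real.pi / 12) * (w z).im) :=
    ⟨isTheta_eta.1.comp_tendsto hlim, isTheta_eta.2.comp_tendsto hlim⟩
  have h2 : (fun z => c * ‖autJ γ z‖ ^ (1 / 2 : ℝ)) =Θ[atImInfty]
      fun z => ‖autJ γ z‖ ^ (1 / 2 : ℝ) := (isTheta_rfl).const_mul_left hc0
  refine IsTheta.trans (IsTheta.of_norm_eventuallyEq_norm (Eventually.of_forall fun z => ?_))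
    ((h2.mul h1.norm_left).trans (IsTheta.of_norm_eventuallyEq_norm
      (Eventually.of_forall fun z => congrArg norm ?_)))
  · dsimp only
    have e1 : et t (γ • z) = ModularForm.eta (δ • w z : ℍ) := by
      rw [← (hw z).1]
      rfl
    have e2 : ‖autJ γ z‖ = (t / (Int.gcd (γ 1 0) t : ℕ) : ℝ) * ‖autJ δ (w z)‖ := by
      rw [(hw z).2.1, norm_mul, norm_div]
      simp
    have hp : (0 : ℝ) < t / (Int.gcd (γ 1 0) t : ℕ) := by positivity
    rw [e1, norm_eta_smul, norm_mul, norm_mul, norm_norm, e2,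
      Real.mul_rpow hp.le (norm_nonneg _), hc, norm_inv, norm_mul,
      Real.norm_of_nonneg (Real.rpow_nonneg hp.le _),
      Real.norm_of_nonneg (Real.rpow_nonneg (norm_nonneg _) _),
      inv_mul_cancel_left₀ (Real.rpow_pos_of_pos hp _).ne']
  · rw [(hw z).2.2]
    ring_nf

lemma push_T2_eq (t : ℕ) [NeZero t] : push T2 t = (2 : ℂ) • (et (2 * t) ^ 2 / et t) := by
  ext z
  have h := eta_mul_T2 (scale t z)
  have h0 := eta_ne_zero (scale t z)
  rw [coe_scale] at h h0
  simp only [push, Pi.smul_apply, Pi.div_apply, Pi.pow_apply, smul_eq_mul]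
  push_cast
  rw [mul_assoc (2 : ℂ) (t : ℂ) (z : ℂ)]
  rw [← mul_div_assoc, ← h]
  field_simp

lemma hasCuspOrder_push_T2 (γ : SL(2, ℤ)) (t : ℕ) [NeZero t] :
    HasCuspOrder γ (1 / 2)
      (((Int.gcd (γ 1 0) (2 * t : ℕ) : ℝ) ^ 2 - (Int.gcd (γ 1 0) t : ℝ) ^ 2) / t)
      (push T2 t) := by
  rw [push_T2_eq]
  have := (((hasCuspOrder_et γ (2 * t)).pow 2).div (hasCuspOrder_et γ t)).smul two_ne_zero
  have ht : (t : ℝ) ≠ 0 := Nat.cast_ne_zero.mpr (NeZero.ne t)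
  convert this using 1
  · norm_num
  · push_cast
    field_simp

/-! ### Eta products as polynomials in theta functions -/

lemma et_pow_mul_pow_two : et 1 ^ 8 * et 2 ^ 8 = ((2 : ℂ) ^ 8)⁻¹ • (A ^ 4 - B ^ 2) := by
  ext z
  have hz := z.im_pos
  have h1 := thetaProd_eq z
  rw [thetaProd] at h1
  have h2 := eta_mul_T2 z
  have h3 : et 1 z = ModularForm.eta z := by simp [push]
  have h4 : et 2 z = ModularForm.eta (2 * z) := by simp [push]
  have h5 := A_sq_sub_B z
  have h6 : A z ^ 2 + B z = 2 * (T3 z * T4 z) ^ 4 := by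
    have : B z = A z ^ 2 - T2 z ^ 8 / 2 := by rw [← h5]; ring
    rw [this, A_apply', show T2 z ^ 8 = (T2 z ^ 4) ^ 2 by ring,
      show T2 z ^ 4 = T3 z ^ 4 - T4 z ^ 4 by rw [T3_pow_four hz]; ring]
    ring
  simp only [Pi.mul_apply, Pi.pow_apply, Pi.smul_apply, Pi.sub_apply, smul_eq_mul, h3, h4]
  calc ModularForm.eta z ^ 8 * ModularForm.eta (2 * z) ^ 8
      = (2 * ModularForm.eta z ^ 3) ^ 4 * (2 * ModularForm.eta (2 * z) ^ 2) ^ 4 /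
        (256 * ModularForm.eta z ^ 4) := by
        have := eta_ne_zero z
        field_simp
        ring
    _ = T2 z ^ 8 * (T3 z * T4 z) ^ 4 / 256 := by
        rw [← h1, ← h2]
        have := eta_ne_zero z
        field_simp
    _ = ((2 : ℂ) ^ 8)⁻¹ * ((A z ^ 2 - B z) * (A z ^ 2 + B z)) := by
        rw [h5, h6]
        ring
    _ = _ := by ring

lemma et_pow_mul_pow_three :
    et 1 ^ 6 * et 3 ^ 6 = ((2 : ℂ) ^ 2 * 3 ^ 3)⁻¹ • (Th 1 ^ 6 - Phi ^ 2) := by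
  ext z
  have hz := z.im_pos
  have h1 := thetaProd_eq z
  have h2 := thetaProd_eq (scale 3 z)
  rw [thetaProd] at h1 h2
  rw [coe_scale, Nat.cast_ofNat] at h2
  have h3 : et 1 z = ModularForm.eta z := by simp [push]
  have h4 : et 3 z = ModularForm.eta (3 * z) := by simp [push]
  have h5 := T2_mul_T2 hz
  have h6 := Theta_sq hz
  have h7 : Phi z ^ 2 = (4 * Theta (2 * z) ^ 2 - 3 * Theta z ^ 2) ^ 2 * Theta (2 * z) ^ 2 := by
    rw [Phi_apply]; ring
  simp only [Pi.mul_apply, Pi.pow_apply, Pi.smul_apply, Pi.sub_apply, smul_eq_mul, h3, h4]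
  rw [h7, Th_one_apply, show Theta z ^ 6 = (Theta z ^ 2) ^ 3 by ring, h6, Theta_two_mul hz]
  calc ModularForm.eta z ^ 6 * ModularForm.eta (3 * z) ^ 6
      = (2 * ModularForm.eta z ^ 3) ^ 2 * (2 * ModularForm.eta (3 * z) ^ 3) ^ 2 / 16 := by ring
    _ = (T2 z * T2 (3 * z)) ^ 2 * (T3 z * T3 (3 * z)) ^ 2 * (T4 z * T4 (3 * z)) ^ 2 / 16 := by
        rw [← h1, ← h2]
        ring
    _ = _ := by
        rw [h5, ← pp, ← rr]
        ring

lemma et_pow_four : et 2 ^ 12 = ((2 : ℂ) ^ 6)⁻¹ • (C * (C ^ 2 - D ^ 2)) := by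
  ext z
  have h2z := im_two_mul_pos z.im_pos
  have h2 := thetaProd_eq (scale 2 z)
  rw [thetaProd] at h2
  rw [coe_scale, Nat.cast_ofNat] at h2
  have h4 : et 2 z = ModularForm.eta (2 * z) := by simp [push]
  have h5 := T3_pow_four h2z
  simp only [Pi.mul_apply, Pi.pow_apply, Pi.smul_apply, Pi.sub_apply, smul_eq_mul, h4]
  rw [C_apply, D_apply]
  calc ModularForm.eta (2 * z) ^ 12 = (2 * ModularForm.eta (2 * z) ^ 3) ^ 4 / 16 := by ring
    _ = T2 (2 * z) ^ 4 * T3 (2 * z) ^ 4 * (T4 (2 * z) ^ 4) / 16 := by rw [← h2]; ring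
    _ = T2 (2 * z) ^ 4 * T3 (2 * z) ^ 4 * (T3 (2 * z) ^ 4 - T2 (2 * z) ^ 4) / 16 := by
        rw [h5]; ring
    _ = _ := by ring

lemma et_pow_six : et 1 ^ 2 * et 2 ^ 2 * et 3 ^ 2 * et 6 ^ 2 =
    ((2 : ℂ) ^ 2 * 3 ^ 2)⁻¹ • (9 * p ^ 2 - s ^ 2) := by
  ext z
  have hz := z.im_pos
  have h1 := thetaProd_eq z
  have h2 := thetaProd_eq (scale 3 z)
  rw [thetaProd] at h1 h2
  rw [coe_scale, Nat.cast_ofNat] at h2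
  have h3 : et 1 z = ModularForm.eta z := by simp [push]
  have h4 : et 3 z = ModularForm.eta (3 * z) := by simp [push]
  have h3' : et 2 z = ModularForm.eta (2 * z) := by simp [push]
  have h4' : et 6 z = ModularForm.eta (2 * (3 * z)) := by
    simp only [push]
    congr 1
    push_cast
    ring
  have h5 := T2_mul_T2 hz
  have h6 := Theta_sq hz
  have h8 := eta_mul_T2 z
  have h9 := eta_mul_T2 (scale 3 z)
  rw [coe_scale, Nat.cast_ofNat] at h9
  simp only [Pi.mul_apply, Pi.pow_apply, Pi.smul_apply, Pi.sub_apply, smul_eq_mul, h3, h4, h3',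
    h4', p, s, Pi.add_apply, Pi.ofNat_apply]
  rw [mul_pow, Th_one_apply, Th_two_apply, h6, Theta_two_mul hz]
  calc ModularForm.eta z ^ 2 * ModularForm.eta (2 * z) ^ 2 * ModularForm.eta (3 * z) ^ 2 *
        ModularForm.eta (2 * (3 * z)) ^ 2
      = ModularForm.eta z ^ 2 * (2 * ModularForm.eta (2 * z) ^ 2) * ModularForm.eta (3 * z) ^ 2 *
        (2 * ModularForm.eta (2 * (3 * z)) ^ 2) / 4 := by ring
    _ = (2 * ModularForm.eta z ^ 3) * (2 * ModularForm.eta (3 * z) ^ 3) *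
        (T2 z * T2 (3 * z)) / 16 := by
        rw [← h8, ← h9]
        ring
    _ = (T2 z * T2 (3 * z)) ^ 2 * (T3 z * T3 (3 * z)) * (T4 z * T4 (3 * z)) / 16 := by
        rw [← h1, ← h2]
        ring
    _ = _ := by
        rw [h5, ← pp, ← rr]
        ring

lemma T2_four_mul_sq (z : ℍ) : T2 (4 * z) ^ 2 = th 1 z ^ 2 - th 2 z ^ 2 := by
  have h := T3_sq (im_two_mul_pos z.im_pos)
  rw [show 2 * (2 * (z : ℂ)) = 4 * z by ring] at h
  rw [th_one_apply, th_two_apply, h]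
  ring

lemma et_pow_eight : et 2 ^ 4 * et 4 ^ 4 = ((2 : ℂ) ^ 2)⁻¹ •
    (th 1 ^ 2 * th 2 ^ 2 * (-th 1 ^ 2 + th 2 ^ 2) * (th 1 ^ 2 - 2 * th 2 ^ 2)) := by
  ext z
  have hz := z.im_pos
  have h2z := im_two_mul_pos hz
  have h1 := thetaProd_eq (scale 2 z)
  rw [thetaProd] at h1
  have h2 := eta_mul_T2 (scale 2 z)
  rw [coe_scale, Nat.cast_ofNat] at h1 h2
  have h3 : et 2 z = ModularForm.eta (2 * z) := by simp [push]
  have h4 : et 4 z = ModularForm.eta (2 * (2 * z)) := by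
    simp only [push]
    congr 1
    push_cast
    ring
  have h0 : ModularForm.eta (2 * z) ≠ 0 := by
    rw [two_mul_scale]
    exact eta_ne_zero _
  have h5 := T2_two_mul_pow_four z
  have h6 : T4 (2 * z) ^ 2 = 2 * th 2 z ^ 2 - th 1 z ^ 2 := by
    rw [T4_sq h2z, show 2 * (2 * (z : ℂ)) = 4 * z by ring, T2_four_mul_sq, th_two_apply]
    ring
  simp only [Pi.mul_apply, Pi.pow_apply, Pi.smul_apply, Pi.sub_apply, smul_eq_mul, h3, h4,
    Pi.add_apply, Pi.ofNat_apply, Pi.neg_apply]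
  calc ModularForm.eta (2 * z) ^ 4 * ModularForm.eta (2 * (2 * z)) ^ 4
      = ModularForm.eta (2 * z) ^ 4 * (2 * ModularForm.eta (2 * (2 * z)) ^ 2) ^ 2 / 4 := by ring
    _ = (2 * ModularForm.eta (2 * z) ^ 3) ^ 2 * T2 (2 * z) ^ 2 / 16 := by
        rw [← h2]
        ring
    _ = T2 (2 * z) ^ 4 * T3 (2 * z) ^ 2 * T4 (2 * z) ^ 2 / 16 := by
        rw [← h1]
        ring
    _ = _ := by
        rw [h5, h6, ← th_one_apply]
        ring

end

/-! ### Limits at `i∞` and behaviour of the hexagonal theta series at the cusps -/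

section

lemma tendsto_scale (t : ℕ) [NeZero t] : Tendsto (scale t) atImInfty atImInfty := by
  refine tendsto_comap_iff.mpr (Tendsto.congr (fun z => (im_scale t z).symm) ?_)
  exact tendsto_im_atImInfty.const_mul_atTop (Nat.cast_pos.mpr (NeZero.pos t))

lemma tendsto_push {F : ℂ → ℂ} {L : ℂ} (h : Tendsto (fun z : ℍ => F z) atImInfty (𝓝 L)) (t : ℕ)
    [NeZero t] : Tendsto (push F t) atImInfty (𝓝 L) :=
  h.comp (tendsto_scale t)

lemma tendsto_th (t : ℕ) [NeZero t] : Tendsto (th t) atImInfty (𝓝 1) := by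
  rw [push_theta_eq]
  exact tendsto_push tendsto_T3 _

lemma tendsto_Th (t : ℕ) [NeZero t] : Tendsto (Th t) atImInfty (𝓝 1) := by
  rw [Th_eq]
  have := ((tendsto_th t).mul (tendsto_th (t * 3))).add
    ((tendsto_push tendsto_T2 (2 * t)).mul (tendsto_push tendsto_T2 (2 * (t * 3))))
  simpa using! this

lemma tendsto_A : Tendsto A atImInfty (𝓝 1) := by
  have h1 := tendsto_th 1
  have h2 := tendsto_th 2
  have := ((h1.pow 4).add (((h1.pow 2).mul (h2.pow 2)).const_mul 4)).sub ((h2.pow 4).const_mul 4)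
  norm_num at this
  refine this.congr fun z => ?_
  simp [A]
  ring

lemma tendsto_Phi : Tendsto Phi atImInfty (𝓝 1) := by
  have := (((tendsto_Th 2).pow 3).const_mul 4).sub
    ((((tendsto_Th 1).pow 2).mul (tendsto_Th 2)).const_mul 3)
  norm_num at this
  refine this.congr fun z => ?_
  simp [Phi]
  ring

/-- The point `(z + m) / n`. -/
noncomputable def affine (m : ℤ) (n : ℕ) [NeZero n] (z : ℍ) : ℍ :=
  ⟨(z + m) / n, by
    have : (0 : ℝ) < n := Nat.cast_pos.mpr (NeZero.pos n)
    have h : ((z + m) / n : ℂ).im = z.im / n := by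
      rw [Complex.div_natCast_im]
      simp
    rw [h]
    exact div_pos z.im_pos this⟩

@[simp] lemma coe_affine (m : ℤ) (n : ℕ) [NeZero n] (z : ℍ) :
    (affine m n z : ℂ) = (z + m) / n := rfl

lemma tendsto_affine (m : ℤ) (n : ℕ) [NeZero n] : Tendsto (affine m n) atImInfty atImInfty := by
  have : (0 : ℝ) < n := Nat.cast_pos.mpr (NeZero.pos n)
  refine tendsto_comap_iff.mpr (Tendsto.congr (fun z => ?_)
    (tendsto_im_atImInfty.atTop_div_const this))
  rw [Function.comp_apply, ← coe_im (affine m n z), coe_affine, Complex.div_natCast_im]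
  simp

/-- In a cusp class of `Γ₀(N)` with `gcd(c, N)` prime to its cofactor, every `γ` is
`σ (1, 0; g, 1) T ^ j` with `σ ∈ Γ₀(N)`. -/
lemma exists_eq_mul_lowU {g n : ℕ} (hg : 0 < g) (hcop : IsCoprime (g : ℤ) n) {γ : SL(2, ℤ)}
    (hγ : Int.gcd (γ 1 0) (g * n : ℕ) = g) :
    ∃ σ ∈ Gamma0 (g * n), ∃ j : ℤ, γ = σ * lowU g * ModularGroup.T ^ j := by
  obtain ⟨c, hc⟩ : (g : ℤ) ∣ γ 1 0 := by
    conv_lhs => rw [← hγ]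
    exact Int.gcd_dvd_left ..
  have hg0 : (g : ℤ) ≠ 0 := by exact_mod_cast hg.ne'
  have hcn : IsCoprime c (n : ℤ) := by
    rw [Int.isCoprime_iff_gcd_eq_one]
    rw [hc, Nat.cast_mul, Int.gcd_mul_left, Int.natAbs_natCast] at hγ
    exact Nat.eq_of_mul_eq_mul_left hg (by rw [hγ, mul_one])
  obtain ⟨x, x', hx⟩ := hcn
  obtain ⟨y, y', hy⟩ := hcop
  set j : ℤ := (γ 1 1 * x - 1) * y with hj
  refine ⟨γ * ModularGroup.T ^ (-j) * lowU (-g), ?_, j, ?_⟩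
  · rw [mem_Gamma0_iff]
    have e : (γ * ModularGroup.T ^ (-j) * lowU (-g)) 1 0 =
        γ 1 0 + (γ 1 1 - j * γ 1 0) * (-g) := by
      rw [Matrix.SpecialLinearGroup.coe_mul, Matrix.SpecialLinearGroup.coe_mul,
        ModularGroup.coe_T_zpow]
      simp only [lowU, Matrix.mul_apply, Fin.sum_univ_two, Matrix.of_apply, Matrix.cons_val]
      ring
    rw [e, hc]
    push_cast
    refine ⟨-(γ 1 1 * x' + c * (γ 1 1 * x - 1) * y'), ?_⟩
    rw [hj]
    linear_combination (g * c * (γ 1 1 * x - 1)) * hy + (g * γ 1 1) * hx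
  · have : lowU (-g) * lowU g = 1 := by
      rw [lowU_mul, neg_add_cancel]
      ext i j
      fin_cases i <;> fin_cases j <;> simp [lowU]
    rw [mul_assoc, mul_assoc, ← mul_assoc (lowU _), this, one_mul, mul_assoc, ← zpow_add,
      neg_add_cancel, zpow_zero, mul_one]

lemma im_T_zpow_smul (j : ℤ) (z : ℍ) : (ModularGroup.T ^ j • z).im = z.im := by
  rw [modular_T_zpow_smul]
  simp

lemma tendsto_T_zpow (j : ℤ) :
    Tendsto (fun z : ℍ => ModularGroup.T ^ j • z) atImInfty atImInfty :=
  tendsto_comap_iff.mpr (Tendsto.congr (fun z => (im_T_zpow_smul j z).symm) tendsto_im_atImInfty)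

lemma autJ_T_zpow (j : ℤ) (z : ℍ) : autJ (ModularGroup.T ^ j) z = 1 := by
  simp [autJ, ModularGroup.coe_T_zpow]

variable {N : ℕ} {ψ : ℤ → ℂ} {l : ℕ} {e : ℍ → ℂ}

/-- Non-vanishing of a form at a cusp may be tested at any representative of the cusp class. -/
lemma IsForm.isBigO_of_mul_eq (he : IsForm N ψ l e) (hψ : ∀ d : ℤ, IsCoprime d N → ψ d ≠ 0)
    {σ ρ : SL(2, ℤ)} (hσ : σ ∈ Gamma0 N) (j : ℤ)
    (h : (fun z => ‖autJ ρ z‖ ^ (l : ℝ)) =O[atImInfty] fun z => e (ρ • z)) :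
    (fun z => ‖autJ (σ * ρ * ModularGroup.T ^ j) z‖ ^ (l : ℝ)) =O[atImInfty]
      fun z => e ((σ * ρ * ModularGroup.T ^ j) • z) := by
  have h1 := h.comp_tendsto (tendsto_T_zpow j)
  have h2 := (isBigO_refl (fun z => ‖autJ σ (ρ • ModularGroup.T ^ j • z)‖ ^ (l : ℝ)) atImInfty).mul
    h1.norm_right
  refine (h2.congr_left fun z => ?_).trans (IsBigO.of_bound ‖ψ (σ 1 1)‖⁻¹
    (Eventually.of_forall fun z => ?_))
  · rw [autJ_mul, autJ_mul, autJ_T_zpow, mul_one, norm_mul,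
      Real.mul_rpow (norm_nonneg _) (norm_nonneg _)]
    rfl
  · have h3 : ‖ψ (σ 1 1)‖ ≠ 0 := norm_ne_zero_iff.mpr (hψ _ (isCoprime_of_mem_Gamma0 hσ))
    rw [mul_smul, mul_smul, he.trans σ hσ, norm_mul, norm_mul, norm_mul, norm_norm,
      Real.norm_of_nonneg (Real.rpow_nonneg (norm_nonneg _) _), Real.rpow_natCast, zpow_natCast,
      norm_pow, mul_assoc, inv_mul_cancel_left₀ h3]
    rfl

lemma isBigO_of_eq_mul {ρ : SL(2, ℤ)} {κ L : ℂ} (hκ : κ ≠ 0) (hL : L ≠ 0) {F u : ℍ → ℂ}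
    (hF : Tendsto F atImInfty (𝓝 L)) (hu : ∀ z, u z = κ * autJ ρ z ^ l * F z) :
    (fun z => ‖autJ ρ z‖ ^ (l : ℝ)) =O[atImInfty] u := by
  have h1 : (fun _ : ℍ => (1 : ℝ)) =O[atImInfty] F :=
    (isBigO_const_left_iff_pos_le_norm one_ne_zero).mpr
      ⟨‖L‖ / 2, half_pos (norm_pos_iff.mpr hL), by
        filter_upwards [hF.norm.eventually_const_lt (half_lt_self (norm_pos_iff.mpr hL))] with z hz
        exact hz.le⟩
  have h2 : (fun z => ‖autJ ρ z‖ ^ (l : ℝ)) =O[atImInfty] fun z => ‖κ * autJ ρ z ^ l‖ := by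
    refine IsBigO.of_bound ‖κ‖⁻¹ (Eventually.of_forall fun z => ?_)
    have h4 : ‖κ‖ ≠ 0 := norm_ne_zero_iff.mpr hκ
    rw [Real.rpow_natCast]
    simp [h4]
  refine IsBigO.of_norm_right (((h2.mul h1.norm_right).congr_left fun z => mul_one _).congr_right
    fun z => ?_)
  rw [hu, norm_mul _ (F z)]

/-- The transformation of `Θ(z)` and `Θ(2 z)` under the matrix `(2, -1; 6, -2)`. -/
lemma Th_atkinLehner_two (z w : ℍ) (h : (w : ℂ) = (2 * z - 1) / (6 * z - 2)) :
    Th 1 w = (6 * z - 2) * Th 2 z ∧ Th 2 w = -(3 * z - 1) * Th 1 z := by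
  have hχ2 : chr chi3 (-2) = 1 := by
    rw [← chr_one chi3, ← chi3_periodic 1 (-3) (by norm_num)]
    norm_num
  have hχ1 : chr chi3 (-1) = -1 := by rw [chi3_neg, chr_one]
  have h0 : (6 * z - 2 : ℂ) ≠ 0 := by
    intro h0
    have := congrArg Complex.im h0
    simp at this
    exact z.im_pos.ne' this
  have h0' : (3 * z - 1 : ℂ) ≠ 0 := fun h => h0 (by linear_combination 2 * h)
  constructor
  · let σ : SL(2, ℤ) := ⟨!![1, -1; 3, -2], by norm_num [Matrix.det_fin_two_of]⟩
    have hσ : σ ∈ Gamma0 3 := mem_Gamma0_iff.mpr ⟨1, rfl⟩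
    have hj : autJ σ (scale 2 z) = 6 * z - 2 := by simp [autJ, σ]; ring
    have hw : σ • scale 2 z = w := by
      ext1
      rw [coe_smul_eq, hj, h]
      congr 1
      simp [σ]
      ring
    have := isForm_Th_one.trans σ hσ (scale 2 z)
    rw [hw, hj, zpow_one, show chr chi3 (σ 1 1) = 1 from hχ2, one_mul] at this
    rw [this]
    congr 1
    exact congrFun (push_comp_scale Theta 1 2) z
  · let σ : SL(2, ℤ) := ⟨!![2, -1; 3, -1], by norm_num [Matrix.det_fin_two_of]⟩
    have hσ : σ ∈ Gamma0 3 := mem_Gamma0_iff.mpr ⟨1, rfl⟩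
    have hj : autJ σ z = 3 * z - 1 := by simp [autJ, σ]; ring
    have hw : σ • z = scale 2 w := by
      ext1
      rw [coe_smul_eq, hj, coe_scale, h, show (6 * z - 2 : ℂ) = 2 * (3 * z - 1) by ring]
      simp [σ]
      field_simp
      ring
    have := isForm_Th_one.trans σ hσ z
    rw [hw, hj, zpow_one, show chr chi3 (σ 1 1) = -1 from hχ1] at this
    rw [show Th 2 w = Th 1 (scale 2 w) from (congrFun (push_comp_scale Theta 1 2) w).symm, this]
    ring

/-- The transformation of `Θ(z)` and `Θ(2 z)` under the matrix `(3, 1; 6, 3)`. -/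
lemma Th_atkinLehner_three (z w : ℍ) (h : (w : ℂ) = (3 * z + 1) / (6 * z + 3)) :
    Th 1 w = Complex.I * Real.sqrt 3 * (2 * z + 1) * Th 1 z ∧
      Th 2 w = -(Complex.I * Real.sqrt 3 * (2 * z + 1)) * Th 2 z := by
  have hχ2 : chr chi3 2 = -1 := by
    rw [← chr_one chi3, ← chi3_neg, ← chi3_periodic (-1) 3 (by norm_num)]
    norm_num
  have hz := z.ne_zero
  have h0 : (2 * z + 1 : ℂ) ≠ 0 := by
    intro h0
    have := congrArg Complex.im h0
    simp at this
    exact z.im_pos.ne' this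
  have h0' : (6 * z + 3 : ℂ) ≠ 0 := fun h => h0 (by linear_combination h / 3)
  constructor
  · let σ : SL(2, ℤ) := ⟨!![-1, 1; -3, 2], by norm_num [Matrix.det_fin_two_of]⟩
    have hσ : σ ∈ Gamma0 3 := mem_Gamma0_iff.mpr ⟨-1, rfl⟩
    have hj : autJ σ (fricke 3 z) = (2 * z + 1) / z := by
      simp [autJ, σ, coe_fricke]
      field_simp
      ring
    have hw : σ • fricke 3 z = w := by
      ext1
      rw [coe_smul_eq, hj, h, coe_fricke, show (6 * z + 3 : ℂ) = 3 * (2 * z + 1) by ring]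
      simp [σ]
      field_simp
      ring
    have := isForm_Th_one.trans σ hσ (fricke 3 z)
    rw [hw, hj, zpow_one, show chr chi3 (σ 1 1) = -1 from hχ2, Th_one_fricke] at this
    rw [this]
    field_simp
  · let σ : SL(2, ℤ) := ⟨!![-2, 1; -3, 1], by norm_num [Matrix.det_fin_two_of]⟩
    have hσ : σ ∈ Gamma0 3 := mem_Gamma0_iff.mpr ⟨-1, rfl⟩
    have hj : autJ σ (fricke 3 (scale 2 z)) = (2 * z + 1) / (2 * z) := by
      simp [autJ, σ, coe_fricke]
      field_simp
      ring
    have hw : σ • fricke 3 (scale 2 z) = scale 2 w := by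
      ext1
      rw [coe_smul_eq, hj, coe_scale, h, coe_fricke, coe_scale,
        show (6 * z + 3 : ℂ) = 3 * (2 * z + 1) by ring]
      simp [σ]
      field_simp
      ring
    have := isForm_Th_one.trans σ hσ (fricke 3 (scale 2 z))
    rw [hw, hj, zpow_one, show chr chi3 (σ 1 1) = 1 from chr_one _, Th_one_fricke,
      coe_scale] at this
    rw [show Th 2 w = Th 1 (scale 2 w) from (congrFun (push_comp_scale Theta 1 2) w).symm, this,
      show Th 1 (scale 2 z) = Th 2 z from congrFun (push_comp_scale Theta 1 2) z]
    push_cast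
    field_simp

/-- The transformation of `Θ(z)` and `Θ(2 z)` under the Fricke involution of level `6`. -/
lemma Th_fricke_six (z : ℍ) :
    Th 1 (fricke 6 z) = -Complex.I * Real.sqrt 3 * (2 * z) * Th 2 z ∧
      Th 2 (fricke 6 z) = -Complex.I * Real.sqrt 3 * z * Th 1 z := by
  have hz := z.ne_zero
  constructor
  · have e : fricke 6 z = fricke 3 (scale 2 z) := by
      ext1
      rw [coe_fricke, coe_fricke, coe_scale]
      push_cast
      field_simp
      norm_num
    rw [e, Th_one_fricke, coe_scale,
      show Th 1 (scale 2 z) = Th 2 z from congrFun (push_comp_scale Theta 1 2) z]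
    norm_num
  · have e : scale 2 (fricke 6 z) = fricke 3 z := by
      ext1
      rw [coe_scale, coe_fricke, coe_fricke]
      push_cast
      field_simp
      norm_num
    rw [show Th 2 (fricke 6 z) = Th 1 (scale 2 (fricke 6 z)) from
      (congrFun (push_comp_scale Theta 1 2) _).symm, e, Th_one_fricke]

end

/-! ### Generators of the rings of forms of level `2`, `4` and `8` -/

lemma HasCuspOrder.isBigO_norm_autJ {γ : SL(2, ℤ)} {k : ℝ} {f : ℍ → ℂ} (h : HasCuspOrder γ k 0 f) :
    (fun z => ‖autJ γ z‖ ^ k) =O[atImInfty] fun z => f (γ • z) := by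
  have := h.isBigO_symm
  simpa using this

lemma HasCuspOrder.isBigO_exp {k : ℝ} {f : ℍ → ℂ} (h : HasCuspOrder 1 k 24 f) :
    (fun z : ℍ => Real.exp (-2 * Real.pi * z.im)) =O[atImInfty] f := by
  refine (h.isBigO_symm.congr_left fun z => ?_).congr_right fun z => by rw [one_smul]
  rw [show autJ 1 z = 1 by simp [autJ], norm_one, Real.one_rpow, one_mul]
  congr 1
  ring

lemma push_T2_ne_zero (t : ℕ) [NeZero t] (z : ℍ) : push T2 t z ≠ 0 := by
  have h1 := eta_ne_zero (scale t z)
  have h2 := eta_ne_zero (scale (2 * t) z)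
  rw [coe_scale] at h1 h2
  rw [push_T2_eq]
  simp only [push, Pi.smul_apply, Pi.div_apply, Pi.pow_apply, smul_eq_mul]
  exact mul_ne_zero two_ne_zero (div_ne_zero (pow_ne_zero 2 h2) h1)

lemma gcd_eq_of_not_mem_Gamma0 {N : ℕ} {γ : SL(2, ℤ)} (hγ : γ ∉ Gamma0 N) :
    Int.gcd (γ 1 0) N ∣ N ∧ Int.gcd (γ 1 0) N ≠ N := by
  refine ⟨Int.natCast_dvd_natCast.mp (Int.gcd_dvd_right ..), fun h => hγ (mem_Gamma0_iff.mpr ?_)⟩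
  rw [← h]
  exact Int.gcd_dvd_left ..

/-- For `t` a power of `2`, the theta series `T2(t z)` vanishes only at the cusps equivalent to `∞`
under `Γ₀(2 t)`. -/
lemma hasCuspOrder_push_T2_zero {N t : ℕ} [NeZero t] (h : 2 * t = N) (ht : ∃ r, t = 2 ^ r)
    {γ : SL(2, ℤ)} (hγ : γ ∉ Gamma0 N) : HasCuspOrder γ (1 / 2) 0 (push T2 t) := by
  have h1 := hasCuspOrder_push_T2 γ t
  suffices Int.gcd (γ 1 0) (2 * t : ℕ) = Int.gcd (γ 1 0) t by
    rw [this] at h1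
    simpa using h1
  obtain ⟨r, rfl⟩ := ht
  refine Nat.dvd_antisymm (Int.dvd_gcd (Int.gcd_dvd_left ..) ?_)
    (Int.gcd_dvd_gcd_of_dvd_right _ ⟨2, by push_cast; ring⟩)
  obtain ⟨h2, h3⟩ := gcd_eq_of_not_mem_Gamma0 hγ
  rw [← h, ← pow_succ'] at h2 h3
  obtain ⟨i, hi, hi'⟩ := (Nat.dvd_prime_pow Nat.prime_two).mp h2
  rw [← pow_succ', hi']
  rw [hi'] at h3
  have : i ≠ r + 1 := fun h => h3 (by rw [h])
  exact_mod_cast pow_dvd_pow 2 (by omega : i ≤ r)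

lemma hasCuspOrder_one_push_T2 (t : ℕ) [NeZero t] :
    HasCuspOrder 1 (1 / 2) (3 * t) (push T2 t) := by
  have ht : (t : ℝ) ≠ 0 := Nat.cast_ne_zero.mpr (NeZero.ne t)
  convert hasCuspOrder_push_T2 1 t using 1
  simp
  field_simp
  ring

lemma chr_of_dvd_sub_one {m N : ℕ} (χ : MulChar (ZMod m) ℤ) (h : m ∣ N) (d : ℤ)
    (hd : (N : ℤ) ∣ d - 1) : chr χ d = 1 := by
  have h1 : ((d - 1 : ℤ) : ZMod m) = 0 :=
    (ZMod.intCast_zmod_eq_zero_iff_dvd _ m).mpr ((Int.natCast_dvd_natCast.mpr h).trans hd)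
  rw [Int.cast_sub, Int.cast_one, sub_eq_zero] at h1
  simp [chr, h1]

lemma chr_ne_zero {m N : ℕ} {χ : MulChar (ZMod m) ℤ}
    (hχ : ∀ d : ℤ, IsCoprime d N → (chr χ ^ 2) d = 1) (d : ℤ) (hd : IsCoprime d N) :
    chr χ d ≠ 0 := by
  intro h
  have := hχ d hd
  simp [h] at this

/-- In `IsForm.mem_span_pow` take `e = A ^ 2 - B = T₂(z) ^ 8 / 2`. -/
theorem IsForm.mem_span_two (k : ℕ) {f : ℍ → ℂ} (hf : IsForm 2 1 (2 * k : ℕ) f) :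
    f ∈ Submodule.span ℂ {F | ∃ i j : ℕ, i + 2 * j = k ∧ F = A ^ i * B ^ j} := by
  have e : (fun z => A z ^ 2 - B z) = (1 / 2 : ℂ) • push T2 1 ^ 8 := by
    ext z
    rw [A_sq_sub_B]
    simp [push]
    ring
  refine IsForm.mem_span_pow (N := 2) (χ := 1) (a := 2) (m := 2) two_pos two_pos
    (fun _ _ => rfl) (fun _ _ => one_ne_zero) isForm_A (by simpa using isForm_B) tendsto_A
    (fun z => ?_) ?_ (fun γ hγ => ?_) k (by simpa [mul_comm] using hf)
  · rw [congrFun e z]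
    exact mul_ne_zero (by norm_num) (pow_ne_zero 8 (push_T2_ne_zero 1 z))
  · rw [e]
    have := ((hasCuspOrder_one_push_T2 1).pow 8).smul (c := 1 / 2) (by norm_num)
    norm_num at this
    simpa using this.isBigO_exp
  · have h : HasCuspOrder γ (((2 : ℕ) : ℝ) * (2 : ℕ)) 0 ((1 / 2 : ℂ) • push T2 1 ^ 8) := by
      convert ((hasCuspOrder_push_T2_zero (N := 2) (t := 1) (by norm_num) ⟨0, rfl⟩ hγ).pow 8).smul
        (c := 1 / 2) (by norm_num) using 1 <;> norm_num
    exact h.isBigO_norm_autJ.congr_right fun z => (congrFun e (γ • z)).symm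

/-- In `IsForm.mem_span_pow` take `e = θ₁ ^ 4 - D = 2 T₂(2 z) ^ 4`. -/
theorem IsForm.mem_span_four (k : ℕ) {f : ℍ → ℂ} (hf : IsForm 4 (chr ZMod.χ₄ ^ k) k f) :
    f ∈ Submodule.span ℂ {F | ∃ i j : ℕ, i + 2 * j = k ∧ F = (th 1 ^ 2) ^ i * D ^ j} := by
  have e : (fun z => (th 1 ^ 2) z ^ 2 - D z) = (2 : ℂ) • push T2 2 ^ 4 := by
    ext z
    rw [D_apply, Pi.pow_apply, th_one_apply]
    simp [push]
    ring
  refine IsForm.mem_span_pow (N := 4) (χ := chr ZMod.χ₄) (a := 1) (m := 2) one_pos two_pos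
    (chr_of_dvd_sub_one _ dvd_rfl) (chr_ne_zero fun d hd => chi4_sq dvd_rfl hd)
    isForm_th_one_sq ((isForm_D.congr_char fun d hd => (chi4_sq dvd_rfl hd).symm))
    (by simpa using! (tendsto_th 1).pow 2)
    (fun z => ?_) ?_ (fun γ hγ => ?_) k (by simpa using hf)
  · rw [congrFun e z]
    exact mul_ne_zero (by norm_num) (pow_ne_zero 4 (push_T2_ne_zero 2 z))
  · rw [e]
    have := ((hasCuspOrder_one_push_T2 2).pow 4).smul (c := 2) (by norm_num)
    norm_num at this
    exact this.isBigO_exp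
  · have h : HasCuspOrder γ (((2 : ℕ) : ℝ) * (1 : ℕ)) 0 ((2 : ℂ) • push T2 2 ^ 4) := by
      convert ((hasCuspOrder_push_T2_zero (N := 4) (t := 2) (by norm_num) ⟨1, rfl⟩ hγ).pow 4).smul
        (c := 2) (by norm_num) using 1 <;> norm_num
    exact h.isBigO_norm_autJ.congr_right fun z => (congrFun e (γ • z)).symm

/-- In `IsForm.mem_span_pow` take `e = θ₁ ^ 2 - θ₂ ^ 2 = T₂(4 z) ^ 2`. -/
theorem IsForm.mem_span_eight (k : ℕ) {f : ℍ → ℂ} (hf : IsForm 8 (chr ZMod.χ₄ ^ k) k f) :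
    f ∈ Submodule.span ℂ {F | ∃ i j : ℕ, i + 1 * j = k ∧ F = (th 1 ^ 2) ^ i * (th 2 ^ 2) ^ j} := by
  have e : (fun z => (th 1 ^ 2) z ^ 1 - (th 2 ^ 2) z) = push T2 4 ^ 2 := by
    ext z
    have := T2_four_mul_sq z
    simp only [Pi.pow_apply, pow_one]
    rw [← this]
    simp [push]
  refine IsForm.mem_span_pow (N := 8) (χ := chr ZMod.χ₄) (a := 1) (m := 1) one_pos one_pos
    (chr_of_dvd_sub_one _ (by norm_num)) (chr_ne_zero fun d hd => chi4_sq (by norm_num) hd)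
    isForm_th_one_sq_eight (by simpa using isForm_th_two_sq)
    (by simpa using! (tendsto_th 1).pow 2)
    (fun z => ?_) ?_ (fun γ hγ => ?_) k (by simpa using hf)
  · rw [congrFun e z]
    exact (pow_ne_zero 2 (push_T2_ne_zero 4 z))
  · rw [e]
    have := ((hasCuspOrder_one_push_T2 4).pow 2)
    norm_num at this
    exact this.isBigO_exp
  · have h : HasCuspOrder γ (((1 : ℕ) : ℝ) * (1 : ℕ)) 0 (push T2 4 ^ 2) := by
      convert (hasCuspOrder_push_T2_zero (N := 8) (t := 4) (by norm_num) ⟨2, rfl⟩ hγ).pow 2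
        using 1 <;> norm_num
    exact h.isBigO_norm_autJ.congr_right fun z => (congrFun e (γ • z)).symm

/-! ### Generators of the rings of forms of level `3` and `6` -/

lemma autJ_lowU (n : ℤ) (z : ℍ) : autJ (lowU n) z = n * z + 1 := by
  simp [autJ, lowU]

lemma coe_lowU_smul (n : ℤ) (z : ℍ) : ((lowU n • z : ℍ) : ℂ) = z / (n * z + 1) := by
  rw [coe_smul_eq, autJ_lowU]
  simp [lowU]

lemma isBigO_exp_of_mul {e f : ℍ → ℂ} {L : ℂ} (hf : Tendsto f atImInfty (𝓝 L))
    (h : (fun z : ℍ => Real.exp (-2 * Real.pi * z.im)) =O[atImInfty] fun z => e z * f z) :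
    (fun z : ℍ => Real.exp (-2 * Real.pi * z.im)) =O[atImInfty] e :=
  h.trans (((isBigO_refl e _).mul (hf.isBigO_one ℂ)).congr_right fun _ => mul_one _)

lemma hasCuspOrder_one_et (t : ℕ) [NeZero t] : HasCuspOrder 1 (1 / 2) t (et t) := by
  have ht : (t : ℝ) ≠ 0 := Nat.cast_ne_zero.mpr (NeZero.ne t)
  convert hasCuspOrder_et 1 t using 1
  simp
  field_simp

lemma et_ne_zero (t : ℕ) [NeZero t] (z : ℍ) : et t z ≠ 0 := by
  have := eta_ne_zero (scale t z)
  rwa [coe_scale] at this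

/-- In `IsForm.mem_span_pow` take `e = Θ ^ 3 - Φ`, a factor of `108 η(z) ^ 6 η(3 z) ^ 6`. -/
theorem IsForm.mem_span_three (k : ℕ) {f : ℍ → ℂ} (hf : IsForm 3 (chr chi3 ^ k) k f) :
    f ∈ Submodule.span ℂ {F | ∃ i j : ℕ, i + 3 * j = k ∧ F = Th 1 ^ i * Phi ^ j} := by
  have hχ : ∀ d : ℤ, IsCoprime d (3 : ℕ) → (chr chi3 ^ 2) d = 1 := fun d hd => chi3_sq dvd_rfl hd
  have hPhi : IsForm 3 (chr chi3 ^ 3) (3 * 1 : ℕ) Phi :=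
    isForm_Phi.congr_char fun d hd => by
      rw [pow_succ, Pi.mul_apply, hχ d hd, one_mul]
  have he : IsForm 3 (chr chi3) (3 : ℕ) (Th 1 ^ 3 - Phi) :=
    IsForm.sub ((by simpa using isForm_Th_one.pow 3 : IsForm 3 (chr chi3 ^ 3) (3 : ℕ)
      (Th 1 ^ 3)).congr_char fun d hd => by
        rw [pow_succ, Pi.mul_apply, hχ d hd, one_mul]) isForm_Phi
  -- the eta product of level `3` factors as a difference of squares
  have hE : (fun z => (Th 1 z ^ 3 - Phi z) * (Th 1 z ^ 3 + Phi z)) =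
      (2 ^ 2 * 3 ^ 3 : ℂ) • (et 1 ^ 6 * et 3 ^ 6) := by
    ext z
    rw [et_pow_mul_pow_three]
    simp
    ring
  have hsum : Tendsto (fun z => Th 1 z ^ 3 + Phi z) atImInfty (𝓝 2) := by
    have := ((tendsto_Th 1).pow 3).add tendsto_Phi
    norm_num at this
    exact this
  refine IsForm.mem_span_pow (N := 3) (χ := chr chi3) (a := 1) (m := 3) one_pos three_pos
    (chr_of_dvd_sub_one _ dvd_rfl) (chr_ne_zero hχ) isForm_Th_one hPhi (tendsto_Th 1)
    (fun z hz => ?_) ?_ (fun γ hγ => ?_) k (by simpa using hf)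
  · have := congrFun hE z
    simp only [hz, zero_mul] at this
    exact smul_ne_zero (by norm_num : (2 ^ 2 * 3 ^ 3 : ℂ) ≠ 0)
      (mul_ne_zero (pow_ne_zero 6 (et_ne_zero 1 z)) (pow_ne_zero 6 (et_ne_zero 3 z))) this.symm
  · refine isBigO_exp_of_mul hsum ?_
    rw [hE]
    have := (((hasCuspOrder_one_et 1).pow 6).mul ((hasCuspOrder_one_et 3).pow 6)).smul
      (c := 2 ^ 2 * 3 ^ 3) (by norm_num)
    norm_num at this ⊢
    simpa using this.isBigO_exp
  · obtain ⟨h2, h3⟩ := gcd_eq_of_not_mem_Gamma0 hγ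
    have hg : Int.gcd (γ 1 0) (1 * 3 : ℕ) = 1 := by
      rw [one_mul]
      exact ((Nat.dvd_prime Nat.prime_three).mp h2).resolve_right h3
    obtain ⟨σ, hσ, j, rfl⟩ := exists_eq_mul_lowU one_pos isCoprime_one_left hg
    have := he.isBigO_of_mul_eq (chr_ne_zero hχ) hσ (ρ := lowU 1) j
      (isBigO_of_eq_mul (κ := (-Complex.I * Real.sqrt 3 / 3) ^ 3) (L := 2)
        (F := (fun z => Th 1 z ^ 3 + Phi z) ∘ affine 1 3) (pow_ne_zero 3 (by simp)) two_ne_zero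
        (hsum.comp (tendsto_affine 1 3)) fun z => ?_)
    · simpa using! this
    · have hu : lowU 1 • z = (1 : ℝ) +ᵥ fricke 3 (affine 1 3 z) := by
        have h0 := autJ_ne_zero (lowU 1) z
        rw [autJ_lowU] at h0
        ext1
        rw [coe_lowU_smul, coe_vadd, coe_fricke, coe_affine]
        push_cast at h0 ⊢
        rw [one_mul] at h0
        field_simp
        ring
      have hT : Phi ((1 : ℝ) +ᵥ fricke 3 (affine 1 3 z)) = Phi (fricke 3 (affine 1 3 z)) := by
        simp only [Phi, Pi.sub_apply, Pi.mul_apply, Pi.pow_apply, Th_one_add_one, Th_two_add_one,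
          Pi.ofNat_apply]
      rw [hu, Pi.sub_apply, Pi.pow_apply, Th_one_add_one, hT, Th_one_fricke, Phi_fricke,
        autJ_lowU, Function.comp_apply, coe_affine]
      push_cast
      ring

/-- In `IsForm.mem_span_pow` take `e = Θ₁ - Θ₂`, a factor of an eta product. -/
theorem IsForm.mem_span_six (k : ℕ) {f : ℍ → ℂ} (hf : IsForm 6 (chr chi3 ^ k) k f) :
    f ∈ Submodule.span ℂ {F | ∃ i j : ℕ, i + 1 * j = k ∧ F = Th 1 ^ i * Th 2 ^ j} := by
  have hχ : ∀ d : ℤ, IsCoprime d (6 : ℕ) → (chr chi3 ^ 2) d = 1 :=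
    fun d hd => chi3_sq (by norm_num) hd
  have he : IsForm 6 (chr chi3) (1 : ℕ) (Th 1 - Th 2) := isForm_Th_one_six.sub isForm_Th_two
  have hE : (fun z => (Th 1 z - Th 2 z) * ((Th 1 z + Th 2 z) * (4 * Th 2 z ^ 2 - Th 1 z ^ 2))) =
      (2 ^ 2 * 3 ^ 2 : ℂ) • (et 1 ^ 2 * et 2 ^ 2 * et 3 ^ 2 * et 6 ^ 2) := by
    ext z
    rw [et_pow_six]
    simp [s, p]
    ring
  have hsum : Tendsto (fun z => Th 1 z + Th 2 z) atImInfty (𝓝 2) := by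
    have := (tendsto_Th 1).add (tendsto_Th 2)
    norm_num at this
    exact this
  have hprod : Tendsto (fun z => (Th 1 z + Th 2 z) * (4 * Th 2 z ^ 2 - Th 1 z ^ 2)) atImInfty
      (𝓝 6) := by
    have := hsum.mul ((((tendsto_Th 2).pow 2).const_mul 4).sub ((tendsto_Th 1).pow 2))
    norm_num at this
    exact this
  refine IsForm.mem_span_pow (N := 6) (χ := chr chi3) (a := 1) (m := 1) one_pos one_pos
    (chr_of_dvd_sub_one _ (by norm_num)) (chr_ne_zero hχ) isForm_Th_one_six
    (by simpa using isForm_Th_two) (tendsto_Th 1)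
    (fun z hz => ?_) ?_ (fun γ hγ => ?_) k (by simpa using hf)
  · rw [pow_one] at hz
    have := congrFun hE z
    simp only [hz, zero_mul] at this
    exact smul_ne_zero (by norm_num : (2 ^ 2 * 3 ^ 2 : ℂ) ≠ 0)
      (mul_ne_zero (mul_ne_zero (mul_ne_zero (pow_ne_zero 2 (et_ne_zero 1 z))
        (pow_ne_zero 2 (et_ne_zero 2 z))) (pow_ne_zero 2 (et_ne_zero 3 z)))
        (pow_ne_zero 2 (et_ne_zero 6 z))) this.symm
  · refine isBigO_exp_of_mul hprod ?_
    simp only [pow_one]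
    rw [hE]
    have := (((((hasCuspOrder_one_et 1).pow 2).mul ((hasCuspOrder_one_et 2).pow 2)).mul
      ((hasCuspOrder_one_et 3).pow 2)).mul ((hasCuspOrder_one_et 6).pow 2)).smul
      (c := 2 ^ 2 * 3 ^ 2) (by norm_num)
    norm_num at this ⊢
    simpa using this.isBigO_exp
  · suffices (fun z => ‖autJ γ z‖ ^ ((1 : ℕ) : ℝ)) =O[atImInfty] fun z => (Th 1 - Th 2) (γ • z) by
      simpa using! this
    obtain ⟨h2, h3⟩ := gcd_eq_of_not_mem_Gamma0 hγ
    have h4 : Int.gcd (γ 1 0) (6 : ℕ) ∈ Nat.divisors 6 := Nat.mem_divisors.mpr ⟨h2, by norm_num⟩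
    rw [show Nat.divisors 6 = {1, 2, 3, 6} by decide] at h4
    simp only [Finset.mem_insert, Finset.mem_singleton] at h4
    rcases h4 with h4 | h4 | h4 | h4
    · obtain ⟨σ, hσ, j, rfl⟩ := exists_eq_mul_lowU (g := 1) (n := 6) one_pos isCoprime_one_left h4
      refine he.isBigO_of_mul_eq (chr_ne_zero hχ) hσ (ρ := lowU 1) j
        (isBigO_of_eq_mul (κ := -Complex.I * Real.sqrt 3 / 6) (L := 1)
          (F := (fun z => 2 * Th 2 z - Th 1 z) ∘ affine 1 6) (by simp) one_ne_zero
          (Tendsto.comp ?_ (tendsto_affine 1 6)) fun z => ?_)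
      · have := ((tendsto_Th 2).const_mul 2).sub (tendsto_Th 1)
        norm_num at this
        exact this
      · have hu : lowU 1 • z = (1 : ℝ) +ᵥ fricke 6 (affine 1 6 z) := by
          have h0 := autJ_ne_zero (lowU 1) z
          rw [autJ_lowU] at h0
          ext1
          rw [coe_lowU_smul, coe_vadd, coe_fricke, coe_affine]
          push_cast at h0 ⊢
          rw [one_mul] at h0
          field_simp
          ring
        rw [hu, Pi.sub_apply, Th_one_add_one, Th_two_add_one, (Th_fricke_six _).1,
          (Th_fricke_six _).2, autJ_lowU, Function.comp_apply, coe_affine]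
        push_cast
        ring
    · obtain ⟨σ, hσ, j, rfl⟩ := exists_eq_mul_lowU (g := 2) (n := 3) two_pos
        (by rw [Int.isCoprime_iff_gcd_eq_one]; rfl) h4
      refine he.isBigO_of_mul_eq (chr_ne_zero hχ) hσ (ρ := lowU 2) j
        (isBigO_of_eq_mul (κ := Complex.I * Real.sqrt 3 / 3) (L := 2)
          (F := (fun z => Th 1 z + Th 2 z) ∘ affine (-1) 3) (by simp) two_ne_zero
          (hsum.comp (tendsto_affine (-1) 3)) fun z => ?_)
      have h0 := autJ_ne_zero (lowU 2) z
      rw [autJ_lowU] at h0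
      have hu : ((lowU 2 • z : ℍ) : ℂ) =
          (3 * (affine (-1) 3 z : ℂ) + 1) / (6 * (affine (-1) 3 z : ℂ) + 3) := by
        rw [coe_lowU_smul, coe_affine]
        push_cast
        congr 1 <;> ring
      obtain ⟨h5, h6⟩ := Th_atkinLehner_three _ _ hu
      rw [Pi.sub_apply, h5, h6, autJ_lowU, Function.comp_apply, coe_affine]
      push_cast
      ring
    · obtain ⟨σ, hσ, j, rfl⟩ := exists_eq_mul_lowU (g := 3) (n := 2) three_pos
        (by rw [Int.isCoprime_iff_gcd_eq_one]; rfl) h4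
      refine he.isBigO_of_mul_eq (chr_ne_zero hχ) hσ (ρ := lowU 3) j
        (isBigO_of_eq_mul (κ := 1 / 2) (L := 3)
          (F := (fun z => Th 1 z + 2 * Th 2 z) ∘ affine 1 2) (by simp) three_ne_zero
          (Tendsto.comp ?_ (tendsto_affine 1 2)) fun z => ?_)
      · have := (tendsto_Th 1).add ((tendsto_Th 2).const_mul 2)
        norm_num at this
        exact this
      have h0 := autJ_ne_zero (lowU 3) z
      rw [autJ_lowU] at h0
      have hu : ((lowU 3 • z : ℍ) : ℂ) =
          (2 * (affine 1 2 z : ℂ) - 1) / (6 * (affine 1 2 z : ℂ) - 2) := by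
        rw [coe_lowU_smul, coe_affine]
        push_cast
        congr 1 <;> ring
      obtain ⟨h5, h6⟩ := Th_atkinLehner_two _ _ hu
      rw [Pi.sub_apply, h5, h6, autJ_lowU, Function.comp_apply, coe_affine]
      push_cast
      ring
    · exact absurd h4 h3

/-! ### Cusp forms -/

section

lemma isZeroAtImInfty_slash {f : ℍ → ℂ} {k : ℤ} {γ : SL(2, ℤ)} {v : ℝ} (hv : 0 < v)
    (h : HasCuspOrder γ k v f) : IsZeroAtImInfty (f ∣[k] γ) := by
  have e : (f ∣[k] γ) = fun z => f (γ • z) * autJ γ z ^ (-k) := funext (slash_eq f k γ)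
  rw [IsZeroAtImInfty, ZeroAtFilter, e]
  have h1 := h.1.mul (isBigO_refl (fun z => autJ γ z ^ (-k)) atImInfty).norm_right
  refine h1.trans_tendsto ?_
  have h2 := tendsto_exp_neg_im (c := -(Real.pi / 12) * v)
    (by nlinarith [Real.pi_pos, mul_pos Real.pi_pos hv])
  refine h2.congr fun z => ?_
  have h0 : 0 < ‖autJ γ z‖ := norm_pos_iff.mpr (autJ_ne_zero γ z)
  rw [Real.rpow_intCast, norm_zpow, mul_comm (‖autJ γ z‖ ^ k), mul_assoc (Real.exp _),
    ← zpow_add₀ h0.ne', add_neg_cancel, zpow_zero, mul_one]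

lemma mem_Sk_of_isForm {N : ℕ} [NeZero N] {f : ℍ → ℂ} {k : ℤ} (hf : IsForm N 1 k f)
    (h : ∀ γ : SL(2, ℤ), ∃ v : ℝ, 0 < v ∧ HasCuspOrder γ k v f) : f ∈ Sk N k := by
  obtain ⟨F, rfl⟩ := mem_Mk_iff.mpr hf
  refine ⟨⟨F.toSlashInvariantForm, F.holo', fun {c} hc => ?_⟩, rfl⟩
  have hc' := (Subgroup.IsArithmetic.isCusp_iff_isCusp_SL2Z _).mp hc
  refine (OnePoint.isZeroAt_iff_forall_SL2Z hc').mpr fun γ _ => ?_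
  obtain ⟨v, hv, hvf⟩ := h γ
  exact isZeroAtImInfty_slash hv hvf

lemma isForm_of_mem_Sk {N : ℕ} [NeZero N] {f : ℍ → ℂ} {k : ℤ} (hf : f ∈ Sk N k) :
    IsForm N 1 k f := by
  obtain ⟨F, rfl⟩ := hf
  exact mem_Mk_iff.mp ⟨F, rfl⟩

/-- A cusp form decays at the cusp `a / c` at the rate given by the width of that cusp; `h` may be
any multiple of the width. -/
lemma isBigO_of_mem_Sk {N : ℕ} [NeZero N] {f : ℍ → ℂ} {k : ℤ} (hf : f ∈ Sk N k) (γ : SL(2, ℤ))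
    {h : ℕ} (h0 : 0 < h) (hh : (N : ℤ) ∣ γ 1 0 ^ 2 * h) :
    (fun z => f (γ • z)) =O[atImInfty]
      fun z => ‖autJ γ z‖ ^ (k : ℝ) * Real.exp (-2 * Real.pi * z.im / h) := by
  have hform := isForm_of_mem_Sk hf
  obtain ⟨F, rfl⟩ := hf
  have hzero : IsZeroAtImInfty (⇑F ∣[k] γ) := by
    have hc : IsCusp (Matrix.SpecialLinearGroup.mapGL ℝ γ • OnePoint.infty)
        (Matrix.SpecialLinearGroup.mapGL (R := ℤ) (n := Fin 2) ℝ).range :=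
      isCusp_SL2Z_iff'.mpr ⟨γ, rfl⟩
    have := F.zero_at_cusps' ((Subgroup.IsArithmetic.isCusp_iff_isCusp_SL2Z _).mpr hc)
    exact (OnePoint.isZeroAt_iff_forall_SL2Z hc).mp this γ rfl
  have hσ : γ * ModularGroup.T ^ (h : ℤ) * γ⁻¹ ∈ Gamma0 N := by
    rw [mem_Gamma0_iff]
    have : (γ * ModularGroup.T ^ (h : ℤ) * γ⁻¹) 1 0 = -(γ 1 0 ^ 2 * h) := by
      rw [Matrix.SpecialLinearGroup.coe_mul, Matrix.SpecialLinearGroup.coe_mul,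
        Matrix.SpecialLinearGroup.coe_inv, Matrix.adjugate_fin_two, ModularGroup.coe_T_zpow]
      simp [Matrix.mul_apply, Fin.sum_univ_two]
      ring
    rw [this]
    exact (dvd_neg).mpr hh
  obtain ⟨σ, hσ, hσγ⟩ : ∃ σ ∈ Gamma0 N, σ * γ = γ * ModularGroup.T ^ (h : ℤ) :=
    ⟨_, hσ, inv_mul_cancel_right _ _⟩
  have hper : ∀ z, (⇑F ∣[k] γ) ((h : ℝ) +ᵥ z) = (⇑F ∣[k] γ) z := by
    intro z
    have h1 : ⇑F ∣[k] σ = ⇑F := by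
      have := (slash_eq_iff (f := F) (k := k) σ 1).mpr fun z => by
        rw [hform.trans σ hσ z, Pi.one_apply]
      rwa [one_smul] at this
    have h2 : (⇑F ∣[k] γ) ∣[k] (ModularGroup.T ^ (h : ℤ)) = ⇑F ∣[k] γ := by
      rw [← SlashAction.slash_mul, ← hσγ, SlashAction.slash_mul, h1]
    have h3 := congrFun h2 z
    rw [slash_eq, autJ_T_zpow, one_zpow, mul_one, modular_T_zpow_smul] at h3
    simpa using h3
  have hper' : Function.Periodic ((⇑F ∣[k] γ) ∘ ofComplex) (h : ℝ) := by
    intro w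
    simp only [Function.comp_apply]
    by_cases hw : 0 < w.im
    · have hw' : 0 < (w + (h : ℝ)).im := by simpa using hw
      rw [ofComplex_apply_of_im_pos hw, ofComplex_apply_of_im_pos hw', ← hper ⟨w, hw⟩]
      refine congrArg (⇑F ∣[k] γ) ?_
      ext1
      simp [add_comm]
    · have hw' : ¬ 0 < (w + (h : ℝ)).im := by simpa using hw
      rw [ofComplex_apply_of_im_nonpos (not_lt.mp hw), ofComplex_apply_of_im_nonpos (not_lt.mp hw')]
  have hdecay := hzero.exp_decay_atImInfty (Nat.cast_pos.mpr h0) hper' (F.holo'.slash k _)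
    hzero.isBoundedAtImInfty
  have h1 := (isBigO_refl (fun z => autJ γ z ^ k) atImInfty).norm_right.mul hdecay
  refine (h1.congr_left fun z => ?_).congr_right fun z => ?_
  · rw [slash_eq, mul_comm, mul_assoc, ← zpow_add₀ (autJ_ne_zero γ z), neg_add_cancel, zpow_zero,
      mul_one]
  · rw [Real.rpow_intCast, norm_zpow]

/-- `E` has no zeros in the upper half plane, and at every cusp a zero of order one in terms of
the local parameter `exp (2 π i z / h)`, where `h` is a multiple of the width of the cusp. -/
structure IsCuspGenerator (N : ℕ) (k : ℤ) (E : ℍ → ℂ) : Prop where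
  isForm : IsForm N 1 k E
  ne_zero : ∀ z, E z ≠ 0
  order : ∀ γ : SL(2, ℤ), ∃ h : ℕ, 0 < h ∧ (N : ℤ) ∣ γ 1 0 ^ 2 * h ∧
    HasCuspOrder γ k (24 / h) E

variable {N : ℕ} [NeZero N] {k : ℤ} {n : ℕ} {E : ℍ → ℂ}

lemma IsCuspGenerator.mem_Sk (hE : IsCuspGenerator N k E) : E ∈ Sk N k :=
  mem_Sk_of_isForm hE.isForm fun γ => by
    obtain ⟨h, h0, _, hh⟩ := hE.order γ
    exact ⟨_, div_pos (by norm_num) (Nat.cast_pos.mpr h0), hh⟩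

lemma IsCuspGenerator.isForm_div (hE : IsCuspGenerator N k E) {l : ℤ} {f : ℍ → ℂ}
    (hf : f ∈ Sk N l) : IsForm N 1 (l - k) (f / E) := by
  have := (isForm_of_mem_Sk hf).div hE.isForm hE.ne_zero (fun _ _ => one_ne_zero) fun γ => by
    obtain ⟨h, h0, hN, hh⟩ := hE.order γ
    have hpos (z) : (0 : ℝ) < ‖autJ γ z‖ := norm_pos_iff.mpr (autJ_ne_zero γ z)
    refine ((isBigO_of_mem_Sk hf γ h0 hN).mul (hh.2.inv_rev (Eventually.of_forall fun z hz =>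
      absurd hz (mul_pos (Real.rpow_pos_of_pos (hpos z) _) (Real.exp_pos _)).ne'))).congr
      (fun z => rfl) fun z => ?_
    have e : -(Real.pi / 12) * (24 / h) * z.im = -2 * Real.pi * z.im / h := by ring
    rw [e, mul_inv, mul_mul_mul_comm, mul_inv_cancel₀ (Real.exp_pos _).ne', mul_one,
      Real.rpow_sub (hpos z), div_eq_mul_inv]
  simpa using this

/-- A cusp form divided by such an `E` is a modular form, so that `E` generates the cuspidal
ideal. -/
theorem IsCuspGenerator.S_eq_span (hE : IsCuspGenerator N (2 * n) E) :
    ∃ h : E ∈ M N, S N = Ideal.span {⟨E, h⟩} := by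
  have hM : E ∈ M N := Submodule.mem_iSup_of_mem n (mem_Mk_iff.mpr hE.isForm)
  refine ⟨hM, le_antisymm ?_ ?_⟩
  · rintro ⟨f, hfM⟩ hf
    rw [Ideal.mem_span_singleton']
    have key : ∃ g ∈ MSum N, f = g * E := by
      refine Submodule.iSup_induction _ (motive := fun f => ∃ g ∈ MSum N, f = g * E)
        (show f ∈ SSum N from hf) (fun m f hf => ?_) ⟨0, zero_mem _, (zero_mul E).symm⟩ ?_
      · have hq := hE.isForm_div hf
        have hfe : f = f / E * E := by
          ext z
          exact (div_mul_cancel₀ _ (hE.ne_zero z)).symm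
        rcases lt_or_ge m n with h | h
        · refine ⟨0, zero_mem _, ?_⟩
          rw [hfe, hq.eq_zero_of_neg (fun _ _ => rfl) (by omega)]
        · refine ⟨f / E, Submodule.mem_iSup_of_mem (m - n) (mem_Mk_iff.mpr ?_), hfe⟩
          convert hq using 1
          push_cast [h]
          ring
      · rintro a b ⟨g, hg, rfl⟩ ⟨g', hg', rfl⟩
        exact ⟨g + g', add_mem hg hg', (add_mul _ _ _).symm⟩
    obtain ⟨g, hg, hfg⟩ := key
    exact ⟨⟨g, hg⟩, Subtype.ext hfg.symm⟩
  · rw [Ideal.span_singleton_le_iff_mem]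
    exact Submodule.mem_iSup_of_mem n hE.mem_Sk

end

/-! ### Eta products generating the cuspidal ideals -/

lemma gcd_gcd_of_dvd {N t : ℕ} (h : t ∣ N) (c : ℤ) : Int.gcd c t = Nat.gcd (Int.gcd c N) t := by
  rw [← Int.gcd_natCast_natCast, Int.gcd_assoc, Int.gcd_natCast_natCast, Nat.gcd_eq_right h]

lemma HasCuspOrder.et_of_dvd {N t : ℕ} [NeZero t] (h : t ∣ N) (γ : SL(2, ℤ)) (n : ℕ) :
    HasCuspOrder γ (n * (1 / 2))
      (n * ((Nat.gcd (Int.gcd (γ 1 0) N) t : ℝ) ^ 2 / t)) (et t ^ n) := by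
  have := (hasCuspOrder_et γ t).pow n
  rwa [gcd_gcd_of_dvd h] at this

/-- The order of `E` at the cusp `a / c` is assumed to depend only on `gcd(c, N)`, so that the
comparison with the width of the cusp is made on the divisors of `N`. -/
lemma isCuspGenerator_of_divisors {N : ℕ} [NeZero N] {k : ℤ} {E : ℍ → ℂ}
    (hE : IsForm N 1 k E) (hne : ∀ z, E z ≠ 0) (ord : ℕ → ℝ)
    (hord : ∀ γ, HasCuspOrder γ k (ord (Int.gcd (γ 1 0) N)) E)
    (h : ∀ g ∈ N.divisors, ∃ h : ℕ, 0 < h ∧ N ∣ g ^ 2 * h ∧ ord g = 24 / h) :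
    IsCuspGenerator N k E where
  isForm := hE
  ne_zero := hne
  order γ := by
    obtain ⟨n, h0, h1, h2⟩ := h (Int.gcd (γ 1 0) N) (Nat.mem_divisors.mpr
      ⟨Int.natCast_dvd_natCast.mp (Int.gcd_dvd_right ..), NeZero.ne N⟩)
    refine ⟨n, h0, (Int.natCast_dvd_natCast.mpr h1).trans ?_, h2 ▸ hord γ⟩
    push_cast
    exact mul_dvd_mul_right (pow_dvd_pow_of_dvd (Int.gcd_dvd_left ..) 2) _

lemma isCuspGenerator_two : IsCuspGenerator 2 8 (et 1 ^ 8 * et 2 ^ 8) := by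
  refine isCuspGenerator_of_divisors ?_ (fun z => mul_ne_zero (pow_ne_zero _ (et_ne_zero 1 z))
    (pow_ne_zero _ (et_ne_zero 2 z)))
    (fun g => 8 * ((Nat.gcd g 1 : ℝ) ^ 2 / 1) + 8 * ((Nat.gcd g 2 : ℝ) ^ 2 / 2)) (fun γ => ?_) ?_
  · rw [et_pow_mul_pow_two]
    have h1 : IsForm 2 1 8 (A ^ 4) := by simpa using isForm_A.pow 4
    have h2 : IsForm 2 1 8 (B ^ 2) := by simpa using isForm_B.pow 2
    exact (h1.sub h2).smul _
  · have := (HasCuspOrder.et_of_dvd (N := 2) (t := 1) (by norm_num) γ 8).mul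
      (HasCuspOrder.et_of_dvd (N := 2) (t := 2) (by norm_num) γ 8)
    convert this using 1
    · norm_num
    · push_cast; rfl
  · rw [show Nat.divisors 2 = {1, 2} by decide]
    simp only [Finset.mem_insert, Finset.mem_singleton]
    rintro g (rfl | rfl)
    · exact ⟨2, by norm_num, by norm_num, by norm_num⟩
    · exact ⟨1, by norm_num, by norm_num, by norm_num⟩

lemma isCuspGenerator_three : IsCuspGenerator 3 6 (et 1 ^ 6 * et 3 ^ 6) := by
  refine isCuspGenerator_of_divisors ?_ (fun z => mul_ne_zero (pow_ne_zero _ (et_ne_zero 1 z))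
    (pow_ne_zero _ (et_ne_zero 3 z)))
    (fun g => 6 * ((Nat.gcd g 1 : ℝ) ^ 2 / 1) + 6 * ((Nat.gcd g 3 : ℝ) ^ 2 / 3)) (fun γ => ?_) ?_
  · rw [et_pow_mul_pow_three]
    have h1 : IsForm 3 1 6 (Th 1 ^ 6) := by
      have := isForm_Th_one.pow 6
      refine IsForm.congr_char (by simpa using this) fun d hd => ?_
      rw [show 6 = 2 * 3 by norm_num, pow_mul, Pi.pow_apply, chi3_sq dvd_rfl hd]
      simp
    have h2 : IsForm 3 1 6 (Phi ^ 2) := by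
      have := isForm_Phi.pow 2
      exact IsForm.congr_char (χ := chr chi3 ^ 2) (by simpa using this) fun d hd =>
        chi3_sq dvd_rfl hd
    exact (h1.sub h2).smul _
  · have := (HasCuspOrder.et_of_dvd (N := 3) (t := 1) (by norm_num) γ 6).mul
      (HasCuspOrder.et_of_dvd (N := 3) (t := 3) (by norm_num) γ 6)
    convert this using 1
    · norm_num
    · push_cast; rfl
  · rw [show Nat.divisors 3 = {1, 3} by decide]
    simp only [Finset.mem_insert, Finset.mem_singleton]
    rintro g (rfl | rfl)
    · exact ⟨3, by norm_num, by norm_num, by norm_num⟩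
    · exact ⟨1, by norm_num, by norm_num, by norm_num⟩

lemma isCuspGenerator_four : IsCuspGenerator 4 6 (et 2 ^ 12) := by
  refine isCuspGenerator_of_divisors ?_ (fun z => pow_ne_zero _ (et_ne_zero 2 z))
    (fun g => 12 * ((Nat.gcd g 2 : ℝ) ^ 2 / 2)) (fun γ => ?_) ?_
  · rw [et_pow_four]
    have h1 : IsForm 4 1 4 (C ^ 2) := by simpa using isForm_C.pow 2
    have h2 : IsForm 4 1 4 (D ^ 2) := by simpa using isForm_D.pow 2
    have h3 : IsForm 4 1 6 (C * (C ^ 2 - D ^ 2)) := by simpa using isForm_C.mul (h1.sub h2)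
    exact h3.smul _
  · convert HasCuspOrder.et_of_dvd (N := 4) (t := 2) (by norm_num) γ 12 using 1
    · norm_num
    · push_cast; rfl
  · rw [show Nat.divisors 4 = {1, 2, 4} by decide]
    simp only [Finset.mem_insert, Finset.mem_singleton]
    rintro g (rfl | rfl | rfl)
    · exact ⟨4, by norm_num, by norm_num, by norm_num⟩
    · exact ⟨1, by norm_num, by norm_num, by norm_num⟩
    · exact ⟨1, by norm_num, by norm_num, by norm_num⟩

lemma isForm_s : IsForm 6 1 2 s := by
  have h1 : IsForm 6 1 2 (Th 1 ^ 2) :=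
    IsForm.congr_char (χ := chr chi3 ^ 2) (by simpa using isForm_Th_one_six.pow 2) fun d hd =>
      chi3_sq (by norm_num) hd
  have h2 : IsForm 6 1 2 (Th 2 ^ 2) :=
    IsForm.congr_char (χ := chr chi3 ^ 2) (by simpa using isForm_Th_two.pow 2) fun d hd =>
      chi3_sq (by norm_num) hd
  convert h1.add (h2.smul 2) using 1
  ext z
  simp [s]

lemma isForm_d : IsForm 6 1 2 d := by
  have h1 : IsForm 6 1 2 (Th 1 ^ 2) :=
    IsForm.congr_char (χ := chr chi3 ^ 2) (by simpa using isForm_Th_one_six.pow 2) fun d hd =>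
      chi3_sq (by norm_num) hd
  have h2 : IsForm 6 1 2 (Th 2 ^ 2) :=
    IsForm.congr_char (χ := chr chi3 ^ 2) (by simpa using isForm_Th_two.pow 2) fun d hd =>
      chi3_sq (by norm_num) hd
  convert h1.sub (h2.smul 2) using 1
  ext z
  simp [d]

lemma isForm_p : IsForm 6 1 2 p :=
  (isForm_Th_one_six.mul isForm_Th_two).congr_char fun d hd => by
    rw [Pi.one_apply, ← chi3_sq (by norm_num : 3 ∣ 6) hd, sq]

lemma isCuspGenerator_six :
    IsCuspGenerator 6 4 (et 1 ^ 2 * et 2 ^ 2 * et 3 ^ 2 * et 6 ^ 2) := by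
  refine isCuspGenerator_of_divisors ?_ (fun z => mul_ne_zero (mul_ne_zero (mul_ne_zero
      (pow_ne_zero _ (et_ne_zero 1 z)) (pow_ne_zero _ (et_ne_zero 2 z)))
      (pow_ne_zero _ (et_ne_zero 3 z))) (pow_ne_zero _ (et_ne_zero 6 z)))
    (fun g => 2 * ((Nat.gcd g 1 : ℝ) ^ 2 / 1) + 2 * ((Nat.gcd g 2 : ℝ) ^ 2 / 2) +
      2 * ((Nat.gcd g 3 : ℝ) ^ 2 / 3) + 2 * ((Nat.gcd g 6 : ℝ) ^ 2 / 6)) (fun γ => ?_) ?_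
  · rw [et_pow_six]
    have h1 : IsForm 6 1 4 (p ^ 2) := by simpa using isForm_p.pow 2
    have h2 : IsForm 6 1 4 (s ^ 2) := by simpa using isForm_s.pow 2
    refine IsForm.smul _ ?_
    convert (h1.smul 9).sub h2 using 1
    ext z
    simp
  · have := (((HasCuspOrder.et_of_dvd (N := 6) (t := 1) (by norm_num) γ 2).mul
      (HasCuspOrder.et_of_dvd (N := 6) (t := 2) (by norm_num) γ 2)).mul
      (HasCuspOrder.et_of_dvd (N := 6) (t := 3) (by norm_num) γ 2)).mul
      (HasCuspOrder.et_of_dvd (N := 6) (t := 6) (by norm_num) γ 2)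
    convert this using 1
    · norm_num
    · push_cast; rfl
  · rw [show Nat.divisors 6 = {1, 2, 3, 6} by decide]
    simp only [Finset.mem_insert, Finset.mem_singleton]
    rintro g (rfl | rfl | rfl | rfl)
    · exact ⟨6, by norm_num, by norm_num, by norm_num⟩
    · exact ⟨3, by norm_num, by norm_num, by norm_num⟩
    · exact ⟨2, by norm_num, by norm_num, by norm_num⟩
    · exact ⟨1, by norm_num, by norm_num, by norm_num⟩

lemma isCuspGenerator_eight : IsCuspGenerator 8 4 (et 2 ^ 4 * et 4 ^ 4) := by
  refine isCuspGenerator_of_divisors ?_ (fun z => mul_ne_zero (pow_ne_zero _ (et_ne_zero 2 z))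
    (pow_ne_zero _ (et_ne_zero 4 z)))
    (fun g => 4 * ((Nat.gcd g 2 : ℝ) ^ 2 / 2) + 4 * ((Nat.gcd g 4 : ℝ) ^ 2 / 4)) (fun γ => ?_) ?_
  · rw [et_pow_eight]
    have h1 := isForm_th_one_sq_eight
    have h2 := isForm_th_two_sq
    have h4 : IsForm 8 (chr ZMod.χ₄ * chr ZMod.χ₄ * chr ZMod.χ₄ * chr ZMod.χ₄) 4
        (th 1 ^ 2 * th 2 ^ 2 * (-th 1 ^ 2 + th 2 ^ 2) * (th 1 ^ 2 - 2 * th 2 ^ 2)) := by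
      have e1 : -th 1 ^ 2 + th 2 ^ 2 = th 2 ^ 2 - th 1 ^ 2 := by ring
      have e2 : th 1 ^ 2 - 2 * th 2 ^ 2 = th 1 ^ 2 - (2 : ℂ) • th 2 ^ 2 := by
        ext z
        simp
      rw [e1, e2]
      exact ((h1.mul h2).mul (h2.sub h1)).mul (h1.sub (h2.smul 2))
    refine (h4.congr_char fun d hd => ?_).smul _
    have := chi4_sq (by norm_num : 4 ∣ 8) hd
    simp only [Pi.mul_apply, Pi.pow_apply, Pi.one_apply] at this ⊢
    linear_combination (chr ZMod.χ₄ d ^ 2 + 1) * this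
  · have := (HasCuspOrder.et_of_dvd (N := 8) (t := 2) (by norm_num) γ 4).mul
      (HasCuspOrder.et_of_dvd (N := 8) (t := 4) (by norm_num) γ 4)
    convert this using 1
    · norm_num
    · push_cast; rfl
  · rw [show Nat.divisors 8 = {1, 2, 4, 8} by decide]
    simp only [Finset.mem_insert, Finset.mem_singleton]
    rintro g (rfl | rfl | rfl | rfl)
    · exact ⟨8, by norm_num, by norm_num, by norm_num⟩
    · exact ⟨2, by norm_num, by norm_num, by norm_num⟩
    · exact ⟨1, by norm_num, by norm_num, by norm_num⟩
    · exact ⟨1, by norm_num, by norm_num, by norm_num⟩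

/-! ### Algebraic independence -/

lemma aeval_apply {f g : ℍ → ℂ} (F : MvPolynomial (Fin 2) ℂ) (z : ℍ) :
    MvPolynomial.aeval ![f, g] F z = MvPolynomial.eval ![f z, g z] F := by
  induction F using MvPolynomial.induction_on with
  | C a => simp
  | add p q hp hq => simp [hp, hq]
  | mul_X p i hp => fin_cases i <;> simp [hp]

lemma polynomial_eval_aeval (u v : Polynomial ℂ) (F : MvPolynomial (Fin 2) ℂ) (t : ℂ) :
    (MvPolynomial.aeval ![u, v] F).eval t = MvPolynomial.eval ![u.eval t, v.eval t] F := by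
  induction F using MvPolynomial.induction_on with
  | C a => simp
  | add p q hp hq => simp [hp, hq]
  | mul_X p i hp => fin_cases i <;> simp [hp]

/-- If `f` takes infinitely many values on `{g = r f ^ m}`, for infinitely many `r`, then `f` and
`g` are algebraically independent: a relation vanishes on infinitely many of the curves
`y = r x ^ m`. -/
lemma algebraicIndependent_of_infinite {f g : ℍ → ℂ} {m : ℕ}
    (h : {r : ℂ | {t : ℂ | ∃ z, f z = t ∧ g z = r * t ^ m}.Infinite}.Infinite) :
    AlgebraicIndependent ℂ ![f, g] := by
  rw [algebraicIndependent_iff]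
  intro P hP
  have h1 : ∀ r ∈ {r : ℂ | {t : ℂ | ∃ z, f z = t ∧ g z = r * t ^ m}.Infinite}, ∀ t : ℂ,
      MvPolynomial.eval ![t, r * t ^ m] P = 0 := by
    intro r hr t
    let q : Polynomial ℂ := MvPolynomial.aeval ![Polynomial.X, Polynomial.C r * Polynomial.X ^ m] P
    have hq (t : ℂ) : q.eval t = MvPolynomial.eval ![t, r * t ^ m] P := by
      rw [polynomial_eval_aeval]
      simp
    have hq0 : q = 0 := Polynomial.eq_zero_of_infinite_isRoot q (hr.mono fun t ht => by
      obtain ⟨z, rfl, hz⟩ := ht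
      rw [Set.mem_ofPred_eq, Polynomial.IsRoot, hq, ← hz, ← aeval_apply, hP, Pi.zero_apply])
    rw [← hq, hq0, Polynomial.eval_zero]
  have h2 : ∀ t : ℂ, t ≠ 0 → ∀ y : ℂ, MvPolynomial.eval ![t, y] P = 0 := by
    intro t ht y
    let q : Polynomial ℂ := MvPolynomial.aeval ![Polynomial.C t, Polynomial.X] P
    have hq (y : ℂ) : q.eval y = MvPolynomial.eval ![t, y] P := by
      rw [polynomial_eval_aeval]
      simp
    have hq0 : q = 0 := by
      refine Polynomial.eq_zero_of_infinite_isRoot q ((h.image (f := fun r => r * t ^ m)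
        (fun a _ b _ hab => mul_right_cancel₀ (pow_ne_zero m ht) hab)).mono ?_)
      rintro _ ⟨r, hr, rfl⟩
      rw [Set.mem_ofPred_eq, Polynomial.IsRoot, hq]
      exact h1 r hr t
    rw [← hq, hq0, Polynomial.eval_zero]
  refine MvPolynomial.funext_set (s := fun _ => {0}ᶜ)
    (fun i => (Set.finite_singleton 0).infinite_compl) fun x hx => ?_
  have : x = ![x 0, x 1] := by ext i; fin_cases i <;> rfl
  rw [this, map_zero]
  exact h2 _ (hx 0 trivial) _

/-- The criterion by which the generators of all the rings are seen to be algebraically independent: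
along an orbit of `(1, 0; N, 1)` the quotient `g / f ^ m` is constant while `f` is not, and the
quotient is not constant near `∞`, since it does not attain its limit. -/
lemma algebraicIndependent_of_tendsto {N : ℕ} [NeZero N] {f g : ℍ → ℂ} {m μ a : ℕ} (ha : a ≠ 0)
    (hμ : μ ≠ 0)
    (hf : ∀ (n : ℕ) (z : ℍ), f (lowU (N * n : ℕ) • z) ^ μ = ((N * n : ℕ) * z + 1) ^ a * f z ^ μ)
    (hg : ∀ (n : ℕ) (z : ℍ),
      g (lowU (N * n : ℕ) • z) * f z ^ m = g z * f (lowU (N * n : ℕ) • z) ^ m)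
    {b c : ℂ} (hb : b ≠ 0) (hfb : Tendsto f atImInfty (𝓝 b)) (hgc : Tendsto g atImInfty (𝓝 c))
    (hne : ∀ z, g z * b ^ m ≠ c * f z ^ m) : AlgebraicIndependent ℂ ![f, g] := by
  apply algebraicIndependent_of_infinite (m := m)
  -- the values of `g / f ^ m` where `f` does not vanish
  refine Set.Infinite.mono (s := (fun z => g z / f z ^ m) '' {z | f z ≠ 0}) ?_ fun hfin => ?_
  · rintro _ ⟨z, hz, rfl⟩ hfin
    obtain ⟨K, hK⟩ := (hfin.image norm).bddAbove
    obtain ⟨n, hn⟩ := exists_nat_gt ((K ^ μ / ‖f z‖ ^ μ + 1) / (N * z.im))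
    have hz' : 0 < ‖f z‖ := norm_pos_iff.mpr hz
    have hN : (0 : ℝ) < N := Nat.cast_pos.mpr (NeZero.pos N)
    rw [div_lt_iff₀ (by have := z.im_pos; positivity)] at hn
    have h1 : K ^ μ / ‖f z‖ ^ μ + 1 < ‖((N * n : ℕ) * z + 1 : ℂ)‖ := by
      refine hn.trans_le (le_trans (le_of_eq ?_)
        (Complex.abs_im_le_norm _ |>.trans' (le_abs_self _)))
      simp
      ring
    have hw0 : f (lowU (N * n : ℕ) • z) ≠ 0 := by
      intro h0
      have := hf n z
      rw [h0, zero_pow hμ] at this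
      refine mul_ne_zero (pow_ne_zero _ ?_) (pow_ne_zero _ hz) this.symm
      have := autJ_ne_zero (lowU (N * n : ℕ)) z
      rw [autJ_lowU] at this
      exact_mod_cast this
    have h2 : ‖f (lowU (N * n : ℕ) • z)‖ ≤ K := hK ⟨_, ⟨_, rfl, by
      rw [div_mul_eq_mul_div, eq_div_iff (pow_ne_zero _ hz)]
      exact hg n z⟩, rfl⟩
    have hK0 : 0 ≤ K := (norm_nonneg _).trans h2
    have h3 : 1 ≤ ‖((N * n : ℕ) * z + 1 : ℂ)‖ :=
      le_trans (by have : 0 ≤ K ^ μ / ‖f z‖ ^ μ := by positivity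
                   linarith) h1.le
    have h4 := congrArg norm (hf n z)
    rw [norm_mul, norm_pow, norm_pow, norm_pow] at h4
    have h5 : ‖f (lowU (N * n : ℕ) • z)‖ ^ μ ≤ K ^ μ := pow_le_pow_left₀ (norm_nonneg _) h2 μ
    rw [h4, ← le_div_iff₀ (by positivity)] at h5
    have h6 := le_self_pow₀ h3 ha
    linarith
  · have hlim : Tendsto (fun z => g z / f z ^ m) atImInfty (𝓝 (c / b ^ m)) :=
      hgc.div (hfb.pow m) (pow_ne_zero m hb)
    have hval : c / b ^ m ∉ (fun z => g z / f z ^ m) '' {z | f z ≠ 0} := by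
      rintro ⟨z, hz, h⟩
      rw [div_eq_div_iff (pow_ne_zero m hz) (pow_ne_zero m hb)] at h
      exact hne z h
    have h1 := hlim.eventually (hfin.isClosed.isOpen_compl.mem_nhds hval)
    have h2 := hfb.eventually_ne hb
    obtain ⟨z, hz1, hz2⟩ := (h1.and h2).exists
    exact hz1 ⟨z, hz2, rfl⟩

lemma IsForm.apply_lowU {N : ℕ} {χ : ℤ → ℂ} {k : ℕ} {f : ℍ → ℂ} (hf : IsForm N χ k f)
    (hχ : χ 1 = 1) (n : ℕ) (z : ℍ) :
    f (lowU (N * n : ℕ) • z) = ((N * n : ℕ) * z + 1) ^ k * f z := by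
  have := hf.trans (lowU (N * n : ℕ)) (mem_Gamma0_iff.mpr (by simp [lowU])) z
  rw [this, autJ_lowU, zpow_natCast, show (lowU (N * n : ℕ)) 1 1 = 1 from rfl, hχ, one_mul]
  push_cast
  rfl

lemma algebraicIndependent_A_B : AlgebraicIndependent ℂ ![A, B] := by
  have hA := fun n z => IsForm.apply_lowU (k := 2) isForm_A rfl n z
  have hB := fun n z => IsForm.apply_lowU (k := 4) isForm_B rfl n z
  refine algebraicIndependent_of_tendsto (N := 2) (m := 2) (μ := 1) (a := 2) two_ne_zero one_ne_zero
    (fun n z => by rw [hA]; ring) (fun n z => by rw [hA, hB]; ring) one_ne_zero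
    tendsto_A (c := 1) ?_ fun z => ?_
  · have := ((tendsto_push tendsto_T2 1).pow 8).div_const 2
    have := (tendsto_A.pow 2).sub this
    norm_num at this
    refine this.congr fun z => ?_
    have := A_sq_sub_B z
    simp [push]
    linear_combination this
  · have h := A_sq_sub_B z
    have h0 := pow_ne_zero 8 (push_T2_ne_zero 1 z)
    simp only [push, Nat.cast_one, one_mul] at h0
    intro h'
    exact h0 (by linear_combination -2 * h - 2 * h')

lemma algebraicIndependent_Th_Phi : AlgebraicIndependent ℂ ![Th 1, Phi] := by
  have hA := fun n z => IsForm.apply_lowU (k := 1) isForm_Th_one (chr_one _) n z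
  have hB := fun n z => IsForm.apply_lowU (k := 3) isForm_Phi (chr_one _) n z
  refine algebraicIndependent_of_tendsto (N := 3) (m := 3) (μ := 1) (a := 1) one_ne_zero one_ne_zero
    (fun n z => by rw [hA]; ring) (fun n z => by rw [hA, hB]; ring) one_ne_zero
    (tendsto_Th 1) tendsto_Phi fun z h => ?_
  have h1 := congrFun et_pow_mul_pow_three z
  simp only [Pi.mul_apply, Pi.pow_apply, Pi.smul_apply, Pi.sub_apply, smul_eq_mul] at h1
  refine mul_ne_zero (pow_ne_zero 6 (et_ne_zero 1 z)) (pow_ne_zero 6 (et_ne_zero 3 z)) ?_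
  rw [h1]
  linear_combination -((2 : ℂ) ^ 2 * 3 ^ 3)⁻¹ * (Th 1 z ^ 3 + Phi z) * h

lemma tendsto_th_one_pow (n : ℕ) : Tendsto (th 1 ^ n) atImInfty (𝓝 1) := by
  simpa using! (tendsto_th 1).pow n

lemma C_sub_D (z : ℍ) : C z - D z = 2 * push T2 2 z ^ 4 := by
  rw [D_apply, C_apply]
  simp [push]

lemma tendsto_D : Tendsto D atImInfty (𝓝 1) := by
  have := (tendsto_th_one_pow 4).sub (((tendsto_push tendsto_T2 2).pow 4).const_mul 2)
  norm_num at this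
  refine this.congr fun z => ?_
  have := C_sub_D z
  rw [C, Pi.pow_apply] at this
  linear_combination this

lemma C_ne_D (z : ℍ) : C z ≠ D z := fun h =>
  pow_ne_zero 4 (push_T2_ne_zero 2 z) (by linear_combination (h - C_sub_D z) / 2)

lemma algebraicIndependent_th_D : AlgebraicIndependent ℂ ![th 1, D] := by
  have hA := fun n z => IsForm.apply_lowU (k := 1) isForm_th_one_sq (chr_one _) n z
  have hD := fun n z => IsForm.apply_lowU (k := 2) isForm_D rfl n z
  simp only [Pi.pow_apply] at hA
  refine algebraicIndependent_of_tendsto (N := 4) (m := 4) (μ := 2) (a := 1) one_ne_zero two_ne_zero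
    (fun n z => hA n z) (fun n z => ?_) one_ne_zero (tendsto_th 1) tendsto_D fun z h => ?_
  · rw [show 4 = 2 * 2 by norm_num, pow_mul, pow_mul, hA, hD]
    ring
  · refine C_ne_D z ?_
    rw [C, Pi.pow_apply]
    linear_combination -h

lemma algebraicIndependent_C_D : AlgebraicIndependent ℂ ![C, D] := by
  have hA := fun n z => IsForm.apply_lowU (k := 2) isForm_C rfl n z
  have hD := fun n z => IsForm.apply_lowU (k := 2) isForm_D rfl n z
  refine algebraicIndependent_of_tendsto (N := 4) (m := 1) (μ := 1) (a := 2) two_ne_zero one_ne_zero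
    (fun n z => by rw [hA]; ring) (fun n z => by rw [hA, hD]; ring) one_ne_zero
    (tendsto_th_one_pow 4) tendsto_D fun z h => C_ne_D z ?_
  linear_combination -h

lemma et_six_ne_zero (z : ℍ) : 9 * p z ^ 2 - s z ^ 2 ≠ 0 := by
  intro h
  have h1 := congrFun et_pow_six z
  have h2 : (9 * p ^ 2 - s ^ 2 : ℍ → ℂ) z = 0 := h
  rw [Pi.smul_apply, h2, smul_zero] at h1
  exact isCuspGenerator_six.ne_zero z h1

lemma algebraicIndependent_Th_Th : AlgebraicIndependent ℂ ![Th 1, Th 2] := by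
  have hA := fun n z => IsForm.apply_lowU (k := 1) isForm_Th_one_six (chr_one _) n z
  have hB := fun n z => IsForm.apply_lowU (k := 1) isForm_Th_two (chr_one _) n z
  refine algebraicIndependent_of_tendsto (N := 6) (m := 1) (μ := 1) (a := 1) one_ne_zero one_ne_zero
    (fun n z => by rw [hA]; ring) (fun n z => by rw [hA, hB]; ring) one_ne_zero
    (tendsto_Th 1) (tendsto_Th 2) fun z h => et_six_ne_zero z ?_
  simp only [p, s, Pi.mul_apply, Pi.add_apply, Pi.pow_apply, Pi.ofNat_apply]
  rw [show Th 2 z = Th 1 z by linear_combination h]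
  ring

lemma algebraicIndependent_s_p : AlgebraicIndependent ℂ ![s, p] := by
  have hA := fun n z => IsForm.apply_lowU (k := 2) isForm_s rfl n z
  have hB := fun n z => IsForm.apply_lowU (k := 2) isForm_p rfl n z
  refine algebraicIndependent_of_tendsto (N := 6) (m := 1) (μ := 1) (a := 2) two_ne_zero one_ne_zero
    (fun n z => by rw [hA]; ring) (fun n z => by rw [hA, hB]; ring) three_ne_zero
    (c := 1) ?_ ?_ fun z h => et_six_ne_zero z ?_
  · have := ((tendsto_Th 1).pow 2).add (((tendsto_Th 2).pow 2).const_mul 2)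
    norm_num at this
    exact this
  · have := (tendsto_Th 1).mul (tendsto_Th 2)
    rw [mul_one] at this
    exact this
  · linear_combination (3 * p z + s z) * h

lemma th_one_sq_ne (z : ℍ) : th 1 z ^ 2 ≠ th 2 z ^ 2 := fun h => by
  have := push_T2_ne_zero 4 z
  simp only [push] at this
  push_cast at this
  exact pow_ne_zero 2 this (by linear_combination T2_four_mul_sq z + h)

lemma algebraicIndependent_th_th : AlgebraicIndependent ℂ ![th 1, th 2] := by
  have hA := fun n z => IsForm.apply_lowU (k := 1) isForm_th_one_sq_eight (chr_one _) n z
  have hB := fun n z => IsForm.apply_lowU (k := 1) isForm_th_mul_th (chr_one _) n z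
  simp only [Pi.pow_apply, Pi.mul_apply, pow_one] at hA hB
  refine algebraicIndependent_of_tendsto (N := 8) (m := 1) (μ := 2) (a := 1) one_ne_zero two_ne_zero
    (fun n z => by rw [hA, pow_one]) (fun n z => ?_) one_ne_zero
    (tendsto_th 1) (tendsto_th 2) fun z h => th_one_sq_ne z ?_
  · rcases eq_or_ne (th 1 z) 0 with h0 | h0
    · have := hA n z
      rw [h0, zero_pow two_ne_zero, mul_zero] at this
      rw [h0, pow_eq_zero_iff two_ne_zero |>.mp this]
      ring
    · have h1 : ((8 * n : ℕ) * z + 1 : ℂ) ≠ 0 := by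
        have := autJ_ne_zero (lowU (8 * n : ℕ)) z
        rw [autJ_lowU] at this
        exact_mod_cast this
      have h2 : th 1 (lowU (8 * n : ℕ) • z) ≠ 0 := by
        intro h2
        have := hA n z
        rw [h2, zero_pow two_ne_zero] at this
        exact mul_ne_zero h1 (pow_ne_zero 2 h0) this.symm
      rw [pow_one, pow_one]
      refine mul_left_cancel₀ (mul_ne_zero h2 h0) ?_
      linear_combination th 1 z ^ 2 * hB n z - th 1 z * th 2 z * hA n z
  · rw [show th 2 z = th 1 z by linear_combination h]

lemma algebraicIndependent_th_sq : AlgebraicIndependent ℂ ![th 1 ^ 2, th 2 ^ 2] := by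
  have hA := fun n z => IsForm.apply_lowU (k := 1) isForm_th_one_sq_eight (chr_one _) n z
  have hB := fun n z => IsForm.apply_lowU (k := 1) isForm_th_two_sq (chr_one _) n z
  refine algebraicIndependent_of_tendsto (N := 8) (m := 1) (μ := 1) (a := 1) one_ne_zero one_ne_zero
    (fun n z => by rw [hA]; ring) (fun n z => by rw [hA, hB]; ring) one_ne_zero
    (tendsto_th_one_pow 2) (by simpa using! (tendsto_th 2).pow 2) fun z h => th_one_sq_ne z ?_
  simp only [Pi.pow_apply, pow_one] at h
  linear_combination -h

/-! ### The rings of modular forms in terms of generators -/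

section

lemma aeval_eq_sum {R : Type*} [CommRing R] [Algebra ℂ R] (x y : R)
    (F : MvPolynomial (Fin 2) ℂ) :
    MvPolynomial.aeval ![x, y] F = ∑ d ∈ F.support, F.coeff d • (x ^ d 0 * y ^ d 1) := by
  rw [MvPolynomial.aeval_def, MvPolynomial.eval₂_eq']
  refine Finset.sum_congr rfl fun d _ => ?_
  rw [Fin.prod_univ_two, Algebra.smul_def]
  rfl

lemma weight_eq {a b k : ℚ} {F : MvPolynomial (Fin 2) ℂ}
    (hF : MvPolynomial.IsWeightedHomogeneous ![a, b] F k) {d : Fin 2 →₀ ℕ} (hd : d ∈ F.support) :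
    a * (d 0 : ℕ) + b * (d 1 : ℕ) = k := by
  rw [← hF (MvPolynomial.mem_support_iff.mp hd), Finsupp.weight_apply,
    Finsupp.sum_fintype _ _ (by simp), Fin.sum_univ_two]
  simp [mul_comm]

lemma aeval_mem_hatMk {f g : ℍ → ℂ} {a b k : ℚ} {F : MvPolynomial (Fin 2) ℂ}
    (hF : MvPolynomial.IsWeightedHomogeneous ![a, b] F k) :
    MvPolynomial.aeval ![f, g] F ∈ hatMk f g a b k := by
  rw [aeval_eq_sum]
  exact Submodule.sum_mem _ fun d hd => Submodule.smul_mem _ _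
    (Submodule.subset_span ⟨_, _, weight_eq hF hd, rfl⟩)

lemma hatMk_le_adjoin (f g : ℍ → ℂ) (a b k : ℚ) :
    hatMk f g a b k ≤ Subalgebra.toSubmodule (hatM f g) := by
  refine Submodule.span_le.mpr ?_
  rintro _ ⟨i, j, _, rfl⟩
  exact Subalgebra.mul_mem _ (pow_mem (Algebra.subset_adjoin (by simp)) i)
    (pow_mem (Algebra.subset_adjoin (by simp)) j)

lemma toSubmodule_M (N : ℕ) : Subalgebra.toSubmodule (M N) = ⨆ n : ℕ, Mk N (2 * n) := rfl

lemma M_le_iff {N : ℕ} {T : Subalgebra ℂ (ℍ → ℂ)} :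
    M N ≤ T ↔ ∀ n : ℕ, Mk N (2 * n) ≤ Subalgebra.toSubmodule T := by
  rw [← Subalgebra.toSubmodule.le_iff_le, toSubmodule_M, iSup_le_iff]

lemma Mk_le_M (N n : ℕ) : Mk N (2 * n) ≤ Subalgebra.toSubmodule (M N) :=
  M_le_iff.mp le_rfl n

section Conversions

variable {N : ℕ} {f g : ℍ → ℂ} {a b : ℚ}

lemma M_le_hatM (h : ∀ n : ℕ, Mk N (2 * n) = hatMk f g a b (2 * n)) : M N ≤ hatM f g :=
  M_le_iff.mpr fun n => (h n).le.trans (hatMk_le_adjoin ..)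

lemma toSubmodule_M_eq (h : ∀ n : ℕ, Mk N (2 * n) = hatMk f g a b (2 * n)) :
    Subalgebra.toSubmodule (M N) = hatMEven f g a b := by
  rw [toSubmodule_M, hatMEven]
  exact iSup_congr h

lemma M_eq_hatM (h : ∀ n : ℕ, Mk N (2 * n) = hatMk f g a b (2 * n)) (hf : f ∈ M N)
    (hg : g ∈ M N) : M N = hatM f g :=
  le_antisymm (M_le_hatM h) (Algebra.adjoin_le (by
    rintro _ (rfl | rfl)
    · exact hf
    · exact hg))

end Conversions

lemma M_mono {N' N : ℕ} [NeZero N'] [NeZero N] (h : N' ∣ N) : M N' ≤ M N :=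
  M_le_iff.mpr fun n _ hf => Mk_le_M N n (mem_Mk_iff.mpr ((mem_Mk_iff.mp hf).mono h))

lemma chr_pow_two_mul {m N : ℕ} {χ : MulChar (ZMod m) ℤ}
    (hχ : ∀ d : ℤ, IsCoprime d N → (chr χ ^ 2) d = 1) (n : ℕ) (d : ℤ) (hd : IsCoprime d N) :
    (chr χ ^ (2 * n)) d = 1 := by
  rw [pow_mul, Pi.pow_apply, hχ d hd, one_pow]

lemma chr_pow_two_mul_add_one {m N : ℕ} {χ : MulChar (ZMod m) ℤ}
    (hχ : ∀ d : ℤ, IsCoprime d N → (chr χ ^ 2) d = 1) (n : ℕ) (d : ℤ) (hd : IsCoprime d N) :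
    (chr χ ^ (2 * n + 1)) d = chr χ d := by
  rw [pow_succ, Pi.mul_apply, chr_pow_two_mul hχ n d hd, one_mul]

lemma Mk_two_eq (n : ℕ) : Mk 2 (2 * n) = hatMk A B 2 4 (2 * n) := by
  apply le_antisymm
  · intro f hf
    refine Submodule.span_mono ?_ ((mem_Mk_iff.mp (by exact_mod_cast hf)).mem_span_two n)
    rintro _ ⟨i, j, h, rfl⟩
    refine ⟨i, j, ?_, rfl⟩
    rw [← h]
    push_cast
    ring
  · refine Submodule.span_le.mpr ?_
    rintro _ ⟨i, j, h, rfl⟩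
    have h' : i + 2 * j = n := by
      have : (i : ℚ) + 2 * j = n := by linarith
      exact_mod_cast this
    have := IsForm.pow_mul_pow (N := 2) (χ := 1) (a := 2) (m := 2) isForm_A
      (by simpa using isForm_B) h'
    rw [one_pow] at this
    refine mem_Mk_iff.mpr ?_
    convert this using 1
    push_cast
    ring

lemma isForm_Th_Phi_monomial {i j k : ℕ} (h : i + 3 * j = k) :
    IsForm 3 (chr chi3 ^ k) k (Th 1 ^ i * Phi ^ j) := by
  have := IsForm.pow_mul_pow (N := 3) (χ := chr chi3) (a := 1) (m := 3) isForm_Th_one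
    (isForm_Phi.congr_char fun d hd =>
      (chr_pow_two_mul_add_one (fun d hd => chi3_sq dvd_rfl hd) 1 d hd).symm) h
  simpa using! this

lemma isForm_th_D_monomial {i j k : ℕ} (h : i + 2 * j = k) :
    IsForm 4 (chr ZMod.χ₄ ^ k) k ((th 1 ^ 2) ^ i * D ^ j) := by
  have := IsForm.pow_mul_pow (N := 4) (χ := chr ZMod.χ₄) (a := 1) (m := 2) isForm_th_one_sq
    (isForm_D.congr_char fun d hd => (chi4_sq dvd_rfl hd).symm) h
  simpa using! this

lemma Mk_three_eq (n : ℕ) : Mk 3 (2 * n) = hatMk (Th 1) Phi 1 3 (2 * n) := by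
  have hχ := chr_pow_two_mul (N := 3) (fun d hd => chi3_sq dvd_rfl hd) n
  apply le_antisymm
  · intro f hf
    have := (mem_Mk_iff.mp hf).congr_char (ψ := chr chi3 ^ (2 * n)) fun d hd => (hχ d hd).symm
    refine Submodule.span_mono ?_ (IsForm.mem_span_three (2 * n) (by exact_mod_cast this))
    rintro _ ⟨i, j, h, rfl⟩
    refine ⟨i, j, ?_, rfl⟩
    have : ((i + 3 * j : ℕ) : ℚ) = (2 * n : ℕ) := by rw [h]
    push_cast at this
    rw [one_mul, this]
  · refine Submodule.span_le.mpr ?_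
    rintro _ ⟨i, j, h, rfl⟩
    rw [one_mul] at h
    refine mem_Mk_iff.mpr ?_
    exact_mod_cast (isForm_Th_Phi_monomial (by exact_mod_cast h)).congr_char hχ

lemma Mk_four_eq (n : ℕ) : Mk 4 (2 * n) = hatMk C D 2 2 (2 * n) := by
  have hχ := chr_pow_two_mul (N := 4) (fun d hd => chi4_sq dvd_rfl hd) n
  apply le_antisymm
  · intro f hf
    have := (mem_Mk_iff.mp hf).congr_char (ψ := chr ZMod.χ₄ ^ (2 * n)) fun d hd => (hχ d hd).symm
    refine Submodule.span_mono ?_ (IsForm.mem_span_four (2 * n) (by exact_mod_cast this))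
    rintro _ ⟨i, j, h, rfl⟩
    obtain ⟨i, rfl⟩ : ∃ i', i = 2 * i' := ⟨n - j, by omega⟩
    refine ⟨i, j, ?_, by rw [C, pow_mul, ← pow_mul (th 1)]⟩
    have : i + j = n := by omega
    rw [← this]
    push_cast
    ring
  · refine Submodule.span_le.mpr ?_
    rintro _ ⟨i, j, h, rfl⟩
    have h' : 2 * i + 2 * j = 2 * n := by exact_mod_cast h
    have := (isForm_th_D_monomial h').congr_char hχ
    rw [pow_mul, ← pow_mul (th 1)] at this
    exact mem_Mk_iff.mpr (by exact_mod_cast this)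

lemma hatMk_C_D (n : ℕ) : hatMk C D 2 2 (2 * n) = hatMk (th 1) D (1 / 2) 2 (2 * n) := by
  apply congrArg (Submodule.span ℂ)
  ext f
  constructor
  · rintro ⟨i, j, h, rfl⟩
    refine ⟨4 * i, j, ?_, by rw [C, pow_mul]⟩
    push_cast
    linarith
  · rintro ⟨i, j, h, rfl⟩
    have h' : i + 4 * j = 4 * n := by
      have : (i : ℚ) + 4 * j = 4 * n := by linarith
      exact_mod_cast this
    obtain ⟨i, rfl⟩ : ∃ i', i = 4 * i' := ⟨n - j, by omega⟩
    refine ⟨i, j, ?_, by rw [C, pow_mul]⟩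
    push_cast at h
    linarith

lemma MkChar_four_eq (n : ℕ) :
    MkChar 4 ZMod.χ₄ (2 * n + 1) = hatMk (th 1) D (1 / 2) 2 (2 * n + 1) := by
  have hχ := chr_pow_two_mul_add_one (N := 4) (fun d hd => chi4_sq dvd_rfl hd) n
  apply le_antisymm
  · intro f hf
    have := ((mem_MkChar_iff dvd_rfl _).mp hf).congr_char (ψ := chr ZMod.χ₄ ^ (2 * n + 1))
      fun d hd => (hχ d hd).symm
    refine Submodule.span_mono ?_ (IsForm.mem_span_four (2 * n + 1) (by exact_mod_cast this))
    rintro _ ⟨i, j, h, rfl⟩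
    refine ⟨2 * i, j, ?_, by rw [pow_mul]⟩
    have : ((i + 2 * j : ℕ) : ℚ) = (2 * n + 1 : ℕ) := by rw [h]
    push_cast at this ⊢
    linarith
  · refine Submodule.span_le.mpr ?_
    rintro _ ⟨i, j, h, rfl⟩
    have h' : i + 4 * j = 4 * n + 2 := by
      have : (i : ℚ) + 4 * j = 4 * n + 2 := by linarith
      exact_mod_cast this
    obtain ⟨i, rfl⟩ : ∃ i', i = 2 * i' := ⟨2 * (n - j) + 1, by omega⟩
    have := (isForm_th_D_monomial (i := i) (j := j) (k := 2 * n + 1) (by omega)).congr_char hχ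
    rw [← pow_mul] at this
    exact (mem_MkChar_iff dvd_rfl _).mpr (by exact_mod_cast this)

lemma Mk_six_eq (n : ℕ) : Mk 6 (2 * n) = hatMk (Th 1) (Th 2) 1 1 (2 * n) := by
  have hχ := chr_pow_two_mul (N := 6) (fun d hd => chi3_sq (by norm_num) hd) n
  apply le_antisymm
  · intro f hf
    have := (mem_Mk_iff.mp hf).congr_char (ψ := chr chi3 ^ (2 * n)) fun d hd => (hχ d hd).symm
    refine Submodule.span_mono ?_ (IsForm.mem_span_six (2 * n) (by exact_mod_cast this))
    rintro _ ⟨i, j, h, rfl⟩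
    refine ⟨i, j, ?_, rfl⟩
    rw [one_mul] at h ⊢
    rw [one_mul]
    exact_mod_cast h
  · refine Submodule.span_le.mpr ?_
    rintro _ ⟨i, j, h, rfl⟩
    rw [one_mul, one_mul] at h
    refine mem_Mk_iff.mpr ?_
    exact_mod_cast (isForm_Th_monomial (k := 2 * n) (by exact_mod_cast h)).congr_char hχ

lemma Mk_eight_eq (n : ℕ) : Mk 8 (2 * n) = Submodule.span ℂ
    {f | ∃ i j : ℕ, Even i ∧ Even j ∧ i + j = 4 * n ∧ f = th 1 ^ i * th 2 ^ j} := by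
  have hχ := chr_pow_two_mul (N := 8) (fun d hd => chi4_sq (by norm_num) hd) n
  apply le_antisymm
  · intro f hf
    have := (mem_Mk_iff.mp hf).congr_char (ψ := chr ZMod.χ₄ ^ (2 * n)) fun d hd => (hχ d hd).symm
    refine Submodule.span_mono ?_ (IsForm.mem_span_eight (2 * n) (by exact_mod_cast this))
    rintro _ ⟨i, j, h, rfl⟩
    exact ⟨2 * i, 2 * j, even_two_mul i, even_two_mul j, by omega, by rw [pow_mul, pow_mul]⟩
  · refine Submodule.span_le.mpr ?_
    rintro _ ⟨i, j, ⟨i, rfl⟩, ⟨j, rfl⟩, h, rfl⟩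
    have := (isForm_th_monomial (i := i) (j := j) (k := 2 * n) (by omega)).congr_char hχ
    rw [← pow_mul, ← pow_mul, two_mul i, two_mul j] at this
    exact mem_Mk_iff.mpr (by exact_mod_cast this)

lemma M_six_eq : M 6 = Algebra.adjoin ℂ {Th 1 ^ 2, Th 1 * Th 2, Th 2 ^ 2} := by
  apply le_antisymm
  · refine M_le_iff.mpr fun n => ?_
    rw [Mk_six_eq]
    refine Submodule.span_le.mpr ?_
    rintro _ ⟨i, j, h, rfl⟩
    have h' : i + j = 2 * n := by exact_mod_cast (by linarith : (i : ℚ) + j = 2 * n)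
    have h1 : Th 1 ^ 2 ∈ Algebra.adjoin ℂ {Th 1 ^ 2, Th 1 * Th 2, Th 2 ^ 2} :=
      Algebra.subset_adjoin (by simp)
    have h2 : Th 1 * Th 2 ∈ Algebra.adjoin ℂ {Th 1 ^ 2, Th 1 * Th 2, Th 2 ^ 2} :=
      Algebra.subset_adjoin (by simp)
    have h3 : Th 2 ^ 2 ∈ Algebra.adjoin ℂ {Th 1 ^ 2, Th 1 * Th 2, Th 2 ^ 2} :=
      Algebra.subset_adjoin (by simp)
    rcases Nat.even_or_odd' i with ⟨i, rfl | rfl⟩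
    · obtain ⟨j, rfl⟩ : ∃ j', j = 2 * j' := ⟨n - i, by omega⟩
      rw [pow_mul, pow_mul]
      exact Subalgebra.mul_mem _ (pow_mem h1 i) (pow_mem h3 j)
    · obtain ⟨j, rfl⟩ : ∃ j', j = 2 * j' + 1 := ⟨n - i - 1, by omega⟩
      rw [show Th 1 ^ (2 * i + 1) * Th 2 ^ (2 * j + 1) =
        (Th 1 ^ 2) ^ i * (Th 2 ^ 2) ^ j * (Th 1 * Th 2) by ring]
      exact Subalgebra.mul_mem _ (mul_mem (pow_mem h1 i) (pow_mem h3 j)) h2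
  · have hmem (i j : ℕ) (h : i + j = 2) : Th 1 ^ i * Th 2 ^ j ∈ M 6 := by
      refine Mk_le_M 6 1 ?_
      rw [Mk_six_eq]
      refine Submodule.subset_span ⟨i, j, ?_, rfl⟩
      rw [one_mul, one_mul, ← Nat.cast_add, h]
      norm_num
    refine Algebra.adjoin_le ?_
    rintro _ (rfl | rfl | rfl)
    · simpa using hmem 2 0 rfl
    · simpa using hmem 1 1 rfl
    · simpa using hmem 0 2 rfl

lemma M_eight_eq : M 8 = Algebra.adjoin ℂ {th 1 ^ 4, th 1 ^ 2 * th 2 ^ 2, th 2 ^ 4} := by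
  apply le_antisymm
  · refine M_le_iff.mpr fun n => ?_
    rw [Mk_eight_eq]
    refine Submodule.span_le.mpr ?_
    have h1 : th 1 ^ 4 ∈ Algebra.adjoin ℂ {th 1 ^ 4, th 1 ^ 2 * th 2 ^ 2, th 2 ^ 4} :=
      Algebra.subset_adjoin (by simp)
    have h2 : th 1 ^ 2 * th 2 ^ 2 ∈ Algebra.adjoin ℂ {th 1 ^ 4, th 1 ^ 2 * th 2 ^ 2, th 2 ^ 4} :=
      Algebra.subset_adjoin (by simp)
    have h3 : th 2 ^ 4 ∈ Algebra.adjoin ℂ {th 1 ^ 4, th 1 ^ 2 * th 2 ^ 2, th 2 ^ 4} :=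
      Algebra.subset_adjoin (by simp)
    rintro _ ⟨i, j, ⟨i, rfl⟩, ⟨j, rfl⟩, h, rfl⟩
    rcases Nat.even_or_odd' i with ⟨i, rfl | rfl⟩
    · obtain ⟨j, rfl⟩ : ∃ j', j = 2 * j' := ⟨n - i, by omega⟩
      rw [show th 1 ^ (2 * i + 2 * i) * th 2 ^ (2 * j + 2 * j) =
        (th 1 ^ 4) ^ i * (th 2 ^ 4) ^ j by ring]
      exact Subalgebra.mul_mem _ (pow_mem h1 i) (pow_mem h3 j)
    · obtain ⟨j, rfl⟩ : ∃ j', j = 2 * j' + 1 := ⟨n - i - 1, by omega⟩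
      rw [show th 1 ^ (2 * i + 1 + (2 * i + 1)) * th 2 ^ (2 * j + 1 + (2 * j + 1)) =
        (th 1 ^ 4) ^ i * (th 2 ^ 4) ^ j * (th 1 ^ 2 * th 2 ^ 2) by ring]
      exact Subalgebra.mul_mem _ (mul_mem (pow_mem h1 i) (pow_mem h3 j)) h2
  · have hmem (i j : ℕ) (hi : Even i) (hj : Even j) (h : i + j = 4) :
        th 1 ^ i * th 2 ^ j ∈ M 8 := by
      refine Mk_le_M 8 1 ?_
      rw [Mk_eight_eq]
      exact Submodule.subset_span ⟨i, j, hi, hj, by omega, rfl⟩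
    refine Algebra.adjoin_le ?_
    rintro _ (rfl | rfl | rfl)
    · simpa using hmem 4 0 (by decide) (by decide) rfl
    · exact hmem 2 2 (by decide) (by decide) rfl
    · simpa using hmem 0 4 (by decide) (by decide) rfl

lemma iSup_hatMk_eight : (⨆ k : ℕ, hatMk (th 1) (th 2) (1 / 2) (1 / 2) k) =
    Subalgebra.toSubmodule (Algebra.adjoin ℂ {th 1 ^ 2, th 2 ^ 2, th 1 * th 2}) := by
  apply le_antisymm
  · refine iSup_le fun k => Submodule.span_le.mpr ?_
    have h1 : th 1 ^ 2 ∈ Algebra.adjoin ℂ {th 1 ^ 2, th 2 ^ 2, th 1 * th 2} :=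
      Algebra.subset_adjoin (by simp)
    have h2 : th 1 * th 2 ∈ Algebra.adjoin ℂ {th 1 ^ 2, th 2 ^ 2, th 1 * th 2} :=
      Algebra.subset_adjoin (by simp)
    have h3 : th 2 ^ 2 ∈ Algebra.adjoin ℂ {th 1 ^ 2, th 2 ^ 2, th 1 * th 2} :=
      Algebra.subset_adjoin (by simp)
    rintro _ ⟨i, j, h, rfl⟩
    have h' : i + j = 2 * k := by exact_mod_cast (by linarith : (i : ℚ) + j = 2 * k)
    rcases Nat.even_or_odd' i with ⟨i, rfl | rfl⟩
    · obtain ⟨j, rfl⟩ : ∃ j', j = 2 * j' := ⟨k - i, by omega⟩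
      rw [pow_mul, pow_mul]
      exact Subalgebra.mul_mem _ (pow_mem h1 i) (pow_mem h3 j)
    · obtain ⟨j, rfl⟩ : ∃ j', j = 2 * j' + 1 := ⟨k - i - 1, by omega⟩
      rw [show th 1 ^ (2 * i + 1) * th 2 ^ (2 * j + 1) =
        (th 1 ^ 2) ^ i * (th 2 ^ 2) ^ j * (th 1 * th 2) by ring]
      exact Subalgebra.mul_mem _ (mul_mem (pow_mem h1 i) (pow_mem h3 j)) h2
  · rw [Algebra.adjoin_eq_span]
    refine Submodule.span_le.mpr fun f hf => ?_
    have : ∃ i j k : ℕ, i + j = 2 * k ∧ f = th 1 ^ i * th 2 ^ j := by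
      refine Submonoid.closure_induction (motive := fun f _ => ∃ i j k : ℕ, i + j = 2 * k ∧
        f = th 1 ^ i * th 2 ^ j) ?_ ⟨0, 0, 0, rfl, by simp⟩ ?_ hf
      · rintro _ (rfl | rfl | rfl)
        · exact ⟨2, 0, 1, rfl, by simp⟩
        · exact ⟨0, 2, 1, rfl, by simp⟩
        · exact ⟨1, 1, 1, rfl, by simp⟩
      · rintro _ _ _ _ ⟨i, j, k, h, rfl⟩ ⟨i', j', k', h', rfl⟩
        exact ⟨i + i', j + j', k + k', by omega, by ring⟩
    obtain ⟨i, j, k, h, rfl⟩ := this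
    refine Submodule.mem_iSup_of_mem k (Submodule.subset_span ⟨i, j, ?_, rfl⟩)
    have : (i : ℚ) + j = 2 * k := by exact_mod_cast h
    linarith

end

/-! ### Forms of level `8` with character `χ₈` -/

lemma th_ne_zero (t : ℕ) [NeZero t] (z : ℍ) : th t z ≠ 0 := by
  have h := thetaProd_eq (scale (2 * t) z)
  have h1 := eta_ne_zero (scale (2 * t) z)
  rw [push_theta_eq]
  intro h0
  simp only [push] at h0
  rw [thetaProd, coe_scale, h0, mul_zero, zero_mul] at h
  exact mul_ne_zero two_ne_zero (pow_ne_zero 3 h1) h.symm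

lemma chr_chi8' (d : ℤ) : chr ZMod.χ₈' d = chr ZMod.χ₄ d * chr ZMod.χ₈ d := by
  rw [chr, chr, chr, ZMod.χ₈'_int_eq_χ₄_mul_χ₈]
  push_cast
  rfl

lemma chr_chi4_mul_chi8' {N : ℕ} (h : 4 ∣ N) {d : ℤ} (hd : IsCoprime d N) :
    chr ZMod.χ₄ d * chr ZMod.χ₈' d = chr ZMod.χ₈ d := by
  have := chi4_sq h hd
  rw [Pi.pow_apply] at this
  rw [chr_chi8', ← mul_assoc, ← sq, this, one_mul]

lemma exists_sum_of_mem_span {u v f : ℍ → ℂ} {m : ℕ}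
    (hf : f ∈ Submodule.span ℂ {F | ∃ i j : ℕ, i + 1 * j = m ∧ F = u ^ i * v ^ j}) :
    ∃ c : ℕ → ℂ, f = ∑ i ∈ Finset.range (m + 1), c i • (u ^ i * v ^ (m - i)) := by
  induction hf using Submodule.span_induction with
  | mem x hx =>
    obtain ⟨i, j, h, rfl⟩ := hx
    refine ⟨Pi.single i 1, ?_⟩
    rw [Finset.sum_eq_single i (fun b _ hb => by simp [Pi.single_eq_of_ne hb])
      (fun h' => absurd (Finset.mem_range.mpr (by omega)) h'), Pi.single_eq_same, one_smul,
      show m - i = j by omega]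
  | zero => exact ⟨0, by simp⟩
  | add x y _ _ hx hy =>
    obtain ⟨a, rfl⟩ := hx
    obtain ⟨b, rfl⟩ := hy
    exact ⟨a + b, by simp [add_smul, Finset.sum_add_distrib]⟩
  | smul r x _ hx =>
    obtain ⟨a, rfl⟩ := hx
    exact ⟨r • a, by simp [Finset.smul_sum, mul_smul]⟩

/-- A form `f` of character `χ₈`, multiplied by `θ₁ θ₂`, is a polynomial `P` in `θ₁ ^ 2` and
`θ₂ ^ 2`. Since `P ^ 2 = f ^ 2 θ₁ ^ 2 θ₂ ^ 2`, it is divisible by both of these. -/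
lemma MkChar_eight_eq (n : ℕ) : MkChar 8 ZMod.χ₈ (2 * n) = Submodule.span ℂ
    {f | ∃ i j : ℕ, Odd i ∧ Odd j ∧ i + j = 4 * n ∧ f = th 1 ^ i * th 2 ^ j} := by
  have hχ : ∀ d : ℤ, IsCoprime d (8 : ℕ) → (chr ZMod.χ₄ ^ 2) d = 1 :=
    fun d hd => chi4_sq (by norm_num) hd
  apply le_antisymm
  · intro f hf
    have hf := (mem_MkChar_iff dvd_rfl _).mp hf
    have hg : IsForm 8 (chr ZMod.χ₄ ^ (2 * n + 1)) (2 * n + 1 : ℕ) (f * (th 1 * th 2)) := by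
      refine IsForm.congr_char (by exact_mod_cast hf.mul isForm_th_mul_th) fun d hd => ?_
      have h1 := hχ d hd
      rw [Pi.pow_apply] at h1
      rw [chr_pow_two_mul_add_one hχ n d hd, Pi.mul_apply,
        ← chr_chi4_mul_chi8' (by norm_num : 4 ∣ 8) hd, mul_assoc, ← sq, chr_chi8', mul_pow, h1,
        ← chr_chi4_mul_chi8' (by norm_num : 4 ∣ 8) hd, chr_chi8']
      have h2 : chr ZMod.χ₈ d ^ 2 = 1 :=
        chr_sq_of_isCoprime ZMod.χ₈ (by decide) (dvd_refl 8) hd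
      linear_combination (chr ZMod.χ₄ d * chr ZMod.χ₈ d ^ 2 * (chr ZMod.χ₄ d ^ 2 + 1)) * h1 +
        chr ZMod.χ₄ d * h2
    have hf2 : IsForm 8 (chr ZMod.χ₄ ^ (4 * n)) (4 * n : ℕ) (f ^ 2) := by
      have e : (((2 : ℕ) : ℤ) * (2 * n)) = (4 * n : ℕ) := by push_cast; ring
      have := hf.pow 2
      rw [e] at this
      refine this.congr_char fun d hd => ?_
      rw [show 4 * n = 2 * (2 * n) by ring, chr_pow_two_mul hχ _ d hd]
      exact chr_sq_of_isCoprime ZMod.χ₈ (by decide) (dvd_refl 8) hd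
    obtain ⟨c, hc⟩ := exists_sum_of_mem_span (IsForm.mem_span_eight _ hg)
    obtain ⟨e, he⟩ := exists_sum_of_mem_span (IsForm.mem_span_eight _ hf2)
    set m := 2 * n + 1 with hm
    let P : MvPolynomial (Fin 2) ℂ := ∑ i ∈ Finset.range (m + 1),
      MvPolynomial.C (c i) * (MvPolynomial.X 0 ^ i * MvPolynomial.X 1 ^ (m - i))
    let H : MvPolynomial (Fin 2) ℂ := ∑ i ∈ Finset.range (4 * n + 1),
      MvPolynomial.C (e i) * (MvPolynomial.X 0 ^ i * MvPolynomial.X 1 ^ (4 * n - i))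
    have hP : MvPolynomial.aeval ![th 1 ^ 2, th 2 ^ 2] P = f * (th 1 * th 2) := by
      rw [hc, map_sum]
      exact Finset.sum_congr rfl fun i _ => by simp [Algebra.smul_def]
    have hH : MvPolynomial.aeval ![th 1 ^ 2, th 2 ^ 2] H = f ^ 2 := by
      rw [he, map_sum]
      exact Finset.sum_congr rfl fun i _ => by simp [Algebra.smul_def]
    have hPH : P ^ 2 = MvPolynomial.X 0 * MvPolynomial.X 1 * H := by
      refine algebraicIndependent_th_sq (?_ : MvPolynomial.aeval _ _ = MvPolynomial.aeval _ _)
      rw [map_pow, map_mul, map_mul, hP, hH]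
      simp
      ring
    -- The coefficients of the two pure powers in `P` vanish.
    have hc0 : c 0 = 0 := by
      have h1 : MvPolynomial.eval ![(0 : ℂ), 1] P = c 0 := by
        rw [map_sum, Finset.sum_eq_single 0 (fun b _ hb => by simp [hb]) (by simp)]
        simp
      have h2 := congrArg (MvPolynomial.eval ![(0 : ℂ), 1]) hPH
      rw [map_pow, h1] at h2
      simpa using h2
    have hcm : c m = 0 := by
      have h1 : MvPolynomial.eval ![(1 : ℂ), 0] P = c m := by
        rw [map_sum, Finset.sum_eq_single m (fun b hb hbm => ?_) (by simp)]
        · simp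
        · have := Finset.mem_range.mp hb
          simp [show m - b ≠ 0 by omega]
      have h2 := congrArg (MvPolynomial.eval ![(1 : ℂ), 0]) hPH
      rw [map_pow, h1] at h2
      simpa using h2
    have hfs : f = ∑ i ∈ Finset.range (m + 1), c i • (th 1 ^ (2 * i - 1) *
        th 2 ^ (2 * (m - i) - 1)) := by
      ext z
      refine mul_right_cancel₀ (mul_ne_zero (th_ne_zero 1 z) (th_ne_zero 2 z)) ?_
      refine (congrFun hc z).trans ?_
      rw [Finset.sum_apply, Finset.sum_apply, Finset.sum_mul]
      refine Finset.sum_congr rfl fun i hi => ?_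
      have him := Finset.mem_range.mp hi
      rcases eq_or_ne i 0 with rfl | h0
      · simp [hc0]
      rcases eq_or_ne i m with rfl | h0'
      · simp [hcm]
      obtain ⟨i, rfl⟩ := Nat.exists_eq_succ_of_ne_zero h0
      obtain ⟨j, hj⟩ : ∃ j, m - (i + 1) = j + 1 := ⟨m - (i + 1) - 1, by omega⟩
      simp only [Nat.succ_eq_add_one, hj, Pi.smul_apply, Pi.mul_apply, Pi.pow_apply, smul_eq_mul,
        show 2 * (i + 1) - 1 = 2 * i + 1 by omega, show 2 * (j + 1) - 1 = 2 * j + 1 by omega]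
      ring
    rw [hfs]
    refine Submodule.sum_mem _ fun i hi => ?_
    have him := Finset.mem_range.mp hi
    rcases eq_or_ne i 0 with rfl | h0
    · rw [hc0, zero_smul]
      exact zero_mem _
    rcases eq_or_ne i m with rfl | h0'
    · rw [hcm, zero_smul]
      exact zero_mem _
    · exact Submodule.smul_mem _ _ (Submodule.subset_span ⟨_, _, ⟨i - 1, by omega⟩,
        ⟨m - i - 1, by omega⟩, by omega, rfl⟩)
  · refine Submodule.span_le.mpr ?_
    rintro _ ⟨_, _, ⟨i, rfl⟩, ⟨j, rfl⟩, h, rfl⟩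
    obtain ⟨n, rfl⟩ : ∃ n', n = n' + 1 := ⟨n - 1, by omega⟩
    have h1 := (isForm_th_monomial (i := i) (j := j) (k := 2 * n + 1) (by omega)).mul
      isForm_th_mul_th
    have e : th 1 ^ (2 * i + 1) * th 2 ^ (2 * j + 1) =
        (th 1 ^ 2) ^ i * (th 2 ^ 2) ^ j * (th 1 * th 2) := by ring
    refine (mem_MkChar_iff dvd_rfl _).mpr ?_
    rw [e]
    convert h1.congr_char fun d hd => ?_ using 1
    · push_cast
      ring
    · rw [Pi.mul_apply, chr_pow_two_mul_add_one hχ n d hd,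
        chr_chi4_mul_chi8' (by norm_num : 4 ∣ 8) hd]

lemma hatMk_eight_eq (n : ℕ) : hatMk (th 1) (th 2) (1 / 2) (1 / 2) (2 * n) =
    Mk 8 (2 * n) ⊔ MkChar 8 ZMod.χ₈ (2 * n) := by
  rw [Mk_eight_eq, MkChar_eight_eq, ← Submodule.span_union]
  apply congrArg (Submodule.span ℂ)
  ext f
  constructor
  · rintro ⟨i, j, h, rfl⟩
    have h' : i + j = 4 * n := by exact_mod_cast (by linarith : (i : ℚ) + j = 4 * n)
    rcases Nat.even_or_odd i with hi | hi
    · exact Or.inl ⟨i, j, hi, (Nat.even_add.mp (h' ▸ ⟨2 * n, by omega⟩)).mp hi, h', rfl⟩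
    · refine Or.inr ⟨i, j, hi, ?_, h', rfl⟩
      have h2 : Even (i + j) := h' ▸ ⟨2 * n, by omega⟩
      rw [Nat.even_add, ← not_iff_not, Nat.not_even_iff_odd, Nat.not_even_iff_odd] at h2
      exact h2.mp hi
  · rintro (⟨i, j, _, _, h, rfl⟩ | ⟨i, j, _, _, h, rfl⟩) <;>
    · refine ⟨i, j, ?_, rfl⟩
      have : (i : ℚ) + j = 4 * n := by exact_mod_cast h
      linarith

/-! ### The structure of the ring of level `6` -/

lemma s_sq_sub_d_sq : s ^ 2 - d ^ 2 = 8 * p ^ 2 := by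
  rw [s, d, p]
  ring

lemma Th_one_sq_eq : Th 1 ^ 2 = (1 / 2 : ℂ) • (s + d) := by
  ext z
  simp [s, d]
  ring

lemma Th_two_sq_eq : Th 2 ^ 2 = (1 / 4 : ℂ) • (s - d) := by
  ext z
  simp [s, d]
  ring

lemma Mk_six_two : Mk 6 2 = Submodule.span ℂ {s, p, d} := by
  have hs : s ∈ Submodule.span ℂ {s, p, d} := Submodule.subset_span (by simp)
  have hp : p ∈ Submodule.span ℂ {s, p, d} := Submodule.subset_span (by simp)
  have hd : d ∈ Submodule.span ℂ {s, p, d} := Submodule.subset_span (by simp)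
  apply le_antisymm
  · have := Mk_six_eq 1
    rw [Nat.cast_one, mul_one] at this
    rw [this]
    refine Submodule.span_le.mpr ?_
    rintro _ ⟨i, j, h, rfl⟩
    have h' : i + j = 2 := by exact_mod_cast (by push_cast at h; linarith : (i : ℚ) + j = 2)
    obtain ⟨rfl, rfl⟩ | ⟨rfl, rfl⟩ | ⟨rfl, rfl⟩ :
        (i = 0 ∧ j = 2) ∨ (i = 1 ∧ j = 1) ∨ (i = 2 ∧ j = 0) := by omega
    · rw [pow_zero, one_mul, Th_two_sq_eq]
      exact Submodule.smul_mem _ _ (sub_mem hs hd)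
    · rw [pow_one, pow_one]
      exact hp
    · rw [pow_zero, mul_one, Th_one_sq_eq]
      exact Submodule.smul_mem _ _ (add_mem hs hd)
  · refine Submodule.span_le.mpr ?_
    rintro _ (rfl | rfl | rfl)
    · exact mem_Mk_iff.mpr isForm_s
    · exact mem_Mk_iff.mpr isForm_p
    · exact mem_Mk_iff.mpr isForm_d

/-- The substitution `Θ₁ ↦ √2 Θ₂`, `Θ₂ ↦ Θ₁ / √2` fixes `s` and `p` and changes the sign of `d`. -/
lemma eq_zero_of_aeval_add_d_mul {F G : MvPolynomial (Fin 2) ℂ}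
    (h : MvPolynomial.aeval ![s, p] F + d * MvPolynomial.aeval ![s, p] G = 0) :
    F = 0 ∧ G = 0 := by
  let σ : MvPolynomial (Fin 2) ℂ →ₐ[ℂ] MvPolynomial (Fin 2) ℂ := MvPolynomial.aeval
    ![MvPolynomial.X 0 ^ 2 + 2 * MvPolynomial.X 1 ^ 2, MvPolynomial.X 0 * MvPolynomial.X 1]
  have hσ {u v : ℍ → ℂ} (P : MvPolynomial (Fin 2) ℂ) : MvPolynomial.aeval ![u, v] (σ P) =
      MvPolynomial.aeval ![u ^ 2 + 2 * v ^ 2, u * v] P := by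
    rw [← AlgHom.comp_apply]
    refine DFunLike.congr_fun (MvPolynomial.algHom_ext fun i => ?_) P
    fin_cases i <;> simp [σ]
  have h0 : σ F + (MvPolynomial.X 0 ^ 2 - 2 * MvPolynomial.X 1 ^ 2) * σ G = 0 := by
    refine algebraicIndependent_Th_Th (?_ : MvPolynomial.aeval _ _ = MvPolynomial.aeval _ _)
    rw [map_zero, map_add, map_mul, hσ, hσ]
    simpa using! h
  have h2 : ((Real.sqrt 2 : ℝ) : ℂ) ^ 2 = 2 := by
    rw [← Complex.ofReal_pow, Real.sq_sqrt two_pos.le]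
    simp
  have h3 : ((Real.sqrt 2 : ℝ) : ℂ) ≠ 0 := by simp
  have h1 := congrArg (MvPolynomial.aeval
    ![((Real.sqrt 2 : ℝ) : ℂ) • Th 2, ((Real.sqrt 2 : ℝ) : ℂ)⁻¹ • Th 1]) h0
  have hs : (((Real.sqrt 2 : ℝ) : ℂ) • Th 2) ^ 2 + 2 * (((Real.sqrt 2 : ℝ) : ℂ)⁻¹ • Th 1) ^ 2 =
      s := by
    ext z
    simp only [s, Pi.add_apply, Pi.mul_apply, Pi.pow_apply, Pi.smul_apply, smul_eq_mul, mul_pow,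
      inv_pow, h2, Pi.ofNat_apply]
    ring
  have hp : (((Real.sqrt 2 : ℝ) : ℂ) • Th 2) * (((Real.sqrt 2 : ℝ) : ℂ)⁻¹ • Th 1) = p := by
    ext z
    simp only [p, Pi.mul_apply, Pi.smul_apply, smul_eq_mul]
    field_simp
  have hd : (((Real.sqrt 2 : ℝ) : ℂ) • Th 2) ^ 2 - 2 * (((Real.sqrt 2 : ℝ) : ℂ)⁻¹ • Th 1) ^ 2 =
      -d := by
    ext z
    simp only [d, Pi.sub_apply, Pi.mul_apply, Pi.pow_apply, Pi.smul_apply, smul_eq_mul, mul_pow,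
      inv_pow, h2, Pi.ofNat_apply, Pi.neg_apply]
    ring
  rw [map_zero, map_add, map_mul, hσ, hσ, hs, hp, map_sub, map_mul, map_pow, map_pow, map_ofNat,
    MvPolynomial.aeval_X, MvPolynomial.aeval_X] at h1
  simp only [Matrix.cons_val_zero, Matrix.cons_val_one] at h1
  rw [hd] at h1
  have hF : F = 0 := by
    refine algebraicIndependent_s_p (?_ : MvPolynomial.aeval _ _ = MvPolynomial.aeval _ _)
    rw [map_zero]
    have h4 : (2 : ℂ) • MvPolynomial.aeval ![s, p] F = 0 := by
      rw [two_smul]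
      linear_combination h + h1
    exact (smul_eq_zero.mp h4).resolve_left two_ne_zero
  have hG : (MvPolynomial.X 0 ^ 2 - 8 * MvPolynomial.X 1 ^ 2) * G = 0 := by
    refine algebraicIndependent_s_p (?_ : MvPolynomial.aeval _ _ = MvPolynomial.aeval _ _)
    rw [map_zero, map_mul, map_sub, map_mul, map_pow, map_pow, map_ofNat, MvPolynomial.aeval_X,
      MvPolynomial.aeval_X]
    simp only [Matrix.cons_val_zero, Matrix.cons_val_one]
    rw [hF, map_zero] at h
    linear_combination d * h + MvPolynomial.aeval ![s, p] G * s_sq_sub_d_sq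
  refine ⟨hF, (mul_eq_zero.mp hG).resolve_left fun h5 => ?_⟩
  have := congrArg (MvPolynomial.eval ![(1 : ℂ), 0]) h5
  simp at this

lemma existsUnique_aeval_add_d_mul {f : ℍ → ℂ} (hf : f ∈ M 6) :
    ∃! F : MvPolynomial (Fin 2) ℂ × MvPolynomial (Fin 2) ℂ,
      f = MvPolynomial.aeval ![s, p] F.1 + d * MvPolynomial.aeval ![s, p] F.2 := by
  refine existsUnique_of_exists_of_unique ?_ fun F G hF hG => ?_
  · rw [M_six_eq] at hf
    induction hf using Algebra.adjoin_induction with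
    | mem x hx =>
      rcases hx with rfl | rfl | rfl
      · refine ⟨(MvPolynomial.C (1 / 2) * MvPolynomial.X 0, MvPolynomial.C (1 / 2)), ?_⟩
        rw [Th_one_sq_eq]
        simp [Algebra.smul_def]
        ring
      · refine ⟨(MvPolynomial.X 1, 0), ?_⟩
        simp [p]
      · refine ⟨(MvPolynomial.C (1 / 4) * MvPolynomial.X 0, -MvPolynomial.C (1 / 4)), ?_⟩
        rw [Th_two_sq_eq]
        simp [Algebra.smul_def]
        ring
    | algebraMap r => exact ⟨(MvPolynomial.C r, 0), by simp⟩
    | add x y _ _ hx hy =>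
      obtain ⟨F, rfl⟩ := hx
      obtain ⟨G, rfl⟩ := hy
      exact ⟨F + G, by simp; ring⟩
    | mul x y _ _ hx hy =>
      obtain ⟨F, rfl⟩ := hx
      obtain ⟨G, rfl⟩ := hy
      -- `d ^ 2 = s ^ 2 - 8 p ^ 2`
      refine ⟨(F.1 * G.1 + (MvPolynomial.X 0 ^ 2 - 8 * MvPolynomial.X 1 ^ 2) * (F.2 * G.2),
        F.1 * G.2 + F.2 * G.1), ?_⟩
      simp only [map_add, map_mul, map_sub, map_pow, MvPolynomial.aeval_X, map_ofNat,
        Matrix.cons_val_zero, Matrix.cons_val_one]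
      linear_combination (-MvPolynomial.aeval ![s, p] F.2 * MvPolynomial.aeval ![s, p] G.2) *
        s_sq_sub_d_sq
  · obtain ⟨h1, h2⟩ := eq_zero_of_aeval_add_d_mul (F := F.1 - G.1) (G := F.2 - G.2) (by
      rw [map_sub, map_sub]
      linear_combination hG - hF)
    exact Prod.ext (sub_eq_zero.mp h1) (sub_eq_zero.mp h2)

lemma linearIndependent_s_p_d : LinearIndependent ℂ ![s, p, d] := by
  rw [Fintype.linearIndependent_iff]
  intro c hc
  rw [Fin.sum_univ_three] at hc
  obtain ⟨h1, h2⟩ := eq_zero_of_aeval_add_d_mul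
    (F := MvPolynomial.C (c 0) * MvPolynomial.X 0 + MvPolynomial.C (c 1) * MvPolynomial.X 1)
    (G := MvPolynomial.C (c 2)) (by
      rw [← hc]
      simp [Algebra.smul_def]
      ring)
  have h3 := congrArg (MvPolynomial.eval ![(1 : ℂ), 0]) h1
  have h4 := congrArg (MvPolynomial.eval ![(0 : ℂ), 1]) h1
  have h5 := congrArg (MvPolynomial.eval ![(0 : ℂ), 0]) h2
  intro i
  fin_cases i
  · simpa using h3
  · simpa using h4
  · simpa using h5

/-! ### Atkin–Lehner operators on the generators -/

lemma atkinLehner_fricke {N : ℕ} [NeZero N] {k : ℤ} {n : ℕ} (hk : k = 2 * n) {f g : ℍ → ℂ}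
    (hf : IsForm N 1 k f)
    (h : ∀ z : ℍ, (N : ℂ) ^ n * f (fricke N z) = (N * z) ^ (2 * n) * g z) :
    AtkinLehner N N k f g := by
  refine atkinLehner_of_isForm dvd_rfl (NeZero.pos N) hk hf (x₀ := 0) (y₀ := -1) (z₀ := 1) (w₀ := 0)
    (by ring) fun z w hw => ?_
  have : w = fricke N z := by
    ext1
    rw [hw, coe_fricke]
    simp
  rw [this, h]
  simp

/-- Homogeneity of weighted homogeneous polynomials, with the scaling factors of the monomials of
weight `k` given. -/
lemma eval_eq_mul_eval {a b k : ℚ} {F : MvPolynomial (Fin 2) ℂ}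
    (hF : MvPolynomial.IsWeightedHomogeneous ![a, b] F k) {x y x' y' c c' : ℂ}
    (h : ∀ i j : ℕ, a * i + b * j = k → c * (x ^ i * y ^ j) = c' * (x' ^ i * y' ^ j)) :
    c * MvPolynomial.eval ![x, y] F = c' * MvPolynomial.eval ![x', y'] F := by
  have e (x y : ℂ) : MvPolynomial.eval ![x, y] F = MvPolynomial.aeval ![x, y] F := by
    rw [MvPolynomial.aeval_eq_eval]
  rw [e, e, aeval_eq_sum, aeval_eq_sum, Finset.mul_sum, Finset.mul_sum]
  refine Finset.sum_congr rfl fun d hd => ?_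
  rw [mul_smul_comm, mul_smul_comm, h _ _ (weight_eq hF hd)]

lemma atkinLehner_A : AtkinLehner 2 2 2 A (-A) :=
  atkinLehner_fricke (n := 1) rfl isForm_A fun z => by
    rw [A_fricke, Pi.neg_apply]
    push_cast
    ring

lemma atkinLehner_B : AtkinLehner 2 2 4 B (-B) :=
  atkinLehner_fricke (n := 2) rfl isForm_B fun z => by
    rw [B_fricke, Pi.neg_apply]
    push_cast
    ring

lemma atkinLehner_et_two :
    AtkinLehner 2 2 8 (et 1 ^ 8 * et 2 ^ 8) (et 1 ^ 8 * et 2 ^ 8) :=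
  atkinLehner_fricke (n := 4) rfl isCuspGenerator_two.isForm fun z => by
    rw [et_pow_mul_pow_two]
    simp only [Pi.smul_apply, Pi.sub_apply, Pi.pow_apply, smul_eq_mul]
    rw [A_fricke, B_fricke]
    push_cast
    ring

lemma sqrt_three_pow_four : (Real.sqrt 3 : ℂ) ^ 4 = 9 := by
  rw [show (Real.sqrt 3 : ℂ) ^ 4 = ((Real.sqrt 3 : ℂ) ^ 2) ^ 2 by ring, sqrt_three_sq]
  norm_num

lemma atkinLehner_three (n : ℕ) (F : MvPolynomial (Fin 2) ℂ)
    (hF : MvPolynomial.IsWeightedHomogeneous ![(1 : ℚ), 3] F (2 * n)) :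
    AtkinLehner 3 3 (2 * n) (MvPolynomial.aeval ![Th 1, Phi] F)
      (MvPolynomial.aeval ![Complex.I • Th 1, Complex.I • Phi] F) := by
  have hform : IsForm 3 1 (2 * n) (MvPolynomial.aeval ![Th 1, Phi] F) :=
    mem_Mk_iff.mp (Mk_three_eq n ▸ aeval_mem_hatMk hF)
  refine atkinLehner_fricke rfl hform fun z => ?_
  rw [aeval_apply, aeval_apply]
  refine eval_eq_mul_eval hF fun i j hij => ?_
  have h' : i + 3 * j = 2 * n := by exact_mod_cast (by linarith : (i : ℚ) + 3 * j = 2 * n)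
  rw [Th_one_fricke, Phi_fricke]
  simp only [Pi.smul_apply, smul_eq_mul]
  -- the Fricke involution is `Θ ↦ μ (i Θ)`, `Φ ↦ μ ^ 3 (i Φ)`, with `μ = -√3 z`
  have e1 : -Complex.I * Real.sqrt 3 * z * Th 1 z =
      (-(Real.sqrt 3 : ℂ) * z) * (Complex.I * Th 1 z) := by ring
  have e2 : -(-Complex.I * Real.sqrt 3 * z) ^ 3 * Phi z =
      (-(Real.sqrt 3 : ℂ) * z) ^ 3 * (Complex.I * Phi z) := by
    linear_combination ((Real.sqrt 3 : ℂ) ^ 3 * z ^ 3 * Phi z * Complex.I) * Complex.I_sq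
  have e3 : (-(Real.sqrt 3 : ℂ) * z) ^ (2 * n) = (3 : ℂ) ^ n * (z : ℂ) ^ (2 * n) := by
    rw [mul_pow, pow_mul, neg_sq, sqrt_three_sq]
  have e4 : (-(Real.sqrt 3 : ℂ) * z) ^ (2 * n) =
      (-(Real.sqrt 3 : ℂ) * z) ^ i * ((-(Real.sqrt 3 : ℂ) * z) ^ 3) ^ j := by
    rw [← h', pow_add, pow_mul]
  rw [e1, e2, mul_pow (-(Real.sqrt 3 : ℂ) * z) (Complex.I * Th 1 z),
    mul_pow ((-(Real.sqrt 3 : ℂ) * z) ^ 3), mul_mul_mul_comm, ← e4, e3,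
    mul_pow ((3 : ℕ) : ℂ) (z : ℂ),
    Nat.cast_ofNat]
  ring

lemma atkinLehner_et_three :
    AtkinLehner 3 3 6 (et 1 ^ 6 * et 3 ^ 6) (-(et 1 ^ 6 * et 3 ^ 6)) :=
  atkinLehner_fricke (n := 3) rfl isCuspGenerator_three.isForm fun z => by
    rw [et_pow_mul_pow_three]
    simp only [Pi.smul_apply, Pi.sub_apply, Pi.pow_apply, Pi.neg_apply, smul_eq_mul]
    rw [Th_one_fricke, Phi_fricke]
    have e : (-Complex.I * Real.sqrt 3 * z) ^ 2 = -3 * (z : ℂ) ^ 2 := by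
      rw [mul_pow, mul_pow, neg_sq, Complex.I_sq, sqrt_three_sq]
      ring
    generalize -Complex.I * Real.sqrt 3 * z = μ at e ⊢
    push_cast
    linear_combination (27 * ((2 : ℂ) ^ 2 * 3 ^ 3)⁻¹ * (Th 1 z ^ 6 - Phi z ^ 2) *
      (μ ^ 4 - 3 * (z : ℂ) ^ 2 * μ ^ 2 + 9 * (z : ℂ) ^ 4)) * e

lemma atkinLehner_four (ρ : ℂ) (hρ : IsPrimitiveRoot ρ 8) (n : ℕ) (F : MvPolynomial (Fin 2) ℂ)
    (hF : MvPolynomial.IsWeightedHomogeneous ![(1 / 2 : ℚ), 2] F (2 * n)) :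
    AtkinLehner 4 4 (2 * n) (MvPolynomial.aeval ![th 1, D] F)
      (MvPolynomial.aeval ![ρ • th 1, D] F) := by
  have hform : IsForm 4 1 (2 * n) (MvPolynomial.aeval ![th 1, D] F) :=
    mem_Mk_iff.mp (((Mk_four_eq n).trans (hatMk_C_D n)) ▸ aeval_mem_hatMk hF)
  refine atkinLehner_fricke rfl hform fun z => ?_
  rw [aeval_apply, aeval_apply]
  refine eval_eq_mul_eval hF fun i j hij => ?_
  have h' : i + 4 * j = 4 * n := by exact_mod_cast (by linarith : (i : ℚ) + 4 * j = 4 * n)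
  -- The weight forces `4 ∣ i`, so that only `ρ ^ 4 = -1` enters.
  obtain ⟨i, rfl⟩ : ∃ i', i = 4 * i' := ⟨n - j, by omega⟩
  obtain rfl : n = i + j := by omega
  have hρ4 : ρ ^ 4 = -1 := by
    have h1 := hρ.pow_eq_one
    have h2 : (ρ ^ 4 - 1) * (ρ ^ 4 + 1) = 0 := by linear_combination h1
    rcases mul_eq_zero.mp h2 with h | h
    · exact absurd (sub_eq_zero.mp h) (hρ.pow_ne_one_of_pos_of_lt (by norm_num) (by norm_num))
    · exact eq_neg_of_add_eq_zero_left h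
  have hC := C_fricke z
  rw [C, Pi.pow_apply, Pi.pow_apply] at hC
  rw [pow_mul (th 1 (fricke 4 z)), hC, D_fricke, Pi.smul_apply, smul_eq_mul,
    pow_mul (ρ * th 1 z), mul_pow ρ, hρ4,
    show (-4 * (z : ℂ) ^ 2 * th 1 z ^ 4) = (4 * (z : ℂ) ^ 2) * (-1 * th 1 z ^ 4) by ring,
    mul_pow (4 * (z : ℂ) ^ 2), mul_pow (4 * (z : ℂ) ^ 2), mul_mul_mul_comm, ← pow_add,
    ← mul_assoc, ← mul_pow, pow_mul]
  congr 2
  push_cast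
  ring

lemma atkinLehner_C : AtkinLehner 4 4 2 C (-C) :=
  atkinLehner_fricke (n := 1) rfl isForm_C fun z => by
    rw [C_fricke, Pi.neg_apply]
    push_cast
    ring

lemma atkinLehner_D : AtkinLehner 4 4 2 D D :=
  atkinLehner_fricke (n := 1) rfl isForm_D fun z => by
    rw [D_fricke]
    push_cast
    ring

lemma atkinLehner_et_four : AtkinLehner 4 4 6 (et 2 ^ 12) (-et 2 ^ 12) :=
  atkinLehner_fricke (n := 3) rfl isCuspGenerator_four.isForm fun z => by
    rw [et_pow_four]
    simp only [Pi.smul_apply, Pi.sub_apply, Pi.mul_apply, Pi.pow_apply, Pi.neg_apply, smul_eq_mul]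
    rw [C_fricke, D_fricke]
    push_cast
    ring

lemma atkinLehner_six_two {k : ℤ} {n : ℕ} (hk : k = 2 * n) {f g : ℍ → ℂ} (hf : IsForm 6 1 k f)
    (h : ∀ z w : ℍ, (Th 1 w = (6 * z - 2) * Th 2 z ∧ Th 2 w = -(3 * z - 1) * Th 1 z) →
      (2 : ℂ) ^ n * f w = (6 * z - 2) ^ (2 * n) * g z) : AtkinLehner 6 2 k f g := by
  refine atkinLehner_of_isForm (by norm_num) two_pos hk hf (x₀ := 1) (y₀ := -1) (z₀ := 1)
    (w₀ := -1) (by norm_num) fun z w hw => ?_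
  have := h z w (Th_atkinLehner_two z w (by rw [hw]; push_cast; ring))
  push_cast
  rw [this]
  ring

lemma atkinLehner_six_three {k : ℤ} {n : ℕ} (hk : k = 2 * n) {f g : ℍ → ℂ} (hf : IsForm 6 1 k f)
    (h : ∀ z w : ℍ, (Th 1 w = Complex.I * Real.sqrt 3 * (2 * z + 1) * Th 1 z ∧
      Th 2 w = -(Complex.I * Real.sqrt 3 * (2 * z + 1)) * Th 2 z) →
      (3 : ℂ) ^ n * f w = (6 * z + 3) ^ (2 * n) * g z) : AtkinLehner 6 3 k f g := by
  refine atkinLehner_of_isForm (by norm_num) three_pos hk hf (x₀ := 1) (y₀ := 1) (z₀ := 1)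
    (w₀ := 1) (by norm_num) fun z w hw => ?_
  have := h z w (Th_atkinLehner_three z w (by rw [hw]; push_cast; ring))
  push_cast
  rw [← mul_one (6 : ℂ)] at this ⊢
  simpa using this

lemma I_mul_sqrt_three_sq : (Complex.I * Real.sqrt 3) ^ 2 = -3 := by
  rw [mul_pow, Complex.I_sq, sqrt_three_sq]
  ring

lemma atkinLehner_s_two : AtkinLehner 6 2 2 s s :=
  atkinLehner_six_two (n := 1) rfl isForm_s fun z w ⟨h1, h2⟩ => by
    simp only [s, Pi.add_apply, Pi.mul_apply, Pi.pow_apply, Pi.ofNat_apply, h1, h2]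
    ring

lemma atkinLehner_p_two : AtkinLehner 6 2 2 p (-p) :=
  atkinLehner_six_two (n := 1) rfl isForm_p fun z w ⟨h1, h2⟩ => by
    simp only [p, Pi.neg_apply, Pi.mul_apply, h1, h2]
    ring

lemma atkinLehner_d_two : AtkinLehner 6 2 2 d (-d) :=
  atkinLehner_six_two (n := 1) rfl isForm_d fun z w ⟨h1, h2⟩ => by
    simp only [d, Pi.neg_apply, Pi.sub_apply, Pi.mul_apply, Pi.pow_apply, Pi.ofNat_apply, h1, h2]
    ring

lemma atkinLehner_s_three : AtkinLehner 6 3 2 s (-s) :=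
  atkinLehner_six_three (n := 1) rfl isForm_s fun z w ⟨h1, h2⟩ => by
    simp only [s, Pi.neg_apply, Pi.add_apply, Pi.mul_apply, Pi.pow_apply, Pi.ofNat_apply, h1, h2]
    linear_combination (3 * (2 * (z : ℂ) + 1) ^ 2 * (Th 1 z ^ 2 + 2 * Th 2 z ^ 2)) *
      I_mul_sqrt_three_sq

lemma atkinLehner_p_three : AtkinLehner 6 3 2 p p :=
  atkinLehner_six_three (n := 1) rfl isForm_p fun z w ⟨h1, h2⟩ => by
    simp only [p, Pi.mul_apply, h1, h2]
    linear_combination (-3 * (2 * (z : ℂ) + 1) ^ 2 * (Th 1 z * Th 2 z)) *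
      I_mul_sqrt_three_sq

lemma atkinLehner_d_three : AtkinLehner 6 3 2 d (-d) :=
  atkinLehner_six_three (n := 1) rfl isForm_d fun z w ⟨h1, h2⟩ => by
    simp only [d, Pi.neg_apply, Pi.sub_apply, Pi.mul_apply, Pi.pow_apply, Pi.ofNat_apply, h1, h2]
    linear_combination (3 * (2 * (z : ℂ) + 1) ^ 2 * (Th 1 z ^ 2 - 2 * Th 2 z ^ 2)) *
      I_mul_sqrt_three_sq

lemma atkinLehner_et_six_two :
    AtkinLehner 6 2 4 (et 1 ^ 2 * et 2 ^ 2 * et 3 ^ 2 * et 6 ^ 2)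
      (et 1 ^ 2 * et 2 ^ 2 * et 3 ^ 2 * et 6 ^ 2) :=
  atkinLehner_six_two (n := 2) rfl isCuspGenerator_six.isForm fun z w ⟨h1, h2⟩ => by
    rw [et_pow_six]
    simp only [s, p, Pi.smul_apply, smul_eq_mul, Pi.add_apply, Pi.sub_apply, Pi.mul_apply,
      Pi.pow_apply, Pi.ofNat_apply, h1, h2]
    ring

lemma atkinLehner_et_six_three :
    AtkinLehner 6 3 4 (et 1 ^ 2 * et 2 ^ 2 * et 3 ^ 2 * et 6 ^ 2)
      (et 1 ^ 2 * et 2 ^ 2 * et 3 ^ 2 * et 6 ^ 2) :=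
  atkinLehner_six_three (n := 2) rfl isCuspGenerator_six.isForm fun z w ⟨h1, h2⟩ => by
    rw [et_pow_six]
    have e : (Complex.I * Real.sqrt 3) ^ 4 = 9 := by
      rw [show (Complex.I * Real.sqrt 3) ^ 4 = ((Complex.I * Real.sqrt 3) ^ 2) ^ 2 by ring,
        I_mul_sqrt_three_sq]
      norm_num
    simp only [s, p, Pi.smul_apply, smul_eq_mul, Pi.add_apply, Pi.sub_apply, Pi.mul_apply,
      Pi.pow_apply, Pi.ofNat_apply, h1, h2]
    linear_combination (9 * ((2 : ℂ) ^ 2 * 3 ^ 2)⁻¹ * (2 * (z : ℂ) + 1) ^ 4 *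
      (9 * (Th 1 z * Th 2 z) ^ 2 - (Th 1 z ^ 2 + 2 * Th 2 z ^ 2) ^ 2)) * e

lemma th_fricke_eight (z : ℍ) : th 1 (fricke 8 z) ^ 2 = -4 * Complex.I * z * th 2 z ^ 2 ∧
    th 2 (fricke 8 z) ^ 2 = -2 * Complex.I * z * th 1 z ^ 2 := by
  have h2 := im_two_mul_pos z.im_pos
  have h4 := im_four_mul_pos z.im_pos
  have hz0 : (z : ℂ) ≠ 0 := z.ne_zero
  constructor
  · rw [th_one_apply, th_two_apply, coe_fricke, Nat.cast_ofNat,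
      show 2 * (-1 / (8 * (z : ℂ))) = -1 / (4 * z) by field_simp; norm_num, T3_neg_inv h4,
      mul_pow, sqrtJ_sq]
    ring
  · rw [th_one_apply, th_two_apply, coe_fricke, Nat.cast_ofNat,
      show 4 * (-1 / (8 * (z : ℂ))) = -1 / (2 * z) by field_simp; norm_num, T3_neg_inv h2,
      mul_pow, sqrtJ_sq]
    ring

lemma atkinLehner_et_eight : AtkinLehner 8 8 4 (et 2 ^ 4 * et 4 ^ 4) (et 2 ^ 4 * et 4 ^ 4) :=
  atkinLehner_fricke (n := 2) rfl isCuspGenerator_eight.isForm fun z => by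
    obtain ⟨h1, h2⟩ := th_fricke_eight z
    have e : Complex.I ^ 4 = 1 := Complex.I_pow_four
    rw [et_pow_eight]
    simp only [Pi.smul_apply, smul_eq_mul, Pi.add_apply, Pi.sub_apply, Pi.mul_apply,
      Pi.pow_apply, Pi.ofNat_apply, Pi.neg_apply, h1, h2]
    push_cast
    linear_combination (4096 * ((2 : ℂ) ^ 2)⁻¹ * (z : ℂ) ^ 4 * th 1 z ^ 2 * th 2 z ^ 2 *
      (-th 1 z ^ 2 + th 2 z ^ 2) * (th 1 z ^ 2 - 2 * th 2 z ^ 2)) * e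

/-! ### The Eisenstein series of level one in terms of theta series -/

lemma isForm_of_modularForm_levelOne {k : ℤ} (F : ModularForm 𝒮ℒ k) : IsForm 1 1 k F := by
  have h (γ : SL(2, ℤ)) : ⇑F ∣[k] γ = ⇑F := F.slash_action_eq' _ ⟨γ, rfl⟩
  refine ⟨F.holo', fun γ _ z => ?_, fun γ => ?_⟩
  · rw [Pi.one_apply]
    exact (slash_eq_iff γ 1).mp (by rw [one_smul, h]) z
  · rw [← isBoundedAtImInfty_slash_iff, h]
    exact ModularFormClass.bdd_at_infty F

lemma tendsto_levelOne {k : ℤ} (F : ModularForm 𝒮ℒ k) :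
    Tendsto F atImInfty (𝓝 ((qExpansion 1 F).coeff 0)) := by
  rw [qExpansion_coeff_zero one_pos
    (ModularFormClass.analyticAt_cuspFunction_zero F one_pos one_mem_strictPeriods_SL)
    (SlashInvariantFormClass.periodic_comp_ofComplex F one_mem_strictPeriods_SL)]
  obtain ⟨c, hc, h⟩ := ModularFormClass.exp_decay_sub_atImInfty' F
  simpa using (h.trans_tendsto (tendsto_exp_neg_im (neg_lt_zero.mpr hc))).add_const
    (valueAtInfty F)

lemma isForm_Q : IsForm 1 1 4 Q := isForm_of_modularForm_levelOne ModularForm.E₄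

lemma isForm_R : IsForm 1 1 6 R := isForm_of_modularForm_levelOne ModularForm.E₆

lemma tendsto_Q : Tendsto Q atImInfty (𝓝 1) := by
  have := tendsto_levelOne ModularForm.E₄
  rwa [EisensteinSeries.E_qExpansion_coeff_zero _ ⟨2, rfl⟩] at this

lemma tendsto_R : Tendsto R atImInfty (𝓝 1) := by
  have := tendsto_levelOne ModularForm.E₆
  rwa [EisensteinSeries.E_qExpansion_coeff_zero _ ⟨3, rfl⟩] at this

lemma IsForm.apply_fricke {f : ℍ → ℂ} {k : ℕ} (hf : IsForm 1 1 k f) (N : ℕ) [NeZero N] (z : ℍ) :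
    f (fricke N z) = (N : ℂ) ^ k * z ^ k * f (scale N z) := by
  rw [fricke, hf.trans ModularGroup.S (mem_Gamma0_iff.mpr (one_dvd _)), Pi.one_apply, one_mul,
    zpow_natCast, ← mul_pow]
  congr 2
  simp [autJ, ModularGroup.S]

lemma tendsto_B : Tendsto B atImInfty (𝓝 1) := by
  have := (tendsto_A.pow 2).sub (((tendsto_push tendsto_T2 1).pow 8).div_const 2)
  norm_num at this
  refine this.congr fun z => ?_
  have := A_sq_sub_B z
  simp [push]
  linear_combination this

/-- The coefficients of `f = α u + β v` from the values of `f`, `u`, `v` at the cusps `∞` and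
`0`. -/
lemma coeff_eq_of_fricke {N k : ℕ} [NeZero N] {f f' u v : ℍ → ℂ} {α β a b c : ℂ}
    (h : α • u + β • v = f) (hf : Tendsto f atImInfty (𝓝 1)) (hf' : Tendsto f' atImInfty (𝓝 1))
    (hu : Tendsto u atImInfty (𝓝 1)) (hv : Tendsto v atImInfty (𝓝 1))
    (hfW : ∀ z, f (fricke N z) = a * z ^ k * f' z) (huW : ∀ z, u (fricke N z) = b * z ^ k * u z)
    (hvW : ∀ z, v (fricke N z) = c * z ^ k * v z) : α + β = 1 ∧ α * b + β * c = a := by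
  constructor
  · have h1 := (hu.const_mul α).add (hv.const_mul β)
    rw [mul_one, mul_one] at h1
    exact tendsto_nhds_unique (h1.congr fun z => congrFun h z) hf
  · have h1 := ((hu.const_mul (α * b)).add (hv.const_mul (β * c)))
    rw [mul_one, mul_one] at h1
    have h2 := hf'.const_mul a
    rw [mul_one] at h2
    refine tendsto_nhds_unique (h1.congr fun z => ?_) h2
    have h3 := congrFun h (fricke N z)
    simp only [Pi.add_apply, Pi.smul_apply, smul_eq_mul] at h3
    rw [hfW, huW, hvW] at h3
    refine mul_left_cancel₀ (pow_ne_zero k z.ne_zero) ?_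
    linear_combination h3

lemma Q_eq_level_two : Q = (5 / 2 : ℂ) • A ^ 2 + (-3 / 2 : ℂ) • B := by
  have h1 : Q ∈ Submodule.span ℂ {A ^ 2, B} := by
    refine Submodule.span_mono ?_ (IsForm.mem_span_two 2 (isForm_Q.mono (one_dvd _)))
    rintro _ ⟨i, j, h, rfl⟩
    obtain ⟨rfl, rfl⟩ | ⟨rfl, rfl⟩ : (i = 2 ∧ j = 0) ∨ (i = 0 ∧ j = 1) := by omega
    · simp
    · simp
  obtain ⟨α, β, h⟩ := Submodule.mem_span_pair.mp h1
  obtain ⟨h2, h3⟩ := coeff_eq_of_fricke (N := 2) (k := 4) (a := 16) (b := 4) (c := -4)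
    (f' := Q ∘ scale 2) h tendsto_Q (tendsto_Q.comp (tendsto_scale 2))
    (by simpa using! tendsto_A.pow 2) tendsto_B
    (fun z => by rw [IsForm.apply_fricke (k := 4) isForm_Q, Function.comp_apply]; norm_num)
    (fun z => by simp only [Pi.pow_apply, A_fricke]; ring) B_fricke
  rw [← h, show α = 5 / 2 by linear_combination (4 * h2 + h3) / 8,
    show β = -3 / 2 by linear_combination (4 * h2 - h3) / 8]

lemma R_eq_level_two : R = (-7 / 2 : ℂ) • A ^ 3 + (9 / 2 : ℂ) • (A * B) := by
  have h1 : R ∈ Submodule.span ℂ {A ^ 3, A * B} := by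
    refine Submodule.span_mono ?_ (IsForm.mem_span_two 3 (isForm_R.mono (one_dvd _)))
    rintro _ ⟨i, j, h, rfl⟩
    obtain ⟨rfl, rfl⟩ | ⟨rfl, rfl⟩ : (i = 3 ∧ j = 0) ∨ (i = 1 ∧ j = 1) := by omega
    · simp
    · simp
  obtain ⟨α, β, h⟩ := Submodule.mem_span_pair.mp h1
  obtain ⟨h2, h3⟩ := coeff_eq_of_fricke (N := 2) (k := 6) (a := 64) (b := -8) (c := 8)
    (f' := R ∘ scale 2) h tendsto_R (tendsto_R.comp (tendsto_scale 2))
    (by simpa using! tendsto_A.pow 3) (by simpa using! tendsto_A.mul tendsto_B)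
    (fun z => by rw [IsForm.apply_fricke (k := 6) isForm_R, Function.comp_apply]; norm_num)
    (fun z => by simp only [Pi.pow_apply, A_fricke]; ring)
    (fun z => by simp only [Pi.mul_apply, A_fricke, B_fricke]; ring)
  rw [← h, show α = -7 / 2 by linear_combination (8 * h2 - h3) / 16,
    show β = 9 / 2 by linear_combination (8 * h2 + h3) / 16]

lemma Q_eq_level_three : Q = (5 : ℂ) • Th 1 ^ 4 + (-4 : ℂ) • (Th 1 * Phi) := by
  have h1 : Q ∈ Submodule.span ℂ {Th 1 ^ 4, Th 1 * Phi} := by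
    have := isForm_Q.mono (one_dvd 3) |>.congr_char (ψ := chr chi3 ^ 4) fun d hd =>
      (chr_pow_two_mul (N := 3) (fun d hd => chi3_sq dvd_rfl hd) 2 d hd).symm
    refine Submodule.span_mono ?_ (IsForm.mem_span_three 4 this)
    rintro _ ⟨i, j, h, rfl⟩
    obtain ⟨rfl, rfl⟩ | ⟨rfl, rfl⟩ : (i = 4 ∧ j = 0) ∨ (i = 1 ∧ j = 1) := by omega
    · simp
    · simp
  obtain ⟨α, β, h⟩ := Submodule.mem_span_pair.mp h1
  have e : (-Complex.I * Real.sqrt 3) ^ 4 = 9 := by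
    rw [mul_pow, sqrt_three_pow_four, Even.neg_pow (by decide), Complex.I_pow_four, one_mul]
  obtain ⟨h2, h3⟩ := coeff_eq_of_fricke (N := 3) (k := 4) (a := 81) (b := 9) (c := -9)
    (f' := Q ∘ scale 3) h tendsto_Q (tendsto_Q.comp (tendsto_scale 3))
    (by simpa using! (tendsto_Th 1).pow 4) (by simpa using! (tendsto_Th 1).mul tendsto_Phi)
    (fun z => by rw [IsForm.apply_fricke (k := 4) isForm_Q, Function.comp_apply]; norm_num)
    (fun z => by
      rw [Pi.pow_apply, Pi.pow_apply, Th_one_fricke, mul_pow, mul_pow _ (z : ℂ), e])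
    (fun z => by
      rw [Pi.mul_apply, Pi.mul_apply, Th_one_fricke, Phi_fricke]
      linear_combination (-(z : ℂ) ^ 4 * Th 1 z * Phi z) * e)
  rw [← h, show α = 5 by linear_combination (9 * h2 + h3) / 18,
    show β = -4 by linear_combination (9 * h2 - h3) / 18]

/-- The coefficient of `s` vanishes since `A` and `s` have different eigenvalues under the
Atkin–Lehner operator at `2`; the others follow from the values at the cusps `∞` and `0`. -/
lemma A_eq_level_six : A = (2 : ℂ) • p + d := by
  have h1 : A ∈ Submodule.span ℂ {s, p, d} := by
    rw [← Mk_six_two]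
    exact mem_Mk_iff.mpr (isForm_A.mono (by norm_num))
  obtain ⟨α, β, γ, h⟩ := Submodule.mem_span_triple.mp h1
  have hp : Tendsto p atImInfty (𝓝 1) := by simpa using! (tendsto_Th 1).mul (tendsto_Th 2)
  have hd : Tendsto (-d) atImInfty (𝓝 1) := by
    have := (((tendsto_Th 2).pow 2).const_mul 2).sub ((tendsto_Th 1).pow 2)
    norm_num at this
    refine this.congr fun z => ?_
    simp [d]
  have hα : ∀ z, α * s z = 0 := by
    intro z
    have hz := z.ne_zero
    let σ : SL(2, ℤ) := ⟨!![1, 1; 2, 3], by norm_num [Matrix.det_fin_two_of]⟩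
    have hσ : σ ∈ Gamma0 2 := mem_Gamma0_iff.mpr ⟨1, rfl⟩
    have hj : autJ σ (fricke 2 z) = (3 * z - 1) / z := by
      simp [autJ, σ, coe_fricke]
      field_simp
      ring
    have h0 : (3 * z - 1 : ℂ) ≠ 0 := by
      intro h0
      have := autJ_ne_zero σ (fricke 2 z)
      rw [hj, h0, zero_div] at this
      exact this rfl
    have hw : ((σ • fricke 2 z : ℍ) : ℂ) = (2 * z - 1) / (6 * z - 2) := by
      rw [coe_smul_eq, hj, show (6 * z - 2 : ℂ) = 2 * (3 * z - 1) by ring, coe_fricke]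
      simp [σ]
      field_simp
      ring
    obtain ⟨h2, h3⟩ := Th_atkinLehner_two _ _ hw
    have h4 : A (σ • fricke 2 z) = -2 * (3 * z - 1) ^ 2 * A z := by
      have := isForm_A.trans σ hσ (fricke 2 z)
      rw [Pi.one_apply, one_mul, hj, A_fricke] at this
      rw [this, zpow_ofNat]
      field_simp
    have h5 := congrFun h (σ • fricke 2 z)
    have h6 := congrFun h z
    simp only [s, p, d, Pi.add_apply, Pi.sub_apply, Pi.mul_apply, Pi.pow_apply, Pi.smul_apply,
      smul_eq_mul, Pi.ofNat_apply] at h5 h6 ⊢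
    rw [h4, h2, h3] at h5
    refine mul_left_cancel₀ (mul_ne_zero (by norm_num : (4 : ℂ) ≠ 0) (pow_ne_zero 2 h0)) ?_
    linear_combination h5 + 2 * (3 * (z : ℂ) - 1) ^ 2 * h6
  have h2 : β • p + (-γ) • -d = A := by
    rw [← h]
    ext z
    have := hα z
    simp only [Pi.add_apply, Pi.smul_apply, smul_eq_mul, Pi.neg_apply]
    linear_combination -this
  obtain ⟨h3, h4⟩ := coeff_eq_of_fricke (N := 6) (k := 2) (a := -18) (b := -6) (c := 6)
    (f' := A ∘ scale 3) h2 tendsto_A (tendsto_A.comp (tendsto_scale 3)) hp hd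
    (fun z => by
      have : fricke 6 z = fricke 2 (scale 3 z) := by
        have hz := z.ne_zero
        ext1
        rw [coe_fricke, coe_fricke, coe_scale]
        push_cast
        congr 1
        ring
      rw [this, A_fricke, coe_scale, Function.comp_apply]
      push_cast
      ring)
    (fun z => by
      obtain ⟨h3, h4⟩ := Th_fricke_six z
      rw [p, Pi.mul_apply, h3, h4, Pi.mul_apply]
      linear_combination (2 * (z : ℂ) ^ 2 * Th 1 z * Th 2 z) * I_mul_sqrt_three_sq)
    (fun z => by
      obtain ⟨h3, h4⟩ := Th_fricke_six z
      simp only [d, Pi.neg_apply, Pi.sub_apply, Pi.mul_apply, Pi.pow_apply, Pi.ofNat_apply, h3, h4]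
      linear_combination (-(2 * (z : ℂ) ^ 2) * (2 * Th 2 z ^ 2 - Th 1 z ^ 2)) *
        I_mul_sqrt_three_sq)
  rw [← h2, show β = 2 by linear_combination (6 * h3 - h4) / 12,
    show γ = 1 by linear_combination (-6 * h3 - h4) / 12]
  simp

theorem Q_eq_Th : Q = Th 1 * (5 * Th 1 ^ 3 + 12 * Th 1 ^ 2 * Th 2 - 16 * Th 2 ^ 3) := by
  rw [Q_eq_level_three, Phi]
  ext z
  simp
  ring

theorem Q_eq_th : Q = th 1 ^ 8 + 56 * th 1 ^ 6 * th 2 ^ 2 - 40 * th 1 ^ 4 * th 2 ^ 4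
    - 32 * th 1 ^ 2 * th 2 ^ 6 + 16 * th 2 ^ 8 := by
  rw [Q_eq_level_two, A, B]
  ext z
  simp
  ring

theorem R_eq_th : R = (th 1 ^ 4 + 4 * th 1 ^ 2 * th 2 ^ 2 - 4 * th 2 ^ 4) *
    (th 1 ^ 8 - 136 * th 1 ^ 6 * th 2 ^ 2 + 152 * th 1 ^ 4 * th 2 ^ 4
      - 32 * th 1 ^ 2 * th 2 ^ 6 + 16 * th 2 ^ 8) := by
  rw [R_eq_level_two, A, B]
  ext z
  simp
  ring

theorem R_eq_Th : R = (Th 1 ^ 2 + 2 * Th 1 * Th 2 - 2 * Th 2 ^ 2) *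
    (-11 * Th 1 ^ 4 - 20 * Th 1 ^ 3 * Th 2 + 16 * Th 1 * Th 2 ^ 3 + 16 * Th 2 ^ 4) := by
  -- eliminate `B` from the formulas of level `2`
  have h : R = (4 : ℂ) • A ^ 3 - (3 : ℂ) • (A * Q) := by
    rw [Q_eq_level_two, R_eq_level_two]
    ext z
    simp
    ring
  rw [h, A_eq_level_six, Q_eq_Th, p, d]
  ext z
  simp
  ring

end SmallLevel

theorem mainTheorem1 :
    -- the common subring of level one, and `Q` and `R` in terms of theta series
    ((∀ N ∈ ({2, 3, 4, 6, 8} : Set ℕ), M 1 ≤ M N) ∧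
      Q = Th 1 * (5 * Th 1 ^ 3 + 12 * Th 1 ^ 2 * Th 2 - 16 * Th 2 ^ 3) ∧
      Q = th 1 ^ 8 + 56 * th 1 ^ 6 * th 2 ^ 2 - 40 * th 1 ^ 4 * th 2 ^ 4
        - 32 * th 1 ^ 2 * th 2 ^ 6 + 16 * th 2 ^ 8 ∧
      R = (Th 1 ^ 2 + 2 * Th 1 * Th 2 - 2 * Th 2 ^ 2) *
        (-11 * Th 1 ^ 4 - 20 * Th 1 ^ 3 * Th 2 + 16 * Th 1 * Th 2 ^ 3 + 16 * Th 2 ^ 4) ∧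
      R = (th 1 ^ 4 + 4 * th 1 ^ 2 * th 2 ^ 2 - 4 * th 2 ^ 4) *
        (th 1 ^ 8 - 136 * th 1 ^ 6 * th 2 ^ 2 + 152 * th 1 ^ 4 * th 2 ^ 4
          - 32 * th 1 ^ 2 * th 2 ^ 6 + 16 * th 2 ^ 8)) ∧
    -- level 2
    (AlgebraicIndependent ℂ ![A, B] ∧
      M 2 = hatM A B ∧
      (∀ n : ℕ, Mk 2 (2 * n) = hatMk A B 2 4 (2 * n)) ∧
      A ∈ Mk 2 2 ∧ AtkinLehner 2 2 2 A (-A) ∧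
      B ∈ Mk 2 4 ∧ AtkinLehner 2 2 4 B (-B) ∧
      et 1 ^ 8 * et 2 ^ 8 = ((2 : ℂ) ^ 8)⁻¹ • (A ^ 4 - B ^ 2) ∧
      et 1 ^ 8 * et 2 ^ 8 ∈ Sk 2 8 ∧
      AtkinLehner 2 2 8 (et 1 ^ 8 * et 2 ^ 8) (et 1 ^ 8 * et 2 ^ 8) ∧
      ∃ h : et 1 ^ 8 * et 2 ^ 8 ∈ M 2, S 2 = Ideal.span {⟨et 1 ^ 8 * et 2 ^ 8, h⟩}) ∧
    -- level 3
    (AlgebraicIndependent ℂ ![Th 1, Phi] ∧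
      Th 1 ∈ MkChar 3 chi3 1 ∧ Phi ∈ MkChar 3 chi3 3 ∧
      M 3 ≤ hatM (Th 1) Phi ∧
      Subalgebra.toSubmodule (M 3) = hatMEven (Th 1) Phi 1 3 ∧
      (∀ n : ℕ, Mk 3 (2 * n) = hatMk (Th 1) Phi 1 3 (2 * n)) ∧
      (∀ (n : ℕ) (F : MvPolynomial (Fin 2) ℂ),
        MvPolynomial.IsWeightedHomogeneous ![(1 : ℚ), 3] F (2 * n) →
        AtkinLehner 3 3 (2 * n) (MvPolynomial.aeval ![Th 1, Phi] F)
          (MvPolynomial.aeval ![Complex.I • Th 1, Complex.I • Phi] F)) ∧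
      et 1 ^ 6 * et 3 ^ 6 = ((2 : ℂ) ^ 2 * 3 ^ 3)⁻¹ • (Th 1 ^ 6 - Phi ^ 2) ∧
      et 1 ^ 6 * et 3 ^ 6 ∈ Sk 3 6 ∧
      AtkinLehner 3 3 6 (et 1 ^ 6 * et 3 ^ 6) (-(et 1 ^ 6 * et 3 ^ 6)) ∧
      ∃ h : et 1 ^ 6 * et 3 ^ 6 ∈ M 3, S 3 = Ideal.span {⟨et 1 ^ 6 * et 3 ^ 6, h⟩}) ∧
    -- level 4
    (AlgebraicIndependent ℂ ![th 1, D] ∧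
      AlgebraicIndependent ℂ ![C, D] ∧
      M 4 ≤ hatM (th 1) D ∧
      Subalgebra.toSubmodule (M 4) = hatMEven (th 1) D (1 / 2) 2 ∧
      M 4 = hatM C D ∧
      (∀ n : ℕ, Mk 4 (2 * n) = hatMk (th 1) D (1 / 2) 2 (2 * n)) ∧
      (∀ n : ℕ, Mk 4 (2 * n) = hatMk C D 2 2 (2 * n)) ∧
      (∀ n : ℕ, MkChar 4 ZMod.χ₄ (2 * n + 1) = hatMk (th 1) D (1 / 2) 2 (2 * n + 1)) ∧
      (∀ ρ : ℂ, IsPrimitiveRoot ρ 8 → ∀ (n : ℕ) (F : MvPolynomial (Fin 2) ℂ),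
        MvPolynomial.IsWeightedHomogeneous ![(1 / 2 : ℚ), 2] F (2 * n) →
        AtkinLehner 4 4 (2 * n) (MvPolynomial.aeval ![th 1, D] F)
          (MvPolynomial.aeval ![ρ • th 1, D] F)) ∧
      C ∈ Mk 4 2 ∧ AtkinLehner 4 4 2 C (-C) ∧
      D ∈ Mk 4 2 ∧ AtkinLehner 4 4 2 D D ∧
      et 2 ^ 12 = ((2 : ℂ) ^ 6)⁻¹ • (C * (C ^ 2 - D ^ 2)) ∧
      et 2 ^ 12 ∈ Sk 4 6 ∧
      AtkinLehner 4 4 6 (et 2 ^ 12) (-et 2 ^ 12) ∧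
      ∃ h : et 2 ^ 12 ∈ M 4, S 4 = Ideal.span {⟨et 2 ^ 12, h⟩}) ∧
    -- level 6
    (AlgebraicIndependent ℂ ![Th 1, Th 2] ∧
      M 6 ≤ hatM (Th 1) (Th 2) ∧
      Subalgebra.toSubmodule (M 6) = hatMEven (Th 1) (Th 2) 1 1 ∧
      M 6 = Algebra.adjoin ℂ {Th 1 ^ 2, Th 1 * Th 2, Th 2 ^ 2} ∧
      (∀ n : ℕ, Mk 6 (2 * n) = hatMk (Th 1) (Th 2) 1 1 (2 * n)) ∧
      LinearIndependent ℂ ![s, p, d] ∧ Mk 6 2 = Submodule.span ℂ {s, p, d} ∧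
      AtkinLehner 6 2 2 s s ∧ AtkinLehner 6 3 2 s (-s) ∧
      AtkinLehner 6 2 2 p (-p) ∧ AtkinLehner 6 3 2 p p ∧
      AtkinLehner 6 2 2 d (-d) ∧ AtkinLehner 6 3 2 d (-d) ∧
      s ^ 2 - d ^ 2 = 8 * p ^ 2 ∧
      (∀ f ∈ M 6, ∃! F : MvPolynomial (Fin 2) ℂ × MvPolynomial (Fin 2) ℂ,
        f = MvPolynomial.aeval ![s, p] F.1 + d * MvPolynomial.aeval ![s, p] F.2) ∧
      et 1 ^ 2 * et 2 ^ 2 * et 3 ^ 2 * et 6 ^ 2 =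
        ((2 : ℂ) ^ 2 * 3 ^ 2)⁻¹ • (9 * p ^ 2 - s ^ 2) ∧
      et 1 ^ 2 * et 2 ^ 2 * et 3 ^ 2 * et 6 ^ 2 ∈ Sk 6 4 ∧
      AtkinLehner 6 2 4 (et 1 ^ 2 * et 2 ^ 2 * et 3 ^ 2 * et 6 ^ 2)
        (et 1 ^ 2 * et 2 ^ 2 * et 3 ^ 2 * et 6 ^ 2) ∧
      AtkinLehner 6 3 4 (et 1 ^ 2 * et 2 ^ 2 * et 3 ^ 2 * et 6 ^ 2)
        (et 1 ^ 2 * et 2 ^ 2 * et 3 ^ 2 * et 6 ^ 2) ∧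
      ∃ h : et 1 ^ 2 * et 2 ^ 2 * et 3 ^ 2 * et 6 ^ 2 ∈ M 6,
        S 6 = Ideal.span {⟨et 1 ^ 2 * et 2 ^ 2 * et 3 ^ 2 * et 6 ^ 2, h⟩}) ∧
    -- level 8
    (AlgebraicIndependent ℂ ![th 1, th 2] ∧
      M 8 ≤ hatM (th 1) (th 2) ∧
      M 8 = Algebra.adjoin ℂ {th 1 ^ 4, th 1 ^ 2 * th 2 ^ 2, th 2 ^ 4} ∧
      (∀ n : ℕ, Mk 8 (2 * n) = Submodule.span ℂ
        {f | ∃ i j : ℕ, Even i ∧ Even j ∧ i + j = 4 * n ∧ f = th 1 ^ i * th 2 ^ j}) ∧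
      (∀ n : ℕ, MkChar 8 ZMod.χ₈ (2 * n) = Submodule.span ℂ
        {f | ∃ i j : ℕ, Odd i ∧ Odd j ∧ i + j = 4 * n ∧ f = th 1 ^ i * th 2 ^ j}) ∧
      (∀ n : ℕ, hatMk (th 1) (th 2) (1 / 2) (1 / 2) (2 * n) =
        Mk 8 (2 * n) ⊔ MkChar 8 ZMod.χ₈ (2 * n)) ∧
      (⨆ k : ℕ, hatMk (th 1) (th 2) (1 / 2) (1 / 2) k) =
        Subalgebra.toSubmodule (Algebra.adjoin ℂ {th 1 ^ 2, th 2 ^ 2, th 1 * th 2}) ∧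
      th 1 ^ 2 ∈ MkChar 8 ZMod.χ₄ 1 ∧ th 2 ^ 2 ∈ MkChar 8 ZMod.χ₄ 1 ∧
      th 1 * th 2 ∈ MkChar 8 ZMod.χ₈' 1 ∧
      et 2 ^ 4 * et 4 ^ 4 = ((2 : ℂ) ^ 2)⁻¹ •
        (th 1 ^ 2 * th 2 ^ 2 * (-th 1 ^ 2 + th 2 ^ 2) * (th 1 ^ 2 - 2 * th 2 ^ 2)) ∧
      et 2 ^ 4 * et 4 ^ 4 ∈ Sk 8 4 ∧
      AtkinLehner 8 8 4 (et 2 ^ 4 * et 4 ^ 4) (et 2 ^ 4 * et 4 ^ 4) ∧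
      ∃ h : et 2 ^ 4 * et 4 ^ 4 ∈ M 8, S 8 = Ideal.span {⟨et 2 ^ 4 * et 4 ^ 4, h⟩}) := by
  have span {N n : ℕ} [NeZero N] {k : ℤ} {E : UpperHalfPlane → ℂ} (h : IsCuspGenerator N k E)
      (hk : k = 2 * (n : ℤ)) : ∃ h : E ∈ M N, S N = Ideal.span {⟨E, h⟩} :=
    IsCuspGenerator.S_eq_span (n := n) (hk ▸ h)
  have mem_M {N n : ℕ} {k : ℤ} {f : UpperHalfPlane → ℂ} (hf : f ∈ Mk N k) (hk : k = 2 * (n : ℤ)) :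
      f ∈ M N :=
    Mk_le_M N n (hk ▸ hf)
  have hA : A ∈ Mk 2 2 := mem_Mk_iff.mpr isForm_A
  have hB : B ∈ Mk 2 4 := mem_Mk_iff.mpr isForm_B
  have hC : C ∈ Mk 4 2 := mem_Mk_iff.mpr isForm_C
  have hD : D ∈ Mk 4 2 := mem_Mk_iff.mpr isForm_D
  have four n : Mk 4 (2 * (n : ℕ)) = hatMk (th 1) D (1 / 2) 2 (2 * n) :=
    (Mk_four_eq n).trans (hatMk_C_D n)
  refine ⟨⟨?_, Q_eq_Th, Q_eq_th, R_eq_Th, R_eq_th⟩,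
    ⟨algebraicIndependent_A_B,
      M_eq_hatM Mk_two_eq (mem_M (n := 1) hA rfl) (mem_M (n := 2) hB rfl),
      Mk_two_eq, hA, atkinLehner_A, hB, atkinLehner_B, et_pow_mul_pow_two,
      isCuspGenerator_two.mem_Sk, atkinLehner_et_two, span (n := 4) isCuspGenerator_two rfl⟩,
    ⟨algebraicIndependent_Th_Phi, (mem_MkChar_iff dvd_rfl _).mpr isForm_Th_one,
      (mem_MkChar_iff dvd_rfl _).mpr isForm_Phi, M_le_hatM Mk_three_eq,
      toSubmodule_M_eq Mk_three_eq, Mk_three_eq, atkinLehner_three, et_pow_mul_pow_three,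
      isCuspGenerator_three.mem_Sk, atkinLehner_et_three,
      span (n := 3) isCuspGenerator_three rfl⟩,
    ⟨algebraicIndependent_th_D, algebraicIndependent_C_D, M_le_hatM four, toSubmodule_M_eq four,
      M_eq_hatM Mk_four_eq (mem_M (n := 1) hC rfl) (mem_M (n := 1) hD rfl), four, Mk_four_eq,
      MkChar_four_eq, atkinLehner_four, hC, atkinLehner_C, hD, atkinLehner_D, et_pow_four,
      isCuspGenerator_four.mem_Sk, atkinLehner_et_four, span (n := 3) isCuspGenerator_four rfl⟩,
    ⟨algebraicIndependent_Th_Th, M_le_hatM Mk_six_eq, toSubmodule_M_eq Mk_six_eq, M_six_eq,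
      Mk_six_eq, linearIndependent_s_p_d, Mk_six_two, atkinLehner_s_two, atkinLehner_s_three,
      atkinLehner_p_two, atkinLehner_p_three, atkinLehner_d_two, atkinLehner_d_three,
      s_sq_sub_d_sq, fun f hf => existsUnique_aeval_add_d_mul hf, et_pow_six,
      isCuspGenerator_six.mem_Sk, atkinLehner_et_six_two, atkinLehner_et_six_three,
      span (n := 2) isCuspGenerator_six rfl⟩,
    ⟨algebraicIndependent_th_th, ?_, M_eight_eq, Mk_eight_eq, MkChar_eight_eq, hatMk_eight_eq,
      iSup_hatMk_eight,
      (mem_MkChar_iff (by norm_num : 4 ∣ 8) _).mpr isForm_th_one_sq_eight,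
      (mem_MkChar_iff (by norm_num : 4 ∣ 8) _).mpr isForm_th_two_sq,
      (mem_MkChar_iff dvd_rfl _).mpr isForm_th_mul_th, et_pow_eight,
      isCuspGenerator_eight.mem_Sk, atkinLehner_et_eight,
      span (n := 2) isCuspGenerator_eight rfl⟩⟩
  · rintro N (rfl | rfl | rfl | rfl | rfl) <;> exact M_mono (one_dvd _)
  · have h1 : th 1 ∈ hatM (th 1) (th 2) := Algebra.subset_adjoin (by simp)
    have h2 : th 2 ∈ hatM (th 1) (th 2) := Algebra.subset_adjoin (by simp)
    rw [M_eight_eq]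
    refine Algebra.adjoin_le ?_
    rintro _ (rfl | rfl | rfl)
    exacts [pow_mem h1 _, mul_mem (pow_mem h1 _) (pow_mem h2 _), pow_mem h2 _]
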